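/- Theorem (Profunctor representation theorem). Let $\mathcal V$ be a Bénabou cosmos, i.e. a complete and cocomplete symmetric monoidal closed category, and write $\mathcal V(X,Y)$ for its internal hom. Let $(\mathbf M,\otimes,I)$ be a small monoidal $\mathcal V$-category, let $\mathbf C$ and $\mathbf D$ be small $\mathcal V$-categories, and let $\oslash\colon \mathbf M\otimes\mathbf C\to\mathbf C$ and $\oslash'\colon \mathbf M\otimes\mathbf D\to\mathbf D$ be strong monoidal actions of $\mathbf M$, with ($\mathcal V$-natural, coherent) structure isomorphisms $$\phi_A\colon A\cong I\oslash A,\quad \phi_{M,N,A}\colon M\oslash(N\oslash A)\cong(M\otimes N)\oslash A,\quad \varphi_B\colon B\cong I\oslash' B,\quad \varphi_{M,N,B}\colon M\oslash'(N\oslash' B)\cong(M\otimes N)\oslash' B .$$ A (generalized) Tambara module is a $\mathcal V$-profunctor $P\colon\mathbf C^{op}\otimes\mathbf D\to\mathcal V$ with morphisms $\alpha_{M,A,B}\colon P(A,B)\to P(M\oslash A,M\oslash' B)$ in $\mathcal V$ that are $\mathcal V$-natural in $A$ and $B$, $\mathcal V$-dinatural in $M$, and satisfy $$P(\phi_A,\varphi_B^{-1})\circ\alpha_{I,A,B}=\mathrm{id},\qquad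 P(\phi_{M,N,A},\varphi^{-1}_{M,N,B})\circ\alpha_{M\otimes N,A,B}=\alpha_{M,N\oslash A,N\oslash' B}\circ\alpha_{N,A,B}.$$ Tambara modules form a $\mathcal V$-category $\mathbf{Tamb}$, whose hom-object from $(P,\alpha)$ to $(Q,\alpha')$ is the intersection, over all $M,A,B$, of the equalizers of the two maps $$\mathcal V(\mathrm{id},\alpha'_{M,A,B})\circ\pi_{A,B},\quad \mathcal V(\alpha_{M,A,B},\mathrm{id})\circ\pi_{M\oslash A,M\oslash' B}\ \colon\ \int_{A,B}\mathcal V(P(A,B),Q(A,B))\rightrightarrows\mathcal V\big(P(A,B),Q(M\oslash A,M\oslash' B)\big).$$ Let $A,S\in\mathbf C$ and $B,T\in\mathbf D$, and put $$\mathbf{Optic}((A,B),(S,T))=\int^{M\in\mathbf M}\mathbf C(S,M\oslash A)\otimes\mathbf D(M\oslash' B,T).$$ Then the $\mathcal V$-enriched end $\int_{P\in\mathbf{Tamb}}\mathcal V(P(A,B),P(S,T))$ exists in $\mathcal V$ (although $\mathbf{Tamb}$ need not be small), and there is an isomorphism in $\mathcal V$ $$\int_{P\in\mathbf{Tamb}}\mathcal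 V(P(A,B),P(S,T))\;\cong\;\mathbf{Optic}((A,B),(S,T)).$$ This isomorphism is the canonical one: for all $M\in\mathbf M$ and $(P,\alpha)\in\mathbf{Tamb}$, its inverse, precomposed with the coend inclusion at $M$ and followed by the end projection at $P$, is the composite $$\mathbf C(S,M\oslash A)\otimes\mathbf D(M\oslash' B,T)\xrightarrow{\ P\ }\mathcal V\big(P(M\oslash A,M\oslash' B),P(S,T)\big)\xrightarrow{\ \mathcal V(\alpha_{M,A,B},\,\mathrm{id})\ }\mathcal V(P(A,B),P(S,T)).$$ -/

import Mathlib

open CategoryTheory MonoidalCategory Limits Opposite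
open scoped CategoryTheory.MonoidalClosed

universe v u u₁ u₂ u₃ u₄

set_option linter.unusedSectionVars false

noncomputable section

namespace EnrichedOptics

section Coherence

variable {V : Type v} [Category.{u} V] [MonoidalCategory V]

lemma tensorμ_assoc_aux [BraidedCategory V] {X₁ X₂ X₃ Y₁ Y₂ Y₃ Z₁ Z₂ Z₃ : V}
    (c₁ : X₁ ⊗ Y₁ ⟶ Z₁) (c₂ : X₂ ⊗ Y₂ ⟶ Z₂) (c₃ : X₃ ⊗ Y₃ ⟶ Z₃) :
    (tensorμ (X₁ ⊗ X₂) X₃ (Y₁ ⊗ Y₂) Y₃ ≫ ((tensorμ X₁ X₂ Y₁ Y₂ ≫ (c₁ ⊗ₘ c₂)) ⊗ₘ c₃)) ≫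
        (α_ Z₁ Z₂ Z₃).hom =
      ((α_ X₁ X₂ X₃).hom ⊗ₘ (α_ Y₁ Y₂ Y₃).hom) ≫ tensorμ X₁ (X₂ ⊗ X₃) Y₁ (Y₂ ⊗ Y₃) ≫
        (c₁ ⊗ₘ (tensorμ X₂ X₃ Y₂ Y₃ ≫ (c₂ ⊗ₘ c₃))) := by
  have h₁ : ((tensorμ X₁ X₂ Y₁ Y₂ ≫ (c₁ ⊗ₘ c₂)) ⊗ₘ c₃) =
      (tensorμ X₁ X₂ Y₁ Y₂ ▷ (X₃ ⊗ Y₃)) ≫ ((c₁ ⊗ₘ c₂) ⊗ₘ c₃) := by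
    rw [← tensorHom_id, tensorHom_comp_tensorHom, Category.id_comp]
  have h₂ : (c₁ ⊗ₘ (tensorμ X₂ X₃ Y₂ Y₃ ≫ (c₂ ⊗ₘ c₃))) =
      ((X₁ ⊗ Y₁) ◁ tensorμ X₂ X₃ Y₂ Y₃) ≫ (c₁ ⊗ₘ (c₂ ⊗ₘ c₃)) := by
    rw [← id_tensorHom, tensorHom_comp_tensorHom, Category.id_comp]
  rw [h₁, h₂, Category.assoc, Category.assoc, associator_naturality, associator_monoidal_assoc]

lemma tensorμ_swap_aux [SymmetricCategory V] {X₁ X₂ Y₁ Y₂ Z₁ Z₂ : V}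
    (c₁ : X₁ ⊗ Y₁ ⟶ Z₁) (c₂ : X₂ ⊗ Y₂ ⟶ Z₂) :
    (tensorμ X₁ X₂ Y₁ Y₂ ≫ (c₁ ⊗ₘ c₂)) ≫ (β_ Z₁ Z₂).hom =
      ((β_ X₁ X₂).hom ⊗ₘ (β_ Y₁ Y₂).hom) ≫ tensorμ X₂ X₁ Y₂ Y₁ ≫ (c₂ ⊗ₘ c₁) := by
  have h : tensorμ X₁ X₂ Y₁ Y₂ ≫ (β_ (X₁ ⊗ Y₁) (X₂ ⊗ Y₂)).hom =
      ((β_ X₁ X₂).hom ⊗ₘ (β_ Y₁ Y₂).hom) ≫ tensorμ X₂ X₁ Y₂ Y₁ := by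
    simp [tensorμ, SymmetricCategory.braiding_swap_eq_inv_braiding Y₁ X₂,
      MonoidalCategory.tensorHom_def]
  rw [Category.assoc, BraidedCategory.braiding_naturality, ← Category.assoc, h, Category.assoc]

lemma tensorμ_left_aux [BraidedCategory V] {E X Y Z : V} (e : 𝟙_ V ⟶ E) (m : E ⊗ E ⟶ E)
    (h : (λ_ E).inv ≫ e ▷ E ≫ m = 𝟙 E) (c : X ⊗ Y ⟶ Z) :
    c ≫ (λ_ Z).inv ≫ e ▷ Z =
      (((λ_ X).inv ≫ e ▷ X) ⊗ₘ ((λ_ Y).inv ≫ e ▷ Y)) ≫ tensorμ E X E Y ≫ (m ⊗ₘ c) := by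
  have h₁ : ((λ_ X).inv ⊗ₘ (λ_ Y).inv) ≫ tensorμ (𝟙_ V) X (𝟙_ V) Y =
      (λ_ (X ⊗ Y)).inv ≫ (λ_ (𝟙_ V)).inv ▷ (X ⊗ Y) := by
    have := leftUnitor_monoidal X Y
    rw [← cancel_epi ((λ_ X).hom ⊗ₘ (λ_ Y).hom), ← cancel_mono ((λ_ (𝟙_ V)).hom ▷ (X ⊗ Y)),
      ← cancel_mono (λ_ (X ⊗ Y)).hom]
    simp only [Category.assoc, tensorHom_comp_tensorHom_assoc, Iso.hom_inv_id, id_tensorHom_id,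
      Category.id_comp, ← this, inv_hom_whiskerRight_assoc, Iso.inv_hom_id, Category.comp_id]
  have h₂ : (λ_ (𝟙_ V)).inv ≫ (e ⊗ₘ e) ≫ m = e := by
    rw [MonoidalCategory.tensorHom_def', Category.assoc, ← leftUnitor_inv_naturality_assoc, h,
      Category.comp_id]
  have h₃ : (λ_ (𝟙_ V)).inv ▷ (X ⊗ Y) ≫ (((e ⊗ₘ e) ≫ m) ⊗ₘ c) = (e ⊗ₘ c) := by
    rw [← tensorHom_id, tensorHom_comp_tensorHom, h₂, Category.id_comp]
  rw [← tensorHom_comp_tensorHom, Category.assoc, ← tensorHom_id e X, ← tensorHom_id e Y,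
    tensorμ_natural_assoc, reassoc_of% h₁, tensorHom_comp_tensorHom, id_tensorHom_id,
    Category.id_comp, h₃, MonoidalCategory.tensorHom_def', leftUnitor_inv_naturality_assoc]

lemma tensorμ_right_aux [BraidedCategory V] {E X Y Z : V} (e : 𝟙_ V ⟶ E) (m : E ⊗ E ⟶ E)
    (h : (λ_ E).inv ≫ e ▷ E ≫ m = 𝟙 E) (c : X ⊗ Y ⟶ Z) :
    c ≫ (ρ_ Z).inv ≫ Z ◁ e =
      (((ρ_ X).inv ≫ X ◁ e) ⊗ₘ ((ρ_ Y).inv ≫ Y ◁ e)) ≫ tensorμ X E Y E ≫ (c ⊗ₘ m) := by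
  have h₁ : ((ρ_ X).inv ⊗ₘ (ρ_ Y).inv) ≫ tensorμ X (𝟙_ V) Y (𝟙_ V) =
      (ρ_ (X ⊗ Y)).inv ≫ (X ⊗ Y) ◁ (λ_ (𝟙_ V)).inv := by
    have := rightUnitor_monoidal X Y
    rw [← cancel_epi ((ρ_ X).hom ⊗ₘ (ρ_ Y).hom), ← cancel_mono ((X ⊗ Y) ◁ (λ_ (𝟙_ V)).hom),
      ← cancel_mono (ρ_ (X ⊗ Y)).hom]
    simp only [Category.assoc, tensorHom_comp_tensorHom_assoc, Iso.hom_inv_id, id_tensorHom_id,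
      Category.id_comp, ← this, whiskerLeft_inv_hom_assoc, Iso.inv_hom_id, Category.comp_id]
  have h₂ : (λ_ (𝟙_ V)).inv ≫ (e ⊗ₘ e) ≫ m = e := by
    rw [MonoidalCategory.tensorHom_def', Category.assoc, ← leftUnitor_inv_naturality_assoc, h,
      Category.comp_id]
  have h₃ : (X ⊗ Y) ◁ (λ_ (𝟙_ V)).inv ≫ (c ⊗ₘ ((e ⊗ₘ e) ≫ m)) = (c ⊗ₘ e) := by
    rw [← id_tensorHom, tensorHom_comp_tensorHom, h₂, Category.id_comp]
  rw [← tensorHom_comp_tensorHom, Category.assoc, ← id_tensorHom X e, ← id_tensorHom Y e,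
    tensorμ_natural_assoc, reassoc_of% h₁, tensorHom_comp_tensorHom, id_tensorHom_id,
    Category.id_comp, h₃, MonoidalCategory.tensorHom_def, rightUnitor_inv_naturality_assoc]

lemma uncurry_tensorHom_comp [MonoidalClosed V] {X Y Z A B : V} (f : A ⟶ (ihom X).obj Y)
    (g : B ⟶ (ihom Y).obj Z) :
    MonoidalClosed.uncurry ((f ⊗ₘ g) ≫ MonoidalClosed.comp X Y Z) =
      (α_ X A B).inv ≫ MonoidalClosed.uncurry f ▷ B ≫ MonoidalClosed.uncurry g := by
  rw [MonoidalClosed.uncurry_natural_left, MonoidalClosed.comp_eq, MonoidalClosed.uncurry_curry,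
    MonoidalClosed.compTranspose_eq, MonoidalClosed.uncurry_eq, MonoidalClosed.uncurry_eq]
  simp only [comp_whiskerRight, Category.assoc]
  rw [MonoidalCategory.tensorHom_def, MonoidalCategory.whiskerLeft_comp, Category.assoc,
    associator_inv_naturality_right_assoc, associator_inv_naturality_middle_assoc,
    whisker_exchange_assoc]
  rfl

lemma actions_aux [BraidedCategory V] {O₀₀ O₁₀ O₁₁ O₂₀ O₂₁ O₂₂ f g f' g' ff gg : V}
    (l : O₀₀ ⊗ f ⟶ O₁₀) (r : O₁₀ ⊗ g ⟶ O₁₁) (l' : O₁₁ ⊗ f' ⟶ O₂₁) (r' : O₂₁ ⊗ g' ⟶ O₂₂)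
    (l'' : O₁₀ ⊗ f' ⟶ O₂₀) (r'' : O₂₀ ⊗ g ⟶ O₂₁) (cf : f ⊗ f' ⟶ ff) (cg : g ⊗ g' ⟶ gg)
    (L : O₀₀ ⊗ ff ⟶ O₂₀) (R : O₂₀ ⊗ gg ⟶ O₂₂)
    (hl : (α_ _ _ _).hom ≫ O₀₀ ◁ cf ≫ L = l ▷ f' ≫ l'')
    (hr : (α_ _ _ _).hom ≫ O₂₀ ◁ cg ≫ R = r'' ▷ g' ≫ r')
    (hc : r ▷ f' ≫ l' = (α_ _ _ _).hom ≫ O₁₀ ◁ (β_ g f').hom ≫ (α_ _ _ _).inv ≫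
      l'' ▷ g ≫ r'') :
    O₀₀ ◁ (tensorμ f g f' g' ≫ (cf ⊗ₘ cg)) ≫ (α_ _ _ _).inv ≫ L ▷ gg ≫ R =
      (α_ _ _ _).inv ≫ ((α_ _ _ _).inv ≫ l ▷ g ≫ r) ▷ (f' ⊗ g') ≫ (α_ _ _ _).inv ≫
        l' ▷ g' ≫ r' := by
  have hl' : O₀₀ ◁ cf ≫ L = (α_ _ _ _).inv ≫ l ▷ f' ≫ l'' := by rw [← hl, Iso.inv_hom_id_assoc]
  have hr' : O₂₀ ◁ cg ≫ R = (α_ _ _ _).inv ≫ r'' ▷ g' ≫ r' := by rw [← hr, Iso.inv_hom_id_assoc]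
  calc
    _ = 𝟙 _ ⊗≫ O₀₀ ◁ f ◁ (β_ g f').hom ▷ g' ⊗≫ (O₀₀ ◁ cf) ▷ (g ⊗ g') ⊗≫
        ((O₀₀ ⊗ ff) ◁ cg ≫ L ▷ gg) ≫ R := by
      rw [MonoidalCategory.tensorHom_def]; dsimp only [tensorμ]; monoidal
    _ = 𝟙 _ ⊗≫ O₀₀ ◁ f ◁ (β_ g f').hom ▷ g' ⊗≫ (O₀₀ ◁ cf ≫ L) ▷ (g ⊗ g') ⊗≫
        (O₂₀ ◁ cg ≫ R) := by
      rw [whisker_exchange]; monoidal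
    _ = 𝟙 _ ⊗≫ (((O₀₀ ⊗ f) ◁ (β_ g f').hom ≫ l ▷ (f' ⊗ g)) ⊗≫ l'' ▷ g) ▷ g' ⊗≫
        r'' ▷ g' ≫ r' := by
      rw [hl', hr']; monoidal
    _ = 𝟙 _ ⊗≫ l ▷ g ▷ f' ▷ g' ⊗≫ ((α_ _ _ _).hom ≫ O₁₀ ◁ (β_ g f').hom ≫ (α_ _ _ _).inv ≫
        l'' ▷ g ≫ r'') ▷ g' ⊗≫ r' := by
      rw [whisker_exchange]; monoidal
    _ = _ := by
      rw [← hc]; monoidal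
lemma actions_unit_aux {O f g : V} (l : O ⊗ f ⟶ O) (r : O ⊗ g ⟶ O) (e : 𝟙_ V ⟶ f)
    (e' : 𝟙_ V ⟶ g) (hl : O ◁ e ≫ l = (ρ_ O).hom) (hr : O ◁ e' ≫ r = (ρ_ O).hom) :
    O ◁ ((λ_ (𝟙_ V)).inv ≫ (e ⊗ₘ e')) ≫ (α_ _ _ _).inv ≫ l ▷ g ≫ r = (ρ_ O).hom := by
  calc
    _ = 𝟙 _ ⊗≫ O ◁ e ▷ 𝟙_ V ⊗≫ ((O ⊗ f) ◁ e' ≫ l ▷ g) ≫ r := by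
      rw [MonoidalCategory.tensorHom_def]; monoidal
    _ = 𝟙 _ ⊗≫ (O ◁ e ≫ l) ▷ 𝟙_ V ⊗≫ (O ◁ e' ≫ r) := by
      rw [whisker_exchange]; monoidal
    _ = _ := by rw [hl, hr]; monoidal

lemma hom_unit_aux [BraidedCategory V] {H E : V} (e : 𝟙_ V ⟶ E) (c : E ⊗ H ⟶ H)
    (h : (λ_ H).inv ≫ e ▷ H ≫ c = 𝟙 H) : H ◁ e ≫ (β_ H E).hom ≫ c = (ρ_ H).hom := by
  rw [BraidedCategory.braiding_naturality_right_assoc, ← braiding_leftUnitor, 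
    ← Category.comp_id (λ_ H).hom, ← (Iso.inv_comp_eq _).1 h]

lemma hom_comp_aux [BraidedCategory V] {H f f' ff Y Z : V} (c : f' ⊗ f ⟶ ff) (c' : ff ⊗ H ⟶ Z)
    (c'' : f ⊗ H ⟶ Y) (c''' : f' ⊗ Y ⟶ Z)
    (h : (α_ _ _ _).hom ≫ f' ◁ c'' ≫ c''' = c ▷ H ≫ c') :
    (α_ _ _ _).hom ≫ H ◁ ((β_ f f').hom ≫ c) ≫ (β_ H ff).hom ≫ c' =
      ((β_ H f).hom ≫ c'') ▷ f' ≫ (β_ Y f').hom ≫ c''' := by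
  have h' : f' ◁ c'' ≫ c''' = (α_ _ _ _).inv ≫ c ▷ H ≫ c' := by
    rw [← h, Iso.inv_hom_id_assoc]
  rw [MonoidalCategory.whiskerLeft_comp, Category.assoc,
    BraidedCategory.braiding_naturality_right_assoc, 
    BraidedCategory.braiding_naturality_right_assoc,
    BraidedCategory.braiding_naturality_left_assoc, MonoidalCategory.whiskerLeft_comp,
    Category.assoc, h']
  simp only [BraidedCategory.braiding_tensor_right_hom, BraidedCategory.braiding_tensor_left_hom,
    Category.assoc, Iso.hom_inv_id_assoc]
  rw [← BraidedCategory.yang_baxter_assoc, Iso.hom_inv_id_assoc, Iso.hom_inv_id_assoc]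

lemma hom_comm_aux [BraidedCategory V] {H f g X Y Z : V} (c : H ⊗ g ⟶ X) (c' : f ⊗ X ⟶ Z)
    (c'' : f ⊗ H ⟶ Y) (c''' : Y ⊗ g ⟶ Z)
    (h : (α_ _ _ _).hom ≫ f ◁ c ≫ c' = c'' ▷ g ≫ c''') :
    c ▷ f ≫ (β_ X f).hom ≫ c' =
      (α_ _ _ _).hom ≫ H ◁ (β_ g f).hom ≫ (α_ _ _ _).inv ≫ ((β_ H f).hom ≫ c'') ▷ g ≫ c''' := by
  rw [BraidedCategory.braiding_naturality_left_assoc, comp_whiskerRight, Category.assoc, ← h]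
  simp only [BraidedCategory.braiding_tensor_left_hom, Category.assoc]

lemma tensor_unit_left_aux [BraidedCategory V] {X Y E : V} (e : 𝟙_ V ⟶ E) (a : X ⊗ E ⟶ X)
    (h : X ◁ e ≫ a = (ρ_ X).hom) :
    (X ⊗ Y) ◁ e ≫ (α_ _ _ _).hom ≫ X ◁ (β_ Y E).hom ≫ (α_ _ _ _).inv ≫ a ▷ Y =
      (ρ_ (X ⊗ Y)).hom := by
  calc
    _ = 𝟙 _ ⊗≫ X ◁ (Y ◁ e ≫ (β_ Y E).hom) ⊗≫ a ▷ Y := by monoidal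
    _ = 𝟙 _ ⊗≫ X ◁ (β_ Y (𝟙_ V)).hom ⊗≫ (X ◁ e ≫ a) ▷ Y := by
      rw [BraidedCategory.braiding_naturality_right]; monoidal
    _ = _ := by rw [h, braiding_tensorUnit_right]; monoidal

lemma tensor_comp_left_aux [BraidedCategory V] {X X' X'' Y f f' ff : V} (a : X ⊗ f ⟶ X')
    (a' : X' ⊗ f' ⟶ X'') (b : X ⊗ ff ⟶ X'') (c : f ⊗ f' ⟶ ff)
    (h : (α_ _ _ _).hom ≫ X ◁ c ≫ b = a ▷ f' ≫ a') :
    (α_ _ _ _).hom ≫ (X ⊗ Y) ◁ c ≫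
        ((α_ _ _ _).hom ≫ X ◁ (β_ Y ff).hom ≫ (α_ _ _ _).inv ≫ b ▷ Y) =
      ((α_ _ _ _).hom ≫ X ◁ (β_ Y f).hom ≫ (α_ _ _ _).inv ≫ a ▷ Y) ▷ f' ≫
        ((α_ _ _ _).hom ≫ X' ◁ (β_ Y f').hom ≫ (α_ _ _ _).inv ≫ a' ▷ Y) := by
  have h' : X ◁ c ≫ b = (α_ _ _ _).inv ≫ a ▷ f' ≫ a' := by rw [← h, Iso.inv_hom_id_assoc]
  calc
    _ = 𝟙 _ ⊗≫ X ◁ (Y ◁ c ≫ (β_ Y ff).hom) ⊗≫ b ▷ Y := by monoidal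
    _ = 𝟙 _ ⊗≫ X ◁ (β_ Y (f ⊗ f')).hom ⊗≫ (X ◁ c ≫ b) ▷ Y := by
      rw [BraidedCategory.braiding_naturality_right]; monoidal
    _ = 𝟙 _ ⊗≫ X ◁ (β_ Y f).hom ▷ f' ⊗≫ ((X ⊗ f) ◁ (β_ Y f').hom ≫ a ▷ (f' ⊗ Y)) ⊗≫ a' ▷ Y := by
      rw [h', BraidedCategory.braiding_tensor_right_hom]; monoidal
    _ = _ := by rw [whisker_exchange]; monoidal

lemma tensor_unit_right_aux {X Y E : V} (e : 𝟙_ V ⟶ E) (a : Y ⊗ E ⟶ Y)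
    (h : Y ◁ e ≫ a = (ρ_ Y).hom) :
    (X ⊗ Y) ◁ e ≫ (α_ _ _ _).hom ≫ X ◁ a = (ρ_ (X ⊗ Y)).hom := by
  calc
    _ = 𝟙 _ ⊗≫ X ◁ (Y ◁ e ≫ a) := by monoidal
    _ = _ := by rw [h]; monoidal

lemma tensor_comp_right_aux {X Y Y' Y'' g g' gg : V} (a : Y ⊗ g ⟶ Y') (a' : Y' ⊗ g' ⟶ Y'')
    (b : Y ⊗ gg ⟶ Y'') (c : g ⊗ g' ⟶ gg) (h : (α_ _ _ _).hom ≫ Y ◁ c ≫ b = a ▷ g' ≫ a') :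
    (α_ _ _ _).hom ≫ (X ⊗ Y) ◁ c ≫ ((α_ _ _ _).hom ≫ X ◁ b) =
      ((α_ _ _ _).hom ≫ X ◁ a) ▷ g' ≫ ((α_ _ _ _).hom ≫ X ◁ a') := by
  calc
    _ = 𝟙 _ ⊗≫ X ◁ ((α_ _ _ _).hom ≫ Y ◁ c ≫ b) := by monoidal
    _ = _ := by rw [h]; monoidal

lemma tensor_comm_aux [BraidedCategory V] {X X' Y Y' f g : V} (a : X ⊗ f ⟶ X')
    (b : Y ⊗ g ⟶ Y') :
    ((α_ _ _ _).hom ≫ X ◁ b) ▷ f ≫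
        ((α_ _ _ _).hom ≫ X ◁ (β_ Y' f).hom ≫ (α_ _ _ _).inv ≫ a ▷ Y') =
      (α_ _ _ _).hom ≫ (X ⊗ Y) ◁ (β_ g f).hom ≫ (α_ _ _ _).inv ≫
        ((α_ _ _ _).hom ≫ X ◁ (β_ Y f).hom ≫ (α_ _ _ _).inv ≫ a ▷ Y) ▷ g ≫
          (α_ _ _ _).hom ≫ X' ◁ b := by
  calc
    _ = 𝟙 _ ⊗≫ X ◁ (b ▷ f ≫ (β_ Y' f).hom) ⊗≫ a ▷ Y' := by monoidal
    _ = 𝟙 _ ⊗≫ X ◁ (β_ (Y ⊗ g) f).hom ⊗≫ ((X ⊗ f) ◁ b ≫ a ▷ Y') := by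
      rw [BraidedCategory.braiding_naturality_left]; monoidal
    _ = _ := by rw [whisker_exchange, BraidedCategory.braiding_tensor_left_hom]; monoidal

end Coherence

section TensorProduct

variable (V : Type v) [Category.{u} V] [MonoidalCategory V] [BraidedCategory V]

/-- The tensor product of two `V`-categories. -/
instance prodEnriched (C : Type u₁) (D : Type u₂) [EnrichedCategory V C] [EnrichedCategory V D] :
    EnrichedCategory V (C × D) where
  Hom X Y := (X.1 ⟶[V] Y.1) ⊗ (X.2 ⟶[V] Y.2)
  id X := (λ_ (𝟙_ V)).inv ≫ (eId V X.1 ⊗ₘ eId V X.2)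
  comp X Y Z := tensorμ _ _ _ _ ≫ (eComp V X.1 Y.1 Z.1 ⊗ₘ eComp V X.2 Y.2 Z.2)
  id_comp X Y := by
    rw [Iso.inv_comp_eq, Category.comp_id, comp_whiskerRight, Category.assoc,
      tensorμ_natural_left_assoc, tensorHom_comp_tensorHom, tensor_left_unitality]
    congr 3
    · rw [← Category.comp_id (λ_ _).hom, ← Iso.inv_comp_eq, e_id_comp]
    · rw [← Category.comp_id (λ_ _).hom, ← Iso.inv_comp_eq, e_id_comp]
  comp_id X Y := by
    rw [Iso.inv_comp_eq, Category.comp_id, MonoidalCategory.whiskerLeft_comp, Category.assoc,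
      tensorμ_natural_right_assoc, tensorHom_comp_tensorHom, tensor_right_unitality]
    congr 3
    · rw [← Category.comp_id (ρ_ _).hom, ← Iso.inv_comp_eq, e_comp_id]
    · rw [← Category.comp_id (ρ_ _).hom, ← Iso.inv_comp_eq, e_comp_id]
  assoc W X Y Z := by
    rw [Iso.inv_comp_eq]
    simp only [comp_whiskerRight, MonoidalCategory.whiskerLeft_comp, Category.assoc]
    rw [tensorμ_natural_left_assoc, tensorμ_natural_right_assoc, tensorHom_comp_tensorHom,
      tensorHom_comp_tensorHom, ← e_assoc', ← e_assoc', ← tensorHom_comp_tensorHom,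
      tensor_associativity_assoc]

variable {V}
variable {C : Type u₁} {D : Type u₂} {C' : Type u₃} {D' : Type u₄}
  [EnrichedCategory V C] [EnrichedCategory V D] [EnrichedCategory V C'] [EnrichedCategory V D']

lemma prod_eId (X : C × D) : eId V X = (λ_ (𝟙_ V)).inv ≫ (eId V X.1 ⊗ₘ eId V X.2) := rfl

lemma prod_eComp (X Y Z : C × D) : eComp V X Y Z =
    tensorμ (X.1 ⟶[V] Y.1) (X.2 ⟶[V] Y.2) (Y.1 ⟶[V] Z.1) (Y.2 ⟶[V] Z.2) ≫
      (eComp V X.1 Y.1 Z.1 ⊗ₘ eComp V X.2 Y.2 Z.2) := rfl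

/-- The tensor product `F ⊗ G` of two `V`-functors. -/
def prodMap (F : EnrichedFunctor V C C') (G : EnrichedFunctor V D D') :
    EnrichedFunctor V (C × D) (C' × D') where
  obj X := (F.obj X.1, G.obj X.2)
  map X Y := F.map X.1 Y.1 ⊗ₘ G.map X.2 Y.2
  map_id X := by
    simp only [prod_eId, Category.assoc, tensorHom_comp_tensorHom, EnrichedFunctor.map_id]
  map_comp X Y Z := by
    simp only [prod_eComp, Category.assoc, tensorHom_comp_tensorHom, EnrichedFunctor.map_comp]
    rw [← tensorHom_comp_tensorHom, tensorμ_natural_assoc]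

/-- The associativity `V`-functor `(C ⊗ D) ⊗ E → C ⊗ (D ⊗ E)`. -/
def prodAssoc (V : Type v) [Category.{u} V] [MonoidalCategory V] [BraidedCategory V]
    (C : Type u₁) (D : Type u₂) (E : Type u₃)
    [EnrichedCategory V C] [EnrichedCategory V D] [EnrichedCategory V E] :
    EnrichedFunctor V ((C × D) × E) (C × (D × E)) where
  obj X := (X.1.1, X.1.2, X.2)
  map X Y := (α_ (X.1.1 ⟶[V] Y.1.1) (X.1.2 ⟶[V] Y.1.2) (X.2 ⟶[V] Y.2)).hom
  map_id X := by
    simp only [prod_eId, Category.assoc]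
    monoidal
  map_comp _ _ _ := tensorμ_assoc_aux _ _ _

/-- The symmetry `V`-functor `C ⊗ D → D ⊗ C`. -/
def prodSwap (V : Type v) [Category.{u} V] [MonoidalCategory V] [SymmetricCategory V]
    (C : Type u₁) (D : Type u₂) [EnrichedCategory V C] [EnrichedCategory V D] :
    EnrichedFunctor V (C × D) (D × C) where
  obj X := (X.2, X.1)
  map X Y := (β_ (X.1 ⟶[V] Y.1) (X.2 ⟶[V] Y.2)).hom
  map_id X := by
    rw [prod_eId, Category.assoc, BraidedCategory.braiding_naturality, prod_eId,
      leftUnitor_inv_braiding_assoc, unitors_inv_equal]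
  map_comp _ _ _ := tensorμ_swap_aux _ _

/-- The `V`-functor `D → C ⊗ D` sending `Y` to `(X, Y)`. -/
def insertLeft (X : C) : EnrichedFunctor V D (C × D) where
  obj Y := (X, Y)
  map Y Z := (λ_ (Y ⟶[V] Z)).inv ≫ (eId V X ▷ (Y ⟶[V] Z))
  map_id Y := by
    rw [prod_eId, MonoidalCategory.tensorHom_def', leftUnitor_inv_naturality_assoc]
  map_comp _ _ _ := tensorμ_left_aux _ _ (e_id_comp V X X) _

/-- The `V`-functor `C → C ⊗ D` sending `X` to `(X, Y)`. -/
def insertRight (Y : D) : EnrichedFunctor V C (C × D) where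
  obj X := (X, Y)
  map X X' := (ρ_ (X ⟶[V] X')).inv ≫ ((X ⟶[V] X') ◁ eId V Y)
  map_id X := by
    rw [prod_eId, MonoidalCategory.tensorHom_def, rightUnitor_inv_naturality_assoc,
      unitors_inv_equal]
  map_comp _ _ _ := tensorμ_right_aux _ _ (e_id_comp V Y Y) _

/-- The opposite of a `V`-functor. -/
def opFunctor (F : EnrichedFunctor V C D) : EnrichedFunctor V Cᵒᵖ Dᵒᵖ where
  obj X := op (F.obj X.unop)
  map X Y := F.map Y.unop X.unop
  map_id X := F.map_id X.unop
  map_comp X Y Z := by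
    simp only [eComp_op_eq, Category.assoc, EnrichedFunctor.map_comp]
    rw [← BraidedCategory.braiding_naturality_assoc]

end TensorProduct

section SelfEnriched

variable {V : Type v} [Category.{u} V] [MonoidalCategory V] [SymmetricCategory V]
  [MonoidalClosed V] {J : Type u₁} {K : Type u₂} [EnrichedCategory V J] [EnrichedCategory V K]

/-- The transpose `F X ⊗ J(X, Y) → F Y` of the action on morphisms of a copresheaf. -/
def act (F : EnrichedFunctor V J V) (X Y : J) : F.obj X ⊗ (X ⟶[V] Y) ⟶ F.obj Y :=
  MonoidalClosed.uncurry (F.map X Y)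

/-- A `V`-functor `J ⊗ K → V` from two compatible actions on a family of objects. -/
def ofActions (O : J → K → V)
    (l : ∀ X X' Y, O X Y ⊗ (X ⟶[V] X') ⟶ O X' Y)
    (r : ∀ X Y Y', O X Y ⊗ (Y ⟶[V] Y') ⟶ O X Y')
    (l_id : ∀ X Y, O X Y ◁ eId V X ≫ l X X Y = (ρ_ (O X Y)).hom)
    (r_id : ∀ X Y, O X Y ◁ eId V Y ≫ r X Y Y = (ρ_ (O X Y)).hom)
    (l_comp : ∀ X X' X'' Y, (α_ _ _ _).hom ≫ O X Y ◁ eComp V X X' X'' ≫ l X X'' Y =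
      l X X' Y ▷ (X' ⟶[V] X'') ≫ l X' X'' Y)
    (r_comp : ∀ X Y Y' Y'', (α_ _ _ _).hom ≫ O X Y ◁ eComp V Y Y' Y'' ≫ r X Y Y'' =
      r X Y Y' ▷ (Y' ⟶[V] Y'') ≫ r X Y' Y'')
    (comm : ∀ X X' Y Y', r X Y Y' ▷ (X ⟶[V] X') ≫ l X X' Y' =
      (α_ _ _ _).hom ≫ O X Y ◁ (β_ (Y ⟶[V] Y') (X ⟶[V] X')).hom ≫ (α_ _ _ _).inv ≫
        l X X' Y ▷ (Y ⟶[V] Y') ≫ r X' Y Y') :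
    EnrichedFunctor V (J × K) V where
  obj X := O X.1 X.2
  map X Y := MonoidalClosed.curry ((α_ _ _ _).inv ≫ l X.1 Y.1 X.2 ▷ (X.2 ⟶[V] Y.2) ≫
    r Y.1 X.2 Y.2)
  map_id X := by
    apply MonoidalClosed.uncurry_injective
    rw [MonoidalClosed.uncurry_natural_left, MonoidalClosed.uncurry_curry]
    refine Eq.trans ?_ (MonoidalClosed.uncurry_curry (ρ_ (O X.1 X.2)).hom).symm
    exact actions_unit_aux _ _ _ _ (l_id _ _) (r_id _ _)
  map_comp X Y Z := by
    apply MonoidalClosed.uncurry_injective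
    rw [MonoidalClosed.uncurry_natural_left, MonoidalClosed.uncurry_curry]
    refine Eq.trans ?_ (uncurry_tensorHom_comp _ _).symm
    rw [MonoidalClosed.uncurry_curry, MonoidalClosed.uncurry_curry]
    exact actions_aux _ _ _ _ _ _ _ _ _ _ (l_comp _ _ _ _) (r_comp _ _ _ _) (comm _ _ _ _)

/-- The hom `V`-functor `C(-, -) : Cᵒᵖ ⊗ C → V`. -/
def homFunctor (V : Type v) [Category.{u} V] [MonoidalCategory V] [SymmetricCategory V]
    [MonoidalClosed V] (C : Type u₁) [EnrichedCategory V C] : EnrichedFunctor V (Cᵒᵖ × C) V :=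
  ofActions (fun X Y => (X.unop ⟶[V] Y))
    (fun X X' Y => (β_ (X.unop ⟶[V] Y) (X'.unop ⟶[V] X.unop)).hom ≫
      eComp V X'.unop X.unop Y)
    (fun X Y Y' => eComp V X.unop Y Y')
    (fun X Y => hom_unit_aux _ _ (e_id_comp V X.unop Y))
    (fun X Y => by
      refine ((Iso.inv_comp_eq _).1 (e_comp_id V X.unop Y)).trans (Category.comp_id _))
    (fun X X' X'' Y => hom_comp_aux _ _ _ _ (e_assoc' V X''.unop X'.unop X.unop Y))
    (fun X Y Y' Y'' => e_assoc' V _ _ _ _)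
    (fun X X' Y Y' => hom_comm_aux _ _ _ _ (e_assoc' V X'.unop X.unop Y Y'))

lemma whiskerLeft_eId_ev (X : V) : X ◁ eId V X ≫ (ihom.ev X).app X = (ρ_ X).hom :=
  MonoidalClosed.whiskerLeft_curry_ihom_ev_app _ _ _

lemma whiskerLeft_eComp_ev (X Y Z : V) :
    (α_ _ _ _).hom ≫ X ◁ eComp V X Y Z ≫ (ihom.ev X).app Z =
      (ihom.ev X).app Y ▷ ((ihom Y).obj Z) ≫ (ihom.ev Y).app Z := by
  have h : X ◁ eComp V X Y Z ≫ (ihom.ev X).app Z = MonoidalClosed.compTranspose X Y Z :=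
    MonoidalClosed.whiskerLeft_curry_ihom_ev_app _ _ _
  rw [h]
  exact Iso.hom_inv_id_assoc _ _

/-- The tensor product `V`-functor `V ⊗ V → V`. -/
def tensorFunctor (V : Type v) [Category.{u} V] [MonoidalCategory V] [SymmetricCategory V]
    [MonoidalClosed V] : EnrichedFunctor V (V × V) V :=
  ofActions (fun X Y => X ⊗ Y)
    (fun X X' Y => (α_ X Y ((ihom X).obj X')).hom ≫ X ◁ (β_ Y ((ihom X).obj X')).hom ≫
      (α_ X ((ihom X).obj X') Y).inv ≫ (ihom.ev X).app X' ▷ Y)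
    (fun X Y Y' => (α_ X Y ((ihom Y).obj Y')).hom ≫ X ◁ (ihom.ev Y).app Y')
    (fun X _ => tensor_unit_left_aux _ _ (whiskerLeft_eId_ev X))
    (fun _ Y => tensor_unit_right_aux _ _ (whiskerLeft_eId_ev Y))
    (fun X X' X'' _ => tensor_comp_left_aux _ _ _ _ (whiskerLeft_eComp_ev X X' X''))
    (fun _ Y Y' Y'' => tensor_comp_right_aux _ _ _ _ (whiskerLeft_eComp_ev Y Y' Y''))
    (fun _ _ _ _ => tensor_comm_aux _ _)

end SelfEnriched

section Ends

variable {V : Type v} [Category.{u} V] [MonoidalCategory V] [SymmetricCategory V]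
  [MonoidalClosed V] {J : Type u₁} [EnrichedCategory V J]

/-- The covariant action `T(X, X) → [J(X, Y), T(X, Y)]`. -/
def wedgeLeft (T : EnrichedFunctor V (Jᵒᵖ × J) V) (X Y : J) :
    T.obj (op X, X) ⟶ (ihom (X ⟶[V] Y)).obj (T.obj (op X, Y)) :=
  MonoidalClosed.curry ((β_ (X ⟶[V] Y) (T.obj (op X, X))).hom ≫
    act ((insertLeft (op X)).comp V T) X Y)

/-- The contravariant action `T(Y, Y) → [J(X, Y), T(X, Y)]`. -/
def wedgeRight (T : EnrichedFunctor V (Jᵒᵖ × J) V) (X Y : J) :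
    T.obj (op Y, Y) ⟶ (ihom (X ⟶[V] Y)).obj (T.obj (op X, Y)) :=
  MonoidalClosed.curry ((β_ (X ⟶[V] Y) (T.obj (op Y, Y))).hom ≫
    act ((insertRight Y).comp V T) (op Y) (op X))

/-- The diagram whose limit is the end of `T`: the multiforks over it are the `V`-natural
families `E ⟶ T(X, X)`. -/
def endIndex (T : EnrichedFunctor V (Jᵒᵖ × J) V) :
    MulticospanIndex ⟨J, J × J, Prod.fst, Prod.snd⟩ V where
  left X := T.obj (op X, X)
  right p := (ihom (p.1 ⟶[V] p.2)).obj (T.obj (op p.1, p.2))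
  fst p := wedgeLeft T p.1 p.2
  snd p := wedgeRight T p.1 p.2

/-- The end of the `V`-functor `T` exists. -/
abbrev HasVEnd (T : EnrichedFunctor V (Jᵒᵖ × J) V) : Prop := HasMultiequalizer (endIndex T)

/-- The end `∫_X T(X, X)`. -/
abbrev vEnd (T : EnrichedFunctor V (Jᵒᵖ × J) V) [HasVEnd T] : V := multiequalizer (endIndex T)

/-- The counit `∫_X T(X, X) ⟶ T(X, X)` of an end. -/
abbrev vEndπ (T : EnrichedFunctor V (Jᵒᵖ × J) V) [HasVEnd T] (X : J) :
    vEnd T ⟶ T.obj (op X, X) := Multiequalizer.ι (endIndex T) X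

/-- The diagram whose colimit is the coend of `T`: its legs are the two actions
`J(X, Y) ⊗ T(Y, X) ⟶ T(X, X)` and `J(X, Y) ⊗ T(Y, X) ⟶ T(Y, Y)`. -/
def coendIndex (T : EnrichedFunctor V (Jᵒᵖ × J) V) :
    MultispanIndex ⟨J × J, J, Prod.fst, Prod.snd⟩ V where
  left p := (p.1 ⟶[V] p.2) ⊗ T.obj (op p.2, p.1)
  right X := T.obj (op X, X)
  fst p := (β_ (p.1 ⟶[V] p.2) (T.obj (op p.2, p.1))).hom ≫
    act ((insertRight p.1).comp V T) (op p.2) (op p.1)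
  snd p := (β_ (p.1 ⟶[V] p.2) (T.obj (op p.2, p.1))).hom ≫
    act ((insertLeft (op p.2)).comp V T) p.1 p.2

/-- The coend of the `V`-functor `T` exists. -/
abbrev HasVCoend (T : EnrichedFunctor V (Jᵒᵖ × J) V) : Prop :=
  HasMulticoequalizer (coendIndex T)

/-- The coend `∫^X T(X, X)`. -/
abbrev vCoend (T : EnrichedFunctor V (Jᵒᵖ × J) V) [HasVCoend T] : V :=
  multicoequalizer (coendIndex T)

/-- The unit `T(X, X) ⟶ ∫^X T(X, X)` of a coend. -/
abbrev vCoendι (T : EnrichedFunctor V (Jᵒᵖ × J) V) [HasVCoend T] (X : J) :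
    T.obj (op X, X) ⟶ vCoend T := Multicoequalizer.π (coendIndex T) X

end Ends

section NaturalTransformations

variable {V : Type v} [Category.{u} V] [MonoidalCategory V] [SymmetricCategory V]
  [MonoidalClosed V] {J : Type u₁} [EnrichedCategory V J] {E : Type u₂} [EnrichedCategory V E]

/-- The `V`-functor `(X, Y) ↦ E(F X, G Y)`, whose end is the object of `V`-natural transformations
from `F` to `G`. -/
def natDiagram (F G : EnrichedFunctor V J E) : EnrichedFunctor V (Jᵒᵖ × J) V :=
  (prodMap (opFunctor F) G).comp V (homFunctor V E)

lemma insertLeft_aux {O f f' g g' O' : V} (e : 𝟙_ V ⟶ f') (m : f' ⟶ f) (k : g' ⟶ g)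
    (l : O ⊗ f ⟶ O) (r : O ⊗ g ⟶ O') (h : O ◁ (e ≫ m) ≫ l = (ρ_ O).hom) :
    O ◁ (((λ_ g').inv ≫ e ▷ g') ≫ (m ⊗ₘ k)) ≫ (α_ _ _ _).inv ≫ l ▷ g ≫ r = O ◁ k ≫ r := by
  calc
    _ = 𝟙 _ ⊗≫ O ◁ (e ≫ m) ▷ g' ⊗≫ ((O ⊗ f) ◁ k ≫ l ▷ g) ≫ r := by
      rw [MonoidalCategory.tensorHom_def]; monoidal
    _ = 𝟙 _ ⊗≫ (O ◁ (e ≫ m) ≫ l) ▷ g' ⊗≫ O ◁ k ≫ r := by rw [whisker_exchange]; monoidal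
    _ = _ := by rw [h]; monoidal

lemma insertRight_aux {O O' f f' g g' : V} (e : 𝟙_ V ⟶ g') (m : g' ⟶ g) (k : f' ⟶ f)
    (l : O ⊗ f ⟶ O') (r : O' ⊗ g ⟶ O') (h : O' ◁ (e ≫ m) ≫ r = (ρ_ O').hom) :
    O ◁ (((ρ_ f').inv ≫ f' ◁ e) ≫ (k ⊗ₘ m)) ≫ (α_ _ _ _).inv ≫ l ▷ g ≫ r = O ◁ k ≫ l := by
  calc
    _ = 𝟙 _ ⊗≫ O ◁ (f' ◁ (e ≫ m) ≫ k ▷ g) ⊗≫ l ▷ g ≫ r := by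
      rw [MonoidalCategory.tensorHom_def']; monoidal
    _ = 𝟙 _ ⊗≫ O ◁ k ▷ 𝟙_ V ⊗≫ ((O ⊗ f) ◁ (e ≫ m) ≫ l ▷ g) ≫ r := by
      rw [whisker_exchange]; monoidal
    _ = 𝟙 _ ⊗≫ O ◁ k ▷ 𝟙_ V ⊗≫ l ▷ 𝟙_ V ≫ (O' ◁ (e ≫ m) ≫ r) := by
      rw [whisker_exchange]; monoidal
    _ = _ := by rw [h]; monoidal

lemma act_natDiagram_left (F G : EnrichedFunctor V J E) (X Y : J) :
    act ((insertLeft (op X)).comp V (natDiagram F G)) X Y =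
      (F.obj X ⟶[V] G.obj X) ◁ G.map X Y ≫ eComp V (F.obj X) (G.obj X) (G.obj Y) := by
  refine (congrArg MonoidalClosed.uncurry (Category.assoc _ _ _).symm).trans ?_
  refine (MonoidalClosed.uncurry_natural_left _ _).trans ?_
  refine (congrArg (fun t => _ ◁ _ ≫ t) (MonoidalClosed.uncurry_curry _)).trans ?_
  refine insertLeft_aux _ _ _ _ _ ?_
  refine (congrArg (fun t => _ ◁ t ≫ _) (F.map_id X)).trans ?_
  exact hom_unit_aux _ _ (e_id_comp V (F.obj X) (G.obj X))

lemma act_natDiagram_right (F G : EnrichedFunctor V J E) (X Y : J) :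
    act ((insertRight Y).comp V (natDiagram F G)) (op Y) (op X) =
      (F.obj Y ⟶[V] G.obj Y) ◁ F.map X Y ≫
        (β_ (F.obj Y ⟶[V] G.obj Y) (F.obj X ⟶[V] F.obj Y)).hom ≫
          eComp V (F.obj X) (F.obj Y) (G.obj Y) := by
  refine (congrArg MonoidalClosed.uncurry (Category.assoc _ _ _).symm).trans ?_
  refine (MonoidalClosed.uncurry_natural_left _ _).trans ?_
  refine (congrArg (fun t => _ ◁ _ ≫ t) (MonoidalClosed.uncurry_curry _)).trans ?_
  refine insertRight_aux _ _ _ _ _ ?_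
  refine (congrArg (fun t => _ ◁ t ≫ _) (G.map_id Y)).trans ?_
  refine ((Iso.inv_comp_eq _).1 (e_comp_id V (F.obj X) (G.obj Y))).trans (Category.comp_id _)

lemma comp_curry_braiding {H W j O : V} (k : W ⟶ H) (a : H ⊗ j ⟶ O) :
    k ≫ MonoidalClosed.curry ((β_ j H).hom ≫ a) =
      MonoidalClosed.curry ((β_ j W).hom ≫ k ▷ j ≫ a) := by
  rw [← MonoidalClosed.curry_natural_left, BraidedCategory.braiding_naturality_right_assoc]

lemma symm_aux {H W f j O : V} (k : W ⟶ H) (m : j ⟶ f) (a : f ⊗ H ⟶ O) :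
    (β_ j W).hom ≫ k ▷ j ≫ H ◁ m ≫ (β_ H f).hom ≫ a = (m ⊗ₘ k) ≫ a := by
  rw [← MonoidalCategory.tensorHom_def_assoc, BraidedCategory.braiding_naturality_assoc,
    SymmetricCategory.symmetry_assoc]

/-- The `V`-naturality of a family `W ⟶ E(F X, G X)`, written with composition in `E`. -/
lemma natWedge_iff (F G : EnrichedFunctor V J E) {W : V}
    (k : ∀ X : J, W ⟶ (F.obj X ⟶[V] G.obj X)) (X Y : J) :
    k X ≫ wedgeLeft (natDiagram F G) X Y = k Y ≫ wedgeRight (natDiagram F G) X Y ↔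
      (β_ (X ⟶[V] Y) W).hom ≫ (k X ⊗ₘ G.map X Y) ≫ eComp V (F.obj X) (G.obj X) (G.obj Y) =
        (F.map X Y ⊗ₘ k Y) ≫ eComp V (F.obj X) (F.obj Y) (G.obj Y) := by
  have h₁ : k X ≫ wedgeLeft (natDiagram F G) X Y =
      MonoidalClosed.curry ((β_ (X ⟶[V] Y) W).hom ≫ (k X ⊗ₘ G.map X Y) ≫
        eComp V (F.obj X) (G.obj X) (G.obj Y)) := by
    refine (comp_curry_braiding _ _).trans (congrArg _ (congrArg _ ?_))
    refine (congrArg _ (act_natDiagram_left F G X Y)).trans ?_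
    rw [MonoidalCategory.tensorHom_def, Category.assoc]
    rfl
  have h₂ : k Y ≫ wedgeRight (natDiagram F G) X Y =
      MonoidalClosed.curry ((F.map X Y ⊗ₘ k Y) ≫ eComp V (F.obj X) (F.obj Y) (G.obj Y)) := by
    refine (comp_curry_braiding _ _).trans (congrArg _ ?_)
    refine (congrArg _ (congrArg _ (act_natDiagram_right F G X Y))).trans ?_
    exact symm_aux _ _ _
  rw [h₁, h₂]
  exact MonoidalClosed.curry_injective.eq_iff

lemma comp_assoc_aux {X Y Z Z' : E} {a b c : V} (x : a ⟶ (X ⟶[V] Y)) (y : b ⟶ (Y ⟶[V] Z))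
    (z : c ⟶ (Z ⟶[V] Z')) :
    (((x ⊗ₘ y) ≫ eComp V X Y Z) ⊗ₘ z) ≫ eComp V X Z Z' =
      (α_ _ _ _).hom ≫ (x ⊗ₘ ((y ⊗ₘ z) ≫ eComp V Y Z Z')) ≫ eComp V X Y Z' := by
  have h₁ : (((x ⊗ₘ y) ≫ eComp V X Y Z) ⊗ₘ z) = ((x ⊗ₘ y) ⊗ₘ z) ≫ eComp V X Y Z ▷ _ := by
    rw [← tensorHom_id, tensorHom_comp_tensorHom, Category.comp_id]
  have h₂ : (x ⊗ₘ ((y ⊗ₘ z) ≫ eComp V Y Z Z')) = (x ⊗ₘ (y ⊗ₘ z)) ≫ _ ◁ eComp V Y Z Z' := by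
    rw [← id_tensorHom, tensorHom_comp_tensorHom, Category.comp_id]
  rw [h₁, h₂, Category.assoc, ← e_assoc', associator_naturality_assoc, Category.assoc]

lemma id_tensor_comp {X Y : E} {a : V} (x : a ⟶ (X ⟶[V] Y)) :
    (eId V X ⊗ₘ x) ≫ eComp V X X Y = (λ_ a).hom ≫ x := by
  rw [MonoidalCategory.tensorHom_def', Category.assoc,
    (Iso.inv_comp_eq _).1 (e_id_comp V X Y), Category.comp_id, leftUnitor_naturality]

lemma tensor_id_comp {X Y : E} {a : V} (x : a ⟶ (X ⟶[V] Y)) :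
    (x ⊗ₘ eId V Y) ≫ eComp V X Y Y = (ρ_ a).hom ≫ x := by
  rw [MonoidalCategory.tensorHom_def, Category.assoc,
    (Iso.inv_comp_eq _).1 (e_comp_id V X Y), Category.comp_id, rightUnitor_naturality]

lemma natComp_aux {X X' Y Y' Z Z' : E} {W W' j : V} (a : W ⟶ (X ⟶[V] Y)) (b : W ⟶ (X' ⟶[V] Y'))
    (a' : W' ⟶ (Y ⟶[V] Z)) (b' : W' ⟶ (Y' ⟶[V] Z')) (f : j ⟶ (X ⟶[V] X'))
    (g : j ⟶ (Y ⟶[V] Y')) (h : j ⟶ (Z ⟶[V] Z'))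
    (h₁ : (β_ j W).hom ≫ (a ⊗ₘ g) ≫ eComp V X Y Y' = (f ⊗ₘ b) ≫ eComp V X X' Y')
    (h₂ : (β_ j W').hom ≫ (a' ⊗ₘ h) ≫ eComp V Y Z Z' = (g ⊗ₘ b') ≫ eComp V Y Y' Z') :
    (β_ j (W ⊗ W')).hom ≫ (((a ⊗ₘ a') ≫ eComp V X Y Z) ⊗ₘ h) ≫ eComp V X Z Z' =
      (f ⊗ₘ ((b ⊗ₘ b') ≫ eComp V X' Y' Z')) ≫ eComp V X X' Z' := by
  have h₃ : (β_ j (W ⊗ W')).hom ≫ (α_ W W' j).hom =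
      (α_ j W W').inv ≫ (β_ j W).hom ▷ W' ≫ (α_ W j W').hom ≫ W ◁ (β_ j W').hom := by
    simp only [BraidedCategory.braiding_tensor_right_hom, Category.assoc, Iso.inv_hom_id,
      Category.comp_id]
  have h₄ : W ◁ (β_ j W').hom ≫ (a ⊗ₘ ((a' ⊗ₘ h) ≫ eComp V Y Z Z')) =
      (a ⊗ₘ ((g ⊗ₘ b') ≫ eComp V Y Y' Z')) := by
    rw [← h₂, ← id_tensorHom, tensorHom_comp_tensorHom, Category.id_comp]
  have h₅ : (β_ j W).hom ▷ W' ≫ (((a ⊗ₘ g) ≫ eComp V X Y Y') ⊗ₘ b') =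
      (((f ⊗ₘ b) ≫ eComp V X X' Y') ⊗ₘ b') := by
    rw [← h₁, ← tensorHom_id, tensorHom_comp_tensorHom, Category.id_comp]
  rw [comp_assoc_aux, reassoc_of% h₃, reassoc_of% h₄, ← comp_assoc_aux, reassoc_of% h₅,
    comp_assoc_aux, Iso.inv_hom_id_assoc]

/-- The hom-object of the `V`-category of `V`-functors: the end `∫_X E(F X, G X)`. -/
abbrev natObj (F G : EnrichedFunctor V J E) [HasVEnd (natDiagram F G)] : V :=
  vEnd (natDiagram F G)

/-- The component at `X` of the object of `V`-natural transformations. -/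
abbrev natπ (F G : EnrichedFunctor V J E) [HasVEnd (natDiagram F G)] (X : J) :
    natObj F G ⟶ (F.obj X ⟶[V] G.obj X) := vEndπ (natDiagram F G) X

/-- The map into the object of `V`-natural transformations given by a `V`-natural family. -/
def natLift (F G : EnrichedFunctor V J E) [HasVEnd (natDiagram F G)] {W : V}
    (k : ∀ X : J, W ⟶ (F.obj X ⟶[V] G.obj X))
    (hk : ∀ X Y : J, (β_ (X ⟶[V] Y) W).hom ≫ (k X ⊗ₘ G.map X Y) ≫
        eComp V (F.obj X) (G.obj X) (G.obj Y) =
      (F.map X Y ⊗ₘ k Y) ≫ eComp V (F.obj X) (F.obj Y) (G.obj Y)) : W ⟶ natObj F G :=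
  Multiequalizer.lift (endIndex (natDiagram F G)) W k
    (fun p => (natWedge_iff F G k p.1 p.2).2 (hk p.1 p.2))

lemma natLift_π (F G : EnrichedFunctor V J E) [HasVEnd (natDiagram F G)] {W : V}
    (k : ∀ X : J, W ⟶ (F.obj X ⟶[V] G.obj X)) (hk) (X : J) :
    natLift F G k hk ≫ natπ F G X = k X :=
  Multiequalizer.lift_ι _ _ _ _ _

lemma natπ_condition (F G : EnrichedFunctor V J E) [HasVEnd (natDiagram F G)] (X Y : J) :
    (β_ (X ⟶[V] Y) (natObj F G)).hom ≫ (natπ F G X ⊗ₘ G.map X Y) ≫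
        eComp V (F.obj X) (G.obj X) (G.obj Y) =
      (F.map X Y ⊗ₘ natπ F G Y) ≫ eComp V (F.obj X) (F.obj Y) (G.obj Y) :=
  (natWedge_iff F G (natπ F G) X Y).1 (Multiequalizer.condition (endIndex (natDiagram F G)) (X, Y))

lemma nat_hom_ext {F G : EnrichedFunctor V J E} [HasVEnd (natDiagram F G)] {W : V}
    {f g : W ⟶ natObj F G} (h : ∀ X, f ≫ natπ F G X = g ≫ natπ F G X) : f = g :=
  Multiequalizer.hom_ext _ _ _ h

/-- The identity `V`-natural transformation. -/
def natId (F : EnrichedFunctor V J E) [HasVEnd (natDiagram F F)] : 𝟙_ V ⟶ natObj F F :=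
  natLift F F (fun X => eId V (F.obj X)) (fun X Y => by
    rw [id_tensor_comp, tensor_id_comp, braiding_leftUnitor_assoc])

/-- Composition of `V`-natural transformations. -/
def natComp (F G H : EnrichedFunctor V J E) [HasVEnd (natDiagram F G)] [HasVEnd (natDiagram G H)]
    [HasVEnd (natDiagram F H)] : natObj F G ⊗ natObj G H ⟶ natObj F H :=
  natLift F H (fun X => (natπ F G X ⊗ₘ natπ G H X) ≫ eComp V (F.obj X) (G.obj X) (H.obj X))
    (fun X Y => natComp_aux _ _ _ _ _ _ _ (natπ_condition F G X Y) (natπ_condition G H X Y))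

lemma natId_π (F : EnrichedFunctor V J E) [HasVEnd (natDiagram F F)] (X : J) :
    natId F ≫ natπ F F X = eId V (F.obj X) := natLift_π _ _ _ _ _

lemma natComp_π (F G H : EnrichedFunctor V J E) [HasVEnd (natDiagram F G)]
    [HasVEnd (natDiagram G H)] [HasVEnd (natDiagram F H)] (X : J) :
    natComp F G H ≫ natπ F H X =
      (natπ F G X ⊗ₘ natπ G H X) ≫ eComp V (F.obj X) (G.obj X) (H.obj X) := natLift_π _ _ _ _ _

end NaturalTransformations

section MonoidalActions

variable {V : Type v} [Category.{u} V] [MonoidalCategory V]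

/-- A `V`-natural isomorphism. Its components are isomorphisms in the underlying category of `D`;
`V`-naturality is an equality of morphisms `C(X, Y) ⟶ D(F X, G Y)` in `V`. -/
structure VNatIso {C : Type u₁} {D : Type u₂} [EnrichedCategory V C] [EnrichedCategory V D]
    (F G : EnrichedFunctor V C D) where
  iso : ∀ X : C, ForgetEnrichment.of V (F.obj X) ≅ ForgetEnrichment.of V (G.obj X)
  naturality : ∀ X Y : C,
    (ρ_ (X ⟶[V] Y)).inv ≫ (F.map X Y ⊗ₘ ForgetEnrichment.homTo V (iso Y).hom) ≫
        eComp V (F.obj X) (F.obj Y) (G.obj Y) =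
      (λ_ (X ⟶[V] Y)).inv ≫ (ForgetEnrichment.homTo V (iso X).hom ⊗ₘ G.map X Y) ≫
        eComp V (F.obj X) (G.obj X) (G.obj Y)

/-- The action of a `V`-functor of two variables on morphisms of the underlying categories. -/
def vBimap [BraidedCategory V] {C : Type u₁} {D : Type u₂} {E : Type u₃} [EnrichedCategory V C]
    [EnrichedCategory V D] [EnrichedCategory V E] (F : EnrichedFunctor V (C × D) E)
    {X X' : C} {Y Y' : D} (f : ForgetEnrichment.of V X ⟶ ForgetEnrichment.of V X')
    (g : ForgetEnrichment.of V Y ⟶ ForgetEnrichment.of V Y') :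
    ForgetEnrichment.of V (F.obj (X, Y)) ⟶ ForgetEnrichment.of V (F.obj (X', Y')) :=
  ForgetEnrichment.homOf V ((λ_ (𝟙_ V)).inv ≫
    (ForgetEnrichment.homTo V f ⊗ₘ ForgetEnrichment.homTo V g) ≫ F.map (X, Y) (X', Y'))

/-- A monoidal `V`-category. -/
class MonoidalVCategory (V : Type v) [Category.{u} V] [MonoidalCategory V] [BraidedCategory V]
    (M : Type u₁) [EnrichedCategory V M] where
  tensor : EnrichedFunctor V (M × M) M
  unit : M
  associator : VNatIso ((prodMap tensor (EnrichedFunctor.id V M)).comp V tensor)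
    ((prodAssoc V M M M).comp V ((prodMap (EnrichedFunctor.id V M) tensor).comp V tensor))
  leftUnitor : VNatIso ((insertLeft unit).comp V tensor) (EnrichedFunctor.id V M)
  rightUnitor : VNatIso ((insertRight unit).comp V tensor) (EnrichedFunctor.id V M)
  pentagon : ∀ W X Y Z : M,
    vBimap tensor (associator.iso ((W, X), Y)).hom (𝟙 (ForgetEnrichment.of V Z)) ≫
        (associator.iso ((W, tensor.obj (X, Y)), Z)).hom ≫
          vBimap tensor (𝟙 (ForgetEnrichment.of V W)) (associator.iso ((X, Y), Z)).hom =
      (associator.iso ((tensor.obj (W, X), Y), Z)).hom ≫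
        (associator.iso ((W, X), tensor.obj (Y, Z))).hom
  triangle : ∀ X Y : M,
    (associator.iso ((X, unit), Y)).hom ≫
        vBimap tensor (𝟙 (ForgetEnrichment.of V X)) (leftUnitor.iso Y).hom =
      vBimap tensor (rightUnitor.iso X).hom (𝟙 (ForgetEnrichment.of V Y))

open MonoidalVCategory

/-- A strong monoidal action of a monoidal `V`-category `M` on a `V`-category `C`, with structure
isomorphisms `A ≅ I ⊘ A` and `M ⊘ (N ⊘ A) ≅ (M ⊗ N) ⊘ A`. -/
structure MonoidalAction (V : Type v) [Category.{u} V] [MonoidalCategory V] [BraidedCategory V]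
    (M : Type u₁) (C : Type u₂) [EnrichedCategory V M] [MonoidalVCategory V M]
    [EnrichedCategory V C] where
  action : EnrichedFunctor V (M × C) C
  unitIso : VNatIso (EnrichedFunctor.id V C) ((insertLeft (unit V : M)).comp V action)
  mulIso : VNatIso
    ((prodAssoc V M M C).comp V ((prodMap (EnrichedFunctor.id V M) action).comp V action))
    ((prodMap (tensor (V := V) (M := M)) (EnrichedFunctor.id V C)).comp V action)
  associativity : ∀ (K L N : M) (A : C),
    (mulIso.iso ((K, L), action.obj (N, A))).hom ≫
        (mulIso.iso ((tensor.obj (K, L), N), A)).hom ≫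
          vBimap action (associator.iso ((K, L), N)).hom (𝟙 (ForgetEnrichment.of V A)) =
      vBimap action (𝟙 (ForgetEnrichment.of V K)) (mulIso.iso ((L, N), A)).hom ≫
        (mulIso.iso ((K, tensor.obj (L, N)), A)).hom
  left_unitality : ∀ (N : M) (A : C),
    (unitIso.iso (action.obj (N, A))).hom ≫ (mulIso.iso ((unit V, N), A)).hom ≫
        vBimap action (leftUnitor.iso N).hom (𝟙 (ForgetEnrichment.of V A)) =
      𝟙 (ForgetEnrichment.of V (action.obj (N, A)))
  right_unitality : ∀ (N : M) (A : C),
    vBimap action (𝟙 (ForgetEnrichment.of V N)) (unitIso.iso A).hom ≫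
        (mulIso.iso ((N, unit V), A)).hom ≫
          vBimap action (rightUnitor.iso N).hom (𝟙 (ForgetEnrichment.of V A)) =
      𝟙 (ForgetEnrichment.of V (action.obj (N, A)))

namespace MonoidalAction

variable [BraidedCategory V] {M : Type u₁} {C : Type u₂} [EnrichedCategory V M]
  [MonoidalVCategory V M] [EnrichedCategory V C]

/-- The `V`-functor `N ⊘ - : C → C`. -/
def byObj (L : MonoidalAction V M C) (N : M) : EnrichedFunctor V C C :=
  (insertLeft N).comp V L.action

/-- The `V`-functor `- ⊘ A : M → C`. -/
def onObj (L : MonoidalAction V M C) (A : C) : EnrichedFunctor V M C :=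
  (insertRight A).comp V L.action

end MonoidalAction

end MonoidalActions

section Optics

variable {V : Type v} [Category.{u} V] [MonoidalCategory V] [SymmetricCategory V]
  [MonoidalClosed V] {M : Type u₁} {C : Type u₂} {D : Type u₃} [EnrichedCategory V M]
  [MonoidalVCategory V M] [EnrichedCategory V C] [EnrichedCategory V D]

/-- The `V`-functor `(N', N) ↦ C(S, N ⊘ A) ⊗ D(N' ⊘' B, T)`. -/
def opticDiagram (L : MonoidalAction V M C) (R : MonoidalAction V M D) (A : C) (B : D) (S : C)
    (T : D) : EnrichedFunctor V (Mᵒᵖ × M) V :=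
  (prodSwap V Mᵒᵖ M).comp V ((prodMap
    ((L.onObj A).comp V ((insertLeft (op S)).comp V (homFunctor V C)))
    ((opFunctor (R.onObj B)).comp V ((insertRight T).comp V (homFunctor V D)))).comp V
      (tensorFunctor V))

/-- The object of optics `∫^N C(S, N ⊘ A) ⊗ D(N ⊘' B, T)` from `(S, T)` with focus on `(A, B)`. -/
abbrev Optic (L : MonoidalAction V M C) (R : MonoidalAction V M D) (A : C) (B : D) (S : C)
    (T : D) [HasVCoend (opticDiagram L R A B S T)] : V :=
  vCoend (opticDiagram L R A B S T)

/-- The inclusion of `C(S, N ⊘ A) ⊗ D(N ⊘' B, T)` into the object of optics. -/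
abbrev opticι (L : MonoidalAction V M C) (R : MonoidalAction V M D) (A : C) (B : D) (S : C)
    (T : D) [HasVCoend (opticDiagram L R A B S T)] (N : M) :
    (S ⟶[V] L.action.obj (N, A)) ⊗ (R.action.obj (N, B) ⟶[V] T) ⟶ Optic L R A B S T :=
  vCoendι (opticDiagram L R A B S T) N

end Optics

section Tambara

variable {V : Type v} [Category.{u} V] [MonoidalCategory V] [SymmetricCategory V]
  [MonoidalClosed V] {M : Type u₁} {C : Type u₂} {D : Type u₃} [EnrichedCategory V M]
  [MonoidalVCategory V M] [EnrichedCategory V C] [EnrichedCategory V D]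

/-- The morphism `P(f, g) : P(A, B) ⟶ P(A', B')` for underlying `f : A' ⟶ A` and `g : B ⟶ B'`. -/
def profMap (P : EnrichedFunctor V (Cᵒᵖ × D) V) {A A' : C} {B B' : D}
    (f : ForgetEnrichment.of V A' ⟶ ForgetEnrichment.of V A)
    (g : ForgetEnrichment.of V B ⟶ ForgetEnrichment.of V B') :
    P.obj (op A, B) ⟶ P.obj (op A', B') :=
  MonoidalClosed.uncurry' ((λ_ (𝟙_ V)).inv ≫
    (ForgetEnrichment.homTo V f ⊗ₘ ForgetEnrichment.homTo V g) ≫ P.map (op A, B) (op A', B'))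

open MonoidalVCategory

/-- A generalized Tambara module for the actions `L` of `M` on `C` and `R` of `M` on `D`. -/
structure TambaraModule (L : MonoidalAction V M C) (R : MonoidalAction V M D) where
  /-- The underlying `V`-profunctor. -/
  P : EnrichedFunctor V (Cᵒᵖ × D) V
  /-- The family of structure morphisms `P(A, B) ⟶ P(N ⊘ A, N ⊘' B)`. -/
  str : ∀ (N : M) (A : C) (B : D),
    P.obj (op A, B) ⟶ P.obj (op (L.action.obj (N, A)), R.action.obj (N, B))
  /-- `V`-naturality in `A` and `B`. -/
  natural : ∀ (N : M) (X Y : Cᵒᵖ × D),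
    P.map X Y ≫ (ihom (P.obj X)).map (str N Y.1.unop Y.2) =
      ((prodMap (opFunctor (L.byObj N)) (R.byObj N)).comp V P).map X Y ≫
        (MonoidalClosed.pre (str N X.1.unop X.2)).app _
  /-- `V`-dinaturality in `N`: the family is a wedge for `(N', N) ↦ P(N' ⊘ A, N ⊘' B)`. -/
  dinatural : ∀ (N N' : M) (A : C) (B : D),
    str N A B ≫ wedgeLeft ((prodMap (opFunctor (L.onObj A)) (R.onObj B)).comp V P) N N' =
      str N' A B ≫ wedgeRight ((prodMap (opFunctor (L.onObj A)) (R.onObj B)).comp V P) N N'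
  str_unit : ∀ (A : C) (B : D),
    str (unit V) A B ≫ profMap P (L.unitIso.iso A).hom (R.unitIso.iso B).inv =
      𝟙 (P.obj (op A, B))
  str_tensor : ∀ (N N' : M) (A : C) (B : D),
    str (tensor.obj (N, N')) A B ≫
        profMap P (L.mulIso.iso ((N, N'), A)).hom (R.mulIso.iso ((N, N'), B)).inv =
      str N' A B ≫ str N (L.action.obj (N', A)) (R.action.obj (N', B))

namespace TambaraModule

variable {L : MonoidalAction V M C} {R : MonoidalAction V M D}

section Hom

variable (P Q : TambaraModule L R)

/-- Postcomposition with the structure of `Q` at `(N, A, B)`. -/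
def homLeft [HasVEnd (natDiagram P.P Q.P)] (p : M × C × D) :
    natObj P.P Q.P ⟶ (ihom (P.P.obj (op p.2.1, p.2.2))).obj
      (Q.P.obj (op (L.action.obj (p.1, p.2.1)), R.action.obj (p.1, p.2.2))) :=
  natπ P.P Q.P (op p.2.1, p.2.2) ≫ (ihom (P.P.obj (op p.2.1, p.2.2))).map (Q.str p.1 p.2.1 p.2.2)

/-- Precomposition with the structure of `P` at `(N, A, B)`. -/
def homRight [HasVEnd (natDiagram P.P Q.P)] (p : M × C × D) :
    natObj P.P Q.P ⟶ (ihom (P.P.obj (op p.2.1, p.2.2))).obj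
      (Q.P.obj (op (L.action.obj (p.1, p.2.1)), R.action.obj (p.1, p.2.2))) :=
  natπ P.P Q.P (op (L.action.obj (p.1, p.2.1)), R.action.obj (p.1, p.2.2)) ≫
    (MonoidalClosed.pre (P.str p.1 p.2.1 p.2.2)).app _

end Hom

end TambaraModule

lemma comp_ihom_map (X Y : V) {Z Z' : V} (f : Z ⟶ Z') :
    eComp V X Y Z ≫ (ihom X).map f = (ihom X).obj Y ◁ (ihom Y).map f ≫ eComp V X Y Z' := by
  have := eComp_eHomWhiskerLeft V X Y f
  rwa [MonoidalClosed.enrichedOrdinaryCategorySelf_eHomWhiskerLeft,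
    MonoidalClosed.enrichedOrdinaryCategorySelf_eHomWhiskerLeft] at this

lemma comp_pre {X X' : V} (f : X ⟶ X') (Y Z : V) :
    eComp V X' Y Z ≫ (MonoidalClosed.pre f).app Z =
      (MonoidalClosed.pre f).app Y ▷ (ihom Y).obj Z ≫ eComp V X Y Z := by
  have := eComp_eHomWhiskerRight V f Y Z
  rwa [MonoidalClosed.enrichedOrdinaryCategorySelf_eHomWhiskerRight,
    MonoidalClosed.enrichedOrdinaryCategorySelf_eHomWhiskerRight] at this

lemma ihom_map_comp (X : V) {Y Y' : V} (f : Y ⟶ Y') (Z : V) :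
    (ihom X).map f ▷ (ihom Y').obj Z ≫ eComp V X Y' Z =
      (ihom X).obj Y ◁ (MonoidalClosed.pre f).app Z ≫ eComp V X Y Z := by
  apply MonoidalClosed.uncurry_injective
  have h₁ := uncurry_tensorHom_comp ((ihom X).map f) (𝟙 ((ihom Y').obj Z))
  have h₂ := uncurry_tensorHom_comp (𝟙 ((ihom X).obj Y)) ((MonoidalClosed.pre f).app Z)
  rw [tensorHom_id] at h₁
  rw [id_tensorHom] at h₂
  refine h₁.trans (Eq.trans ?_ h₂.symm)
  rw [MonoidalClosed.uncurry_ihom_map, MonoidalClosed.uncurry_pre,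
    MonoidalClosed.uncurry_id_eq_ev, MonoidalClosed.uncurry_id_eq_ev, comp_whiskerRight,
    Category.assoc]

lemma id_ihom_map {X Y : V} (f : X ⟶ Y) :
    eId V X ≫ (ihom X).map f = eId V Y ≫ (MonoidalClosed.pre f).app Y := by
  apply MonoidalClosed.uncurry_injective
  rw [MonoidalClosed.uncurry_natural_right, MonoidalClosed.uncurry_pre_app]
  have h (Z : V) : MonoidalClosed.uncurry (eId V Z) = (ρ_ Z).hom := MonoidalClosed.uncurry_curry _
  rw [h, h, rightUnitor_naturality]

lemma tambComp_aux {W W' X Y Z X' Y' Z' : V} (x : X ⟶ X') (y : Y ⟶ Y') (z : Z ⟶ Z')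
    (k : W ⟶ (ihom X).obj Y) (k' : W ⟶ (ihom X').obj Y')
    (m : W' ⟶ (ihom Y).obj Z) (m' : W' ⟶ (ihom Y').obj Z')
    (h₁ : k ≫ (ihom X).map y = k' ≫ (MonoidalClosed.pre x).app Y')
    (h₂ : m ≫ (ihom Y).map z = m' ≫ (MonoidalClosed.pre y).app Z') :
    ((k ⊗ₘ m) ≫ eComp V X Y Z) ≫ (ihom X).map z =
      ((k' ⊗ₘ m') ≫ eComp V X' Y' Z') ≫ (MonoidalClosed.pre x).app Z' := by
  rw [Category.assoc, Category.assoc, comp_ihom_map, comp_pre, ← id_tensorHom, ← tensorHom_id,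
    tensorHom_comp_tensorHom_assoc, tensorHom_comp_tensorHom_assoc, h₂, ← h₁, Category.comp_id,
    Category.comp_id, ← Category.comp_id k, ← Category.comp_id m', ← tensorHom_comp_tensorHom_assoc,
    id_tensorHom, ← ihom_map_comp, ← tensorHom_id, tensorHom_comp_tensorHom_assoc]
  simp

end Tambara

section TambCategory

variable {V : Type v} [Category.{u} V] [MonoidalCategory V] [SymmetricCategory V]
  [MonoidalClosed V] [HasLimits V] {M C D : Type u} [EnrichedCategory V M]
  [MonoidalVCategory V M] [EnrichedCategory V C] [EnrichedCategory V D]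
  {L : MonoidalAction V M C} {R : MonoidalAction V M D}

namespace TambaraModule

variable (P Q : TambaraModule L R)

/-- The hom-object of Tambara modules: the intersection over all `(N, A, B)` of the equalizers of
the two maps `∫_{A, B} V(P(A, B), Q(A, B)) ⟶ V(P(A, B), Q(N ⊘ A, N ⊘' B))`. -/
def homObj : V := equalizer (Pi.lift (homLeft P Q)) (Pi.lift (homRight P Q))

/-- The inclusion of the hom-object into the object of `V`-natural transformations. -/
def homι : homObj P Q ⟶ natObj P.P Q.P :=
  equalizer.ι (Pi.lift (homLeft P Q)) (Pi.lift (homRight P Q))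

/-- The component of the hom-object of Tambara modules at `X = (A, B)`. -/
def homπ (X : Cᵒᵖ × D) : homObj P Q ⟶ (EnrichedCategory.Hom (P.P.obj X) (Q.P.obj X) : V) :=
  homι P Q ≫ natπ P.P Q.P X

lemma homπ_condition (N : M) (A : C) (B : D) :
    homπ P Q (op A, B) ≫ (ihom (P.P.obj (op A, B))).map (Q.str N A B) =
      homπ P Q (op (L.action.obj (N, A)), R.action.obj (N, B)) ≫
        (MonoidalClosed.pre (P.str N A B)).app _ := by
  have h := equalizer.condition (Pi.lift (homLeft P Q)) (Pi.lift (homRight P Q)) =≫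
    Pi.π _ (N, A, B)
  rw [Category.assoc, Category.assoc, Pi.lift_π, Pi.lift_π] at h
  exact (Category.assoc _ _ _).trans (h.trans (Category.assoc _ _ _).symm)

variable {P Q} in
lemma hom_ext' {W : V} {f g : W ⟶ homObj P Q} (h : ∀ X, f ≫ homπ P Q X = g ≫ homπ P Q X) :
    f = g :=
  equalizer.hom_ext (nat_hom_ext fun X => 
    (Category.assoc _ _ _).trans ((h X).trans (Category.assoc _ _ _).symm))

/-- The map into the hom-object given by a map into the object of `V`-natural transformations that
is compatible with the structures. -/
def homLift {W : V} (k : W ⟶ natObj P.P Q.P)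
    (hk : ∀ (N : M) (A : C) (B : D),
      (k ≫ natπ P.P Q.P (op A, B)) ≫ (ihom (P.P.obj (op A, B))).map (Q.str N A B) =
        (k ≫ natπ P.P Q.P (op (L.action.obj (N, A)), R.action.obj (N, B))) ≫
          (MonoidalClosed.pre (P.str N A B)).app _) : W ⟶ homObj P Q :=
  equalizer.lift k (Pi.hom_ext _ _ fun p => by
    rw [Category.assoc, Category.assoc, Pi.lift_π, Pi.lift_π]
    exact (Category.assoc _ _ _).symm.trans
      ((hk p.1 p.2.1 p.2.2).trans (Category.assoc _ _ _)))

lemma homLift_π {W : V} (k : W ⟶ natObj P.P Q.P) (hk) (X : Cᵒᵖ × D) :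
    homLift P Q k hk ≫ homπ P Q X = k ≫ natπ P.P Q.P X :=
  (Category.assoc _ _ _).symm.trans (congrArg (fun t => t ≫ _) (equalizer.lift_ι _ _))

/-- The identity of a Tambara module. -/
def homId : 𝟙_ V ⟶ homObj P P :=
  homLift P P (natId P.P) (fun N A B => by
    rw [natId_π, natId_π]
    exact id_ihom_map _)

/-- Composition of morphisms of Tambara modules. -/
def homComp (P Q S : TambaraModule L R) : homObj P Q ⊗ homObj Q S ⟶ homObj P S :=
  homLift P S ((homι P Q ⊗ₘ homι Q S) ≫ natComp P.P Q.P S.P)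
    (fun N A B => by
      have h (X : Cᵒᵖ × D) : ((homι P Q ⊗ₘ homι Q S) ≫ natComp P.P Q.P S.P) ≫ natπ P.P S.P X =
          (homπ P Q X ⊗ₘ homπ Q S X) ≫ eComp V (P.P.obj X) (Q.P.obj X) (S.P.obj X) := by
        rw [Category.assoc, natComp_π, tensorHom_comp_tensorHom_assoc]
        rfl
      rw [h, h]
      exact tambComp_aux _ _ _ _ _ _ _ (homπ_condition P Q N A B) (homπ_condition Q S N A B))

lemma homId_π (X : Cᵒᵖ × D) : homId P ≫ homπ P P X = eId V (P.P.obj X) := by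
  rw [homId, homLift_π, natId_π]

lemma homComp_π (P Q S : TambaraModule L R) (X : Cᵒᵖ × D) :
    homComp P Q S ≫ homπ P S X =
      (homπ P Q X ⊗ₘ homπ Q S X) ≫ eComp V (P.P.obj X) (Q.P.obj X) (S.P.obj X) := by
  rw [homComp, homLift_π, Category.assoc, natComp_π, tensorHom_comp_tensorHom_assoc]
  rfl

/-- The `V`-category `Tamb` of Tambara modules. -/
instance : EnrichedCategory V (TambaraModule L R) where
  Hom P Q := homObj P Q
  id P := homId P
  comp P Q S := homComp P Q S
  id_comp P Q := hom_ext' fun X => by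
    rw [Category.assoc, Category.assoc, homComp_π, ← tensorHom_id,
      tensorHom_comp_tensorHom_assoc, homId_π, Category.id_comp, id_tensor_comp,
      Iso.inv_hom_id_assoc]
  comp_id P Q := hom_ext' fun X => by
    rw [Category.assoc, Category.assoc, homComp_π, ← id_tensorHom,
      tensorHom_comp_tensorHom_assoc, homId_π, Category.id_comp, tensor_id_comp,
      Iso.inv_hom_id_assoc]
  assoc P Q S T := hom_ext' fun X => by
    simp only [Category.assoc]
    rw [homComp_π, homComp_π, ← tensorHom_id, ← id_tensorHom, tensorHom_comp_tensorHom_assoc,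
      tensorHom_comp_tensorHom_assoc, homComp_π, homComp_π, Category.id_comp, Category.id_comp,
      comp_assoc_aux, Iso.inv_hom_id_assoc]

/-- The `V`-functor `Tamb → V` evaluating a Tambara module at `(A, B)`. -/
def evalAt (L : MonoidalAction V M C) (R : MonoidalAction V M D) (A : C) (B : D) :
    EnrichedFunctor V (TambaraModule L R) V where
  obj P := P.P.obj (op A, B)
  map P Q := homπ P Q (op A, B)
  map_id P := homId_π P _
  map_comp P Q S := homComp_π P Q S _

/-- The `V`-functor `(P, Q) ↦ V(P(A, B), Q(S, T))` on `Tambᵒᵖ ⊗ Tamb`. -/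
def evalDiagram (L : MonoidalAction V M C) (R : MonoidalAction V M D) (A : C) (B : D) (S : C)
    (T : D) : EnrichedFunctor V ((TambaraModule L R)ᵒᵖ × TambaraModule L R) V :=
  (prodMap (opFunctor (evalAt L R A B)) (evalAt L R S T)).comp V (homFunctor V V)

end TambaraModule

end TambCategory

end EnrichedOptics

end

open EnrichedOptics

/-! The theorem is a Yoneda argument in `Tamb`. Fix the focus `a = (A, B)` and regard `C(S, N ⊘ A) ⊗
D(N ⊘' B, T)` as the hom-object of `Cᵒᵖ ⊗ D` from `(N ⊘ A, N ⊘' B)` to `k = (S, T)`. Then `Optic(a,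
k)` is a coend over `N` of representables in `k`. It is a profunctor in `k` by composition, and
acting by `K` on both coordinates followed by `K ⊘ (N ⊘ -) ≅ (K ⊗ N) ⊘ -` sends the summand at `N`
to the summand at `K ⊗ N`. This makes `Optic(a, -)` a Tambara module (`opticModule`). The coherence
laws of the actions give its unit and tensor axioms only up to isomorphisms `I ⊗ N ≅ N` and `(K ⊗ N)
⊗ N' ≅ K ⊗ (N ⊗ N')` of the index, but the coend does not see such reindexing (`isoPair_opticIn`).

Optics act on every Tambara module `P` by `P(a) ⊗ Optic(a, k) ⟶ P(k)` (`opticTransform`): apply the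
structure map at `N`, then the profunctor action. Dinaturality of the structure makes this well
defined on the coend; its naturality and its compatibility with `⊗` make the action compatible with
the structure maps (`opticStr_opticTransform`); its unit axiom makes the identity optic act
trivially (`idOptic_opticTransform`). Hence each `P(a)` maps to `Tamb(Optic(a, -), P)`
(`opticYoneda`), and the action is natural in `P` (`opticTransform_homEv`), so the curried actions
form a wedge with vertex `Optic(a, s)`, where `s = (S, T)`.

This wedge is shown directly to be limiting, which settles existence of the end over the possibly
large `Tamb` along with its value. Given a wedge `W`, take its component at `Optic(a, -)` and
evaluate it at the identity optic; this is a map `W ⟶ Optic(a, s)`. It recovers the component at any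
`P`, because the wedge condition between `Optic(a, -)` and `P`, tested on the morphisms coming from
`P(a)`, forces it (`eq_of_braided_wedge`). It is unique because acting on the identity optic by an
optic returns that optic (`idOptic_opticTransform_opticModule`). The legs of the wedge, restricted
to a summand, are the composite in the statement (`opticIn_curry_opticTransform`). -/

noncomputable section

namespace EnrichedOptics

/-! ### Global elements of hom-objects and composition with them. -/

section Elements

variable {V : Type v} [Category.{u} V] [MonoidalCategory V] {E : Type u₁} [EnrichedCategory V E]
  {E' : Type u₂} [EnrichedCategory V E']

/-- Precomposition with a global element of a hom-object. -/
def preElt {X Y : E} (g : 𝟙_ V ⟶ (X ⟶[V] Y)) (Z : E) : (Y ⟶[V] Z) ⟶ (X ⟶[V] Z) :=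
  (λ_ _).inv ≫ g ▷ _ ≫ eComp V X Y Z

/-- Postcomposition with a global element of a hom-object. -/
def postElt {Y Z : E} (g : 𝟙_ V ⟶ (Y ⟶[V] Z)) (X : E) : (X ⟶[V] Y) ⟶ (X ⟶[V] Z) :=
  (ρ_ _).inv ≫ _ ◁ g ≫ eComp V X Y Z

/-- Composition of global elements. -/
def compElt {X Y Z : E} (g : 𝟙_ V ⟶ (X ⟶[V] Y)) (h : 𝟙_ V ⟶ (Y ⟶[V] Z)) : 𝟙_ V ⟶ (X ⟶[V] Z) :=
  (λ_ _).inv ≫ (g ⊗ₘ h) ≫ eComp V X Y Z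

lemma homTo_comp' {X Y Z : ForgetEnrichment V E} (f : X ⟶ Y) (g : Y ⟶ Z) :
    ForgetEnrichment.homTo V (f ≫ g) =
      compElt (ForgetEnrichment.homTo V f) (ForgetEnrichment.homTo V g) := by
  rw [ForgetEnrichment.homTo_comp, Category.assoc]; rfl

lemma elt_postElt {X Y Z : E} (g : 𝟙_ V ⟶ (X ⟶[V] Y)) (h : 𝟙_ V ⟶ (Y ⟶[V] Z)) :
    g ≫ postElt h X = compElt g h := by
  rw [postElt, compElt, MonoidalCategory.tensorHom_def, rightUnitor_inv_naturality_assoc,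
    unitors_inv_equal, Category.assoc]

lemma elt_preElt {X Y Z : E} (g : 𝟙_ V ⟶ (X ⟶[V] Y)) (h : 𝟙_ V ⟶ (Y ⟶[V] Z)) :
    h ≫ preElt g Z = compElt g h := by
  rw [preElt, compElt, MonoidalCategory.tensorHom_def', leftUnitor_inv_naturality_assoc,
    Category.assoc]

/-- Associativity of composition with a global element in the first of the three slots. The next two
lemmas place it in the last and in the middle slot. -/
lemma preElt_eComp {X Y : E} (g : 𝟙_ V ⟶ (X ⟶[V] Y)) (Z W : E) :
    preElt g Z ▷ (Z ⟶[V] W) ≫ eComp V X Z W = eComp V Y Z W ≫ preElt g W := by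
  have h := e_assoc' V X Y Z W
  rw [preElt, preElt, leftUnitor_inv_naturality_assoc, whisker_exchange_assoc, comp_whiskerRight,
    comp_whiskerRight, Category.assoc, Category.assoc, ← h]
  monoidal

lemma eComp_postElt {Z W : E} (g : 𝟙_ V ⟶ (Z ⟶[V] W)) (X Y : E) :
    (X ⟶[V] Y) ◁ postElt g Y ≫ eComp V X Y W = eComp V X Y Z ≫ postElt g X := by
  have h := e_assoc V X Y Z W
  rw [postElt, postElt, rightUnitor_inv_naturality_assoc, ← whisker_exchange_assoc,
    MonoidalCategory.whiskerLeft_comp, MonoidalCategory.whiskerLeft_comp, Category.assoc,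
    Category.assoc, ← h]
  monoidal

lemma postElt_eComp {Y Z : E} (g : 𝟙_ V ⟶ (Y ⟶[V] Z)) (X W : E) :
    postElt g X ▷ (Z ⟶[V] W) ≫ eComp V X Z W = (X ⟶[V] Y) ◁ preElt g W ≫ eComp V X Y W := by
  have h := e_assoc V X Y Z W
  rw [preElt, postElt, MonoidalCategory.whiskerLeft_comp, MonoidalCategory.whiskerLeft_comp,
    Category.assoc, Category.assoc, ← h]
  monoidal

lemma preElt_map (F : EnrichedFunctor V E E') {X Y : E} (g : 𝟙_ V ⟶ (X ⟶[V] Y)) (Z : E) :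
    preElt g Z ≫ F.map X Z = F.map Y Z ≫ preElt (g ≫ F.map X Y) (F.obj Z) := by
  rw [preElt, preElt, leftUnitor_inv_naturality_assoc, Category.assoc, Category.assoc, F.map_comp,
    MonoidalCategory.tensorHom_def, comp_whiskerRight, Category.assoc, Category.assoc,
    whisker_exchange_assoc, whisker_exchange_assoc]

lemma postElt_map (F : EnrichedFunctor V E E') {Y Z : E} (g : 𝟙_ V ⟶ (Y ⟶[V] Z)) (X : E) :
    postElt g X ≫ F.map X Z = F.map X Y ≫ postElt (g ≫ F.map Y Z) (F.obj X) := by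
  rw [postElt, postElt, rightUnitor_inv_naturality_assoc, Category.assoc, Category.assoc,
    F.map_comp, MonoidalCategory.tensorHom_def', MonoidalCategory.whiskerLeft_comp, Category.assoc,
    Category.assoc, ← whisker_exchange_assoc, ← whisker_exchange_assoc]

lemma compElt_map (F : EnrichedFunctor V E E') {X Y Z : E} (g : 𝟙_ V ⟶ (X ⟶[V] Y))
    (h : 𝟙_ V ⟶ (Y ⟶[V] Z)) :
    compElt g h ≫ F.map X Z = compElt (g ≫ F.map X Y) (h ≫ F.map Y Z) := by
  rw [← elt_postElt, Category.assoc, postElt_map, ← Category.assoc, elt_postElt]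

@[simp] lemma preElt_eId (X Z : E) : preElt (eId V X) Z = 𝟙 _ := e_id_comp V X Z

@[simp] lemma postElt_eId (X Z : E) : postElt (eId V Z) X = 𝟙 _ := e_comp_id V X Z

@[simp] lemma compElt_eId {X Y : E} (g : 𝟙_ V ⟶ (X ⟶[V] Y)) : compElt g (eId V Y) = g := by
  rw [← elt_postElt, postElt_eId, Category.comp_id]

@[simp] lemma eId_compElt {X Y : E} (g : 𝟙_ V ⟶ (X ⟶[V] Y)) : compElt (eId V X) g = g := by
  rw [← elt_preElt, preElt_eId, Category.comp_id]

lemma postElt_postElt {X Y Z : E} (g : 𝟙_ V ⟶ (X ⟶[V] Y)) (h : 𝟙_ V ⟶ (Y ⟶[V] Z)) (W : E) :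
    postElt g W ≫ postElt h W = postElt (compElt g h) W := by
  conv_rhs => rw [← elt_postElt g h, postElt, MonoidalCategory.whiskerLeft_comp, Category.assoc,
    eComp_postElt]
  rw [postElt, Category.assoc, Category.assoc]

lemma preElt_preElt {X Y Z : E} (g : 𝟙_ V ⟶ (X ⟶[V] Y)) (h : 𝟙_ V ⟶ (Y ⟶[V] Z)) (W : E) :
    preElt h W ≫ preElt g W = preElt (compElt g h) W := by
  conv_rhs => rw [← elt_preElt g h, preElt, comp_whiskerRight, Category.assoc, preElt_eComp]
  rw [preElt, Category.assoc, Category.assoc]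

lemma preElt_postElt {X Y Z W : E} (g : 𝟙_ V ⟶ (X ⟶[V] Y)) (h : 𝟙_ V ⟶ (Z ⟶[V] W)) :
    preElt g Z ≫ postElt h X = postElt h Y ≫ preElt g W := by
  have := preElt_eComp g Z W
  rw [postElt, postElt, rightUnitor_inv_naturality_assoc, Category.assoc, Category.assoc,
    ← preElt_eComp, whisker_exchange_assoc]

lemma compElt_assoc {X Y Z W : E} (f : 𝟙_ V ⟶ (X ⟶[V] Y)) (g : 𝟙_ V ⟶ (Y ⟶[V] Z))
    (h : 𝟙_ V ⟶ (Z ⟶[V] W)) : compElt (compElt f g) h = compElt f (compElt g h) := by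
  rw [← elt_preElt (compElt f g), ← preElt_preElt, ← Category.assoc, elt_preElt, elt_preElt]

end Elements

/-! ### Copresheaves as objects with an uncurried action. -/

section Actions

variable {V : Type v} [Category.{u} V] [MonoidalCategory V] [SymmetricCategory V]
  [MonoidalClosed V] {J : Type u₁} {K : Type u₂} [EnrichedCategory V J] [EnrichedCategory V K]

lemma act_eId (F : EnrichedFunctor V J V) (X : J) :
    F.obj X ◁ eId V X ≫ act F X X = (ρ_ (F.obj X)).hom := by
  rw [act, ← MonoidalClosed.uncurry_natural_left, F.map_id]
  exact MonoidalClosed.uncurry_curry _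

lemma act_eComp (F : EnrichedFunctor V J V) (X Y Z : J) :
    F.obj X ◁ eComp V X Y Z ≫ act F X Z =
      (α_ _ _ _).inv ≫ act F X Y ▷ (Y ⟶[V] Z) ≫ act F Y Z := by
  rw [act, ← MonoidalClosed.uncurry_natural_left, F.map_comp]
  exact uncurry_tensorHom_comp _ _

/-- The `V`-functor `J → V` given by an action on a family of objects. -/
def ofAct (O : J → V) (a : ∀ X Y, O X ⊗ (X ⟶[V] Y) ⟶ O Y)
    (a_id : ∀ X, O X ◁ eId V X ≫ a X X = (ρ_ (O X)).hom)
    (a_comp : ∀ X Y Z, O X ◁ eComp V X Y Z ≫ a X Z =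
      (α_ _ _ _).inv ≫ a X Y ▷ (Y ⟶[V] Z) ≫ a Y Z) : EnrichedFunctor V J V where
  obj := O
  map X Y := MonoidalClosed.curry (a X Y)
  map_id X := by
    apply MonoidalClosed.uncurry_injective
    rw [MonoidalClosed.uncurry_natural_left, MonoidalClosed.uncurry_curry, a_id]
    exact (MonoidalClosed.uncurry_curry _).symm
  map_comp X Y Z := by
    apply MonoidalClosed.uncurry_injective
    rw [MonoidalClosed.uncurry_natural_left, MonoidalClosed.uncurry_curry, a_comp]
    refine Eq.trans ?_ (uncurry_tensorHom_comp _ _).symm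
    rw [MonoidalClosed.uncurry_curry, MonoidalClosed.uncurry_curry]

lemma act_ofAct (O : J → V) (a : ∀ X Y, O X ⊗ (X ⟶[V] Y) ⟶ O Y) (a_id a_comp) (X Y : J) :
    act (ofAct O a a_id a_comp) X Y = a X Y :=
  MonoidalClosed.uncurry_curry _

lemma act_comp (G : EnrichedFunctor V J K) (F : EnrichedFunctor V K V) (X Y : J) :
    act (G.comp V F) X Y = F.obj (G.obj X) ◁ G.map X Y ≫ act F (G.obj X) (G.obj Y) :=
  MonoidalClosed.uncurry_natural_left _ _

/-- The action of a global element of a hom-object. -/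
def actElt (F : EnrichedFunctor V J V) {X Y : J} (g : 𝟙_ V ⟶ (X ⟶[V] Y)) : F.obj X ⟶ F.obj Y :=
  (ρ_ _).inv ≫ F.obj X ◁ g ≫ act F X Y

/-- Associativity of the action when the first arrow is global. It moves a structure isomorphism
from a module value onto the hom-object acting on it. -/
lemma actElt_act (F : EnrichedFunctor V J V) {X Y : J} (g : 𝟙_ V ⟶ (X ⟶[V] Y)) (Z : J) :
    actElt F g ▷ (Y ⟶[V] Z) ≫ act F Y Z = F.obj X ◁ preElt g Z ≫ act F X Z := by
  rw [actElt, preElt, MonoidalCategory.whiskerLeft_comp, MonoidalCategory.whiskerLeft_comp,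
    Category.assoc, Category.assoc, act_eComp]
  monoidal

/-- Links the action of a global element to the form in which `profMap` is defined. -/
lemma actElt_eq_uncurry' (F : EnrichedFunctor V J V) {X Y : J} (g : 𝟙_ V ⟶ (X ⟶[V] Y)) :
    actElt F g = MonoidalClosed.uncurry' (g ≫ F.map X Y) := by
  rw [actElt, act, ← MonoidalClosed.uncurry_natural_left]; rfl

end Actions

/-! ### Hom-objects of a tensor product of categories, with one coordinate held at a global element.
-/

section Pairs

variable {V : Type v} [Category.{u} V] [MonoidalCategory V] [BraidedCategory V]
  {C : Type u₁} {D : Type u₂} [EnrichedCategory V C] [EnrichedCategory V D]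

/-- The generalized element `(e, r)` of a hom-object of `C ⊗ D` whose first component is global. -/
def pairR {W : V} {X X' : C} {Y Y' : D} (e : 𝟙_ V ⟶ (X ⟶[V] X')) (r : W ⟶ (Y ⟶[V] Y')) :
    W ⟶ ((X, Y) ⟶[V] (X', Y')) :=
  (λ_ W).inv ≫ (e ⊗ₘ r)

/-- The generalized element `(r, e)` of a hom-object of `C ⊗ D` whose second component is
global. -/
def pairL {W : V} {X X' : C} {Y Y' : D} (r : W ⟶ (X ⟶[V] X')) (e : 𝟙_ V ⟶ (Y ⟶[V] Y')) :
    W ⟶ ((X, Y) ⟶[V] (X', Y')) :=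
  (ρ_ W).inv ≫ (r ⊗ₘ e)

lemma comp_pairR {W W' : V} {X X' : C} {Y Y' : D} (k : W' ⟶ W) (e : 𝟙_ V ⟶ (X ⟶[V] X'))
    (r : W ⟶ (Y ⟶[V] Y')) : k ≫ pairR e r = pairR e (k ≫ r) := by
  rw [pairR, pairR, leftUnitor_inv_naturality_assoc, ← id_tensorHom, tensorHom_comp_tensorHom,
    Category.id_comp]

lemma comp_pairL {W W' : V} {X X' : C} {Y Y' : D} (k : W' ⟶ W) (r : W ⟶ (X ⟶[V] X'))
    (e : 𝟙_ V ⟶ (Y ⟶[V] Y')) : k ≫ pairL r e = pairL (k ≫ r) e := by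
  rw [pairL, pairL, rightUnitor_inv_naturality_assoc, ← tensorHom_id, tensorHom_comp_tensorHom,
    Category.id_comp]

lemma pairR_comp {W : V} {X X' X₁ X₁' : C} {Y Y' Y₁ Y₁' : D} (e : 𝟙_ V ⟶ (X ⟶[V] X'))
    (r : W ⟶ (Y ⟶[V] Y')) (f : (X ⟶[V] X') ⟶ (X₁ ⟶[V] X₁')) (g : (Y ⟶[V] Y') ⟶ (Y₁ ⟶[V] Y₁')) :
    pairR e r ≫ (f ⊗ₘ g) = pairR (e ≫ f) (r ≫ g) := by
  rw [pairR, pairR, Category.assoc, tensorHom_comp_tensorHom]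

lemma pairL_comp {W : V} {X X' X₁ X₁' : C} {Y Y' Y₁ Y₁' : D} (r : W ⟶ (X ⟶[V] X'))
    (e : 𝟙_ V ⟶ (Y ⟶[V] Y')) (f : (X ⟶[V] X') ⟶ (X₁ ⟶[V] X₁')) (g : (Y ⟶[V] Y') ⟶ (Y₁ ⟶[V] Y₁')) :
    pairL r e ≫ (f ⊗ₘ g) = pairL (r ≫ f) (e ≫ g) := by
  rw [pairL, pairL, Category.assoc, tensorHom_comp_tensorHom]

/-- When one of the four factors is the unit, the middle-four interchange collapses. A braiding
survives only if the unit is an outer factor; if it is one of the two middle factors, only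
associators and unitors remain. The four cases evaluate composition against `pairR` and `pairL` on
either side. -/
lemma tensorμ_unit_left (W a b : V) : (λ_ W).inv ▷ (a ⊗ b) ≫ tensorμ (𝟙_ V) W a b =
    (α_ W a b).inv ≫ (β_ W a).hom ▷ b ≫ (α_ a W b).hom ≫ (λ_ a).inv ▷ (W ⊗ b) := by
  dsimp only [tensorμ]; monoidal

lemma tensorμ_unit_right (W a b : V) : (a ⊗ b) ◁ (λ_ W).inv ≫ tensorμ a b (𝟙_ V) W =
    (α_ a b W).hom ≫ (ρ_ a).inv ▷ (b ⊗ W) := by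
  dsimp only [tensorμ]; rw [braiding_tensorUnit_right]; monoidal

lemma tensorμ_unit_left' (W a b : V) : (ρ_ W).inv ▷ (a ⊗ b) ≫ tensorμ W (𝟙_ V) a b =
    (α_ W a b).inv ≫ (W ⊗ a) ◁ (λ_ b).inv := by
  dsimp only [tensorμ]; rw [braiding_tensorUnit_left]; monoidal

lemma tensorμ_unit_right' (W a b : V) : (a ⊗ b) ◁ (ρ_ W).inv ≫ tensorμ a b W (𝟙_ V) =
    (α_ a b W).hom ≫ a ◁ (β_ b W).hom ≫ (α_ a W b).inv ≫ (a ⊗ W) ◁ (ρ_ b).inv := by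
  dsimp only [tensorμ]; monoidal

/-- The moving coordinate is the second, so `W` has to cross the first factor of the other
hom-object; the constant coordinate contributes only a precomposition. Of the three companions that
follow, only `whiskerLeft_pairL_eComp` needs such a crossing. -/
lemma pairR_whiskerRight_eComp {W : V} {X X' : C} {Y Y' : D} (e : 𝟙_ V ⟶ (X ⟶[V] X'))
    (r : W ⟶ (Y ⟶[V] Y')) (X'' : C) (Y'' : D) :
    pairR e r ▷ ((X', Y') ⟶[V] (X'', Y'')) ≫ eComp V (X, Y) (X', Y') (X'', Y'') =
      (α_ W (X' ⟶[V] X'') (Y' ⟶[V] Y'')).inv ≫ (β_ _ _).hom ▷ _ ≫ (α_ _ _ _).hom ≫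
        (preElt e X'' ⊗ₘ (r ▷ _ ≫ eComp V Y Y' Y'')) := by
  rw [pairR, prod_eComp, comp_whiskerRight, Category.assoc]
  refine (congrArg (fun t => _ ≫ t) (tensorμ_natural_left_assoc _ _ _ _ _)).trans ?_
  refine ((reassoc_of% (tensorμ_unit_left W (X' ⟶[V] X'') (Y' ⟶[V] Y''))) _).trans ?_
  rw [tensorHom_comp_tensorHom, whiskerRight_comp_tensorHom]
  rfl

lemma whiskerLeft_pairR_eComp {W : V} {X X' : C} {Y Y' : D} (e : 𝟙_ V ⟶ (X ⟶[V] X'))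
    (r : W ⟶ (Y ⟶[V] Y')) (X'' : C) (Y'' : D) :
    ((X'', Y'') ⟶[V] (X, Y)) ◁ pairR e r ≫ eComp V (X'', Y'') (X, Y) (X', Y') =
      (α_ (X'' ⟶[V] X) (Y'' ⟶[V] Y) W).hom ≫
        (postElt e X'' ⊗ₘ (_ ◁ r ≫ eComp V Y'' Y Y')) := by
  rw [pairR, prod_eComp, MonoidalCategory.whiskerLeft_comp, Category.assoc]
  refine (congrArg (fun t => _ ≫ t) (tensorμ_natural_right_assoc _ _ _ _ _)).trans ?_
  refine ((reassoc_of% (tensorμ_unit_right W (X'' ⟶[V] X) (Y'' ⟶[V] Y))) _).trans ?_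
  rw [tensorHom_comp_tensorHom, whiskerRight_comp_tensorHom]
  rfl

lemma pairL_whiskerRight_eComp {W : V} {X X' : C} {Y Y' : D} (r : W ⟶ (X ⟶[V] X'))
    (e : 𝟙_ V ⟶ (Y ⟶[V] Y')) (X'' : C) (Y'' : D) :
    pairL r e ▷ ((X', Y') ⟶[V] (X'', Y'')) ≫ eComp V (X, Y) (X', Y') (X'', Y'') =
      (α_ W (X' ⟶[V] X'') (Y' ⟶[V] Y'')).inv ≫
        ((r ▷ _ ≫ eComp V X X' X'') ⊗ₘ preElt e Y'') := by
  rw [pairL, prod_eComp, comp_whiskerRight, Category.assoc]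
  refine (congrArg (fun t => _ ≫ t) (tensorμ_natural_left_assoc _ _ _ _ _)).trans ?_
  refine ((reassoc_of% (tensorμ_unit_left' W (X' ⟶[V] X'') (Y' ⟶[V] Y''))) _).trans ?_
  rw [tensorHom_comp_tensorHom, whiskerLeft_comp_tensorHom]
  rfl

lemma whiskerLeft_pairL_eComp {W : V} {X X' : C} {Y Y' : D} (r : W ⟶ (X ⟶[V] X'))
    (e : 𝟙_ V ⟶ (Y ⟶[V] Y')) (X'' : C) (Y'' : D) :
    ((X'', Y'') ⟶[V] (X, Y)) ◁ pairL r e ≫ eComp V (X'', Y'') (X, Y) (X', Y') =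
      (α_ (X'' ⟶[V] X) (Y'' ⟶[V] Y) W).hom ≫ _ ◁ (β_ _ _).hom ≫ (α_ _ _ _).inv ≫
        ((_ ◁ r ≫ eComp V X'' X X') ⊗ₘ postElt e Y'') := by
  rw [pairL, prod_eComp, MonoidalCategory.whiskerLeft_comp, Category.assoc]
  refine (congrArg (fun t => _ ≫ t) (tensorμ_natural_right_assoc _ _ _ _ _)).trans ?_
  refine ((reassoc_of% (tensorμ_unit_right' W (X'' ⟶[V] X) (Y'' ⟶[V] Y))) _).trans ?_
  rw [tensorHom_comp_tensorHom, whiskerLeft_comp_tensorHom]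
  rfl

/-- With both coordinates global, the remaining braiding is one with the unit, hence trivial, and
precomposition acts coordinatewise. -/
lemma preElt_pair {X X' : C} {Y Y' : D} (e : 𝟙_ V ⟶ (X ⟶[V] X')) (e' : 𝟙_ V ⟶ (Y ⟶[V] Y'))
    (X'' : C) (Y'' : D) : preElt (pairR e e') (X'', Y'') = (preElt e X'' ⊗ₘ preElt e' Y'') := by
  rw [preElt, pairR_whiskerRight_eComp]
  change (λ_ ((X' ⟶[V] X'') ⊗ (Y' ⟶[V] Y''))).inv ≫ _ = _
  have : preElt e' Y'' = (λ_ _).inv ≫ (e' ▷ _ ≫ eComp V Y Y' Y'') := rfl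
  rw [braiding_tensorUnit_left, MonoidalCategory.tensorHom_def', MonoidalCategory.tensorHom_def',
    this]
  monoidal

lemma postElt_pair {X X' : C} {Y Y' : D} (e : 𝟙_ V ⟶ (X ⟶[V] X')) (e' : 𝟙_ V ⟶ (Y ⟶[V] Y'))
    (X'' : C) (Y'' : D) :
    postElt (pairR e e') (X'', Y'') = (postElt e X'' ⊗ₘ postElt e' Y'') := by
  rw [postElt, whiskerLeft_pairR_eComp]
  change (ρ_ ((X'' ⟶[V] X) ⊗ (Y'' ⟶[V] Y))).inv ≫ _ = _
  have : postElt e' Y'' = (ρ_ _).inv ≫ (_ ◁ e' ≫ eComp V Y'' Y Y') := rfl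
  rw [MonoidalCategory.tensorHom_def', MonoidalCategory.tensorHom_def', this]
  monoidal

lemma pairR_preElt {W : V} {X X' X₁ : C} {Y Y' Y₁ : D} (e : 𝟙_ V ⟶ (X ⟶[V] X'))
    (r : W ⟶ (Y ⟶[V] Y')) (g : 𝟙_ V ⟶ (X₁ ⟶[V] X)) (g' : 𝟙_ V ⟶ (Y₁ ⟶[V] Y)) :
    pairR e r ≫ preElt (pairR g g') (X', Y') = pairR (compElt g e) (r ≫ preElt g' Y') := by
  rw [preElt_pair, ← elt_preElt]; exact pairR_comp _ _ _ _

lemma pairR_postElt {W : V} {X X' X₁ : C} {Y Y' Y₁ : D} (e : 𝟙_ V ⟶ (X ⟶[V] X'))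
    (r : W ⟶ (Y ⟶[V] Y')) (g : 𝟙_ V ⟶ (X' ⟶[V] X₁)) (g' : 𝟙_ V ⟶ (Y' ⟶[V] Y₁)) :
    pairR e r ≫ postElt (pairR g g') (X, Y) = pairR (compElt e g) (r ≫ postElt g' Y) := by
  rw [postElt_pair, ← elt_postElt]; exact pairR_comp _ _ _ _

lemma pairL_preElt {W : V} {X X' X₁ : C} {Y Y' Y₁ : D} (r : W ⟶ (X ⟶[V] X'))
    (e : 𝟙_ V ⟶ (Y ⟶[V] Y')) (g : 𝟙_ V ⟶ (X₁ ⟶[V] X)) (g' : 𝟙_ V ⟶ (Y₁ ⟶[V] Y)) :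
    pairL r e ≫ preElt (pairR g g') (X', Y') = pairL (r ≫ preElt g X') (compElt g' e) := by
  rw [preElt_pair, ← elt_preElt]; exact pairL_comp _ _ _ _

lemma pairL_postElt {W : V} {X X' X₁ : C} {Y Y' Y₁ : D} (r : W ⟶ (X ⟶[V] X'))
    (e : 𝟙_ V ⟶ (Y ⟶[V] Y')) (g : 𝟙_ V ⟶ (X' ⟶[V] X₁)) (g' : 𝟙_ V ⟶ (Y' ⟶[V] Y₁)) :
    pairL r e ≫ postElt (pairR g g') (X, Y) = pairL (r ≫ postElt g X) (compElt e g') := by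
  rw [postElt_pair, ← elt_postElt]; exact pairL_comp _ _ _ _

lemma pairR_elt_eq_pairL {X X' : C} {Y Y' : D} (e : 𝟙_ V ⟶ (X ⟶[V] X'))
    (e' : 𝟙_ V ⟶ (Y ⟶[V] Y')) : pairL e e' = pairR e e' := by
  rw [pairL, pairR, unitors_inv_equal]

lemma compElt_pair {X X' X'' : C} {Y Y' Y'' : D} (e : 𝟙_ V ⟶ (X ⟶[V] X'))
    (e' : 𝟙_ V ⟶ (Y ⟶[V] Y')) (g : 𝟙_ V ⟶ (X' ⟶[V] X'')) (g' : 𝟙_ V ⟶ (Y' ⟶[V] Y'')) :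
    compElt (pairR e e') (pairR g g') = pairR (compElt e g) (compElt e' g') := by
  rw [← elt_postElt, pairR_postElt, elt_postElt]

/-- Composition in `Cᵒᵖ` contains a braiding, which for two global elements is that of the unit with
itself, an identity. -/
lemma compElt_op {X Y Z : C} (g : 𝟙_ V ⟶ (X ⟶[V] Y)) (h : 𝟙_ V ⟶ (Y ⟶[V] Z)) :
    compElt (E := Cᵒᵖ) (X := op Z) (Y := op Y) (Z := op X) h g = compElt g h := by
  rw [compElt, compElt, eComp_op_eq]
  refine (congrArg _ (BraidedCategory.braiding_naturality_assoc _ _ _)).trans ?_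
  rw [braiding_tensorUnit_left, unitors_equal, Iso.hom_inv_id, Category.id_comp]

lemma preElt_op {X Y : C} (g : 𝟙_ V ⟶ (X ⟶[V] Y)) (Z : C) :
    preElt (E := Cᵒᵖ) (X := op Y) (Y := op X) g (op Z) = postElt g Z := by
  rw [preElt, postElt, eComp_op_eq]
  refine (congrArg _ (BraidedCategory.braiding_naturality_left_assoc _ _ _)).trans ?_
  rw [braiding_tensorUnit_left, Category.assoc, Iso.inv_hom_id_assoc]
  rfl

lemma postElt_op {X Y : C} (g : 𝟙_ V ⟶ (X ⟶[V] Y)) (Z : C) :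
    postElt (E := Cᵒᵖ) (Y := op Y) (Z := op X) g (op Z) = preElt g Z := by
  rw [preElt, postElt, eComp_op_eq]
  refine (congrArg _ (BraidedCategory.braiding_naturality_right_assoc _ _ _)).trans ?_
  rw [braiding_tensorUnit_right, Category.assoc, Iso.inv_hom_id_assoc]
  rfl

end Pairs

/-! ### Maps out of a coend tensored with a fixed object. -/

section Coends

variable {V : Type v} [Category.{u} V] [MonoidalCategory V] [SymmetricCategory V]
  [MonoidalClosed V] {J : Type u₁} [EnrichedCategory V J] (T : EnrichedFunctor V (Jᵒᵖ × J) V)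
  [HasVCoend T]

lemma vCoend_condition (X Y : J) :
    (coendIndex T).fst (X, Y) ≫ vCoendι T X = (coendIndex T).snd (X, Y) ≫ vCoendι T Y :=
  Multicoequalizer.condition (coendIndex T) (X, Y)

variable {T} in
-- Tensoring with `Z` is a left adjoint and preserves the coend; concretely, one curries and uses
-- that the coend inclusions are jointly epic.
lemma whiskerLeft_vCoend_hom_ext {Z Y : V} {f g : Z ⊗ vCoend T ⟶ Y}
    (h : ∀ X, Z ◁ vCoendι T X ≫ f = Z ◁ vCoendι T X ≫ g) : f = g :=
  MonoidalClosed.curry_injective (Multicoequalizer.hom_ext _ _ _ fun X => by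
    rw [← MonoidalClosed.curry_natural_left, ← MonoidalClosed.curry_natural_left]
    exact congrArg _ (h X))

variable {T} in
lemma whiskerRight_vCoend_hom_ext {Z Y : V} {f g : vCoend T ⊗ Z ⟶ Y}
    (h : ∀ X, vCoendι T X ▷ Z ≫ f = vCoendι T X ▷ Z ≫ g) : f = g := by
  rw [← cancel_epi (β_ Z (vCoend T)).hom]
  refine whiskerLeft_vCoend_hom_ext fun X => ?_
  rw [BraidedCategory.braiding_naturality_right_assoc, h,
    BraidedCategory.braiding_naturality_right_assoc]

/-- The map out of `Z ⊗ ∫^X T(X, X)` given by a compatible family. -/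
def whiskerLeftDesc {Z Y : V} (k : ∀ X, Z ⊗ T.obj (op X, X) ⟶ Y)
    (hk : ∀ X X', Z ◁ (coendIndex T).fst (X, X') ≫ k X = Z ◁ (coendIndex T).snd (X, X') ≫ k X') :
    Z ⊗ vCoend T ⟶ Y :=
  MonoidalClosed.uncurry (Multicoequalizer.desc (coendIndex T) _ (fun X => MonoidalClosed.curry
      (k X))
    (fun p => by
      refine (MonoidalClosed.curry_natural_left _ _).symm.trans
        (Eq.trans ?_ (MonoidalClosed.curry_natural_left _ _))
      exact congrArg _ (hk p.1 p.2)))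

lemma ι_whiskerLeftDesc {Z Y : V} (k : ∀ X, Z ⊗ T.obj (op X, X) ⟶ Y) (hk) (X : J) :
    Z ◁ vCoendι T X ≫ whiskerLeftDesc T k hk = k X := by
  rw [whiskerLeftDesc, ← MonoidalClosed.uncurry_natural_left]
  refine (congrArg _ (Multicoequalizer.π_desc _ _ _ _ _)).trans ?_
  exact MonoidalClosed.uncurry_curry _

/-- The map out of `∫^X T(X, X) ⊗ Z` given by a compatible family. -/
def whiskerRightDesc {Z Y : V} (k : ∀ X, T.obj (op X, X) ⊗ Z ⟶ Y)
    (hk : ∀ X X', (coendIndex T).fst (X, X') ▷ Z ≫ k X = (coendIndex T).snd (X, X') ▷ Z ≫ k X') :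
    vCoend T ⊗ Z ⟶ Y :=
  (β_ _ _).hom ≫ whiskerLeftDesc T (fun X => (β_ Z (T.obj (op X, X))).hom ≫ k X) (fun X X' => by
    refine (BraidedCategory.braiding_naturality_right_assoc _ _ _).trans
      (Eq.trans ?_ (BraidedCategory.braiding_naturality_right_assoc _ _ _).symm)
    exact congrArg _ (hk X X'))

lemma ι_whiskerRightDesc {Z Y : V} (k : ∀ X, T.obj (op X, X) ⊗ Z ⟶ Y) (hk) (X : J) :
    vCoendι T X ▷ Z ≫ whiskerRightDesc T k hk = k X := by
  refine (BraidedCategory.braiding_naturality_left_assoc _ _ _).trans ?_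
  refine (congrArg (fun t => _ ≫ t) (ι_whiskerLeftDesc T _ _ X)).trans ?_
  exact SymmetricCategory.symmetry_assoc _ _ _

end Coends

/-! ### Optics as a coend of representables on `Cᵒᵖ ⊗ D`. -/

section OpticDiagram

variable {V : Type v} [Category.{u} V] [MonoidalCategory V] [SymmetricCategory V]
  [MonoidalClosed V]

/-- `homFunctor` acts on both variables at once; the frozen one acts by an identity, which
`insertLeft_aux` removes. The next lemma is the contravariant counterpart, where the braiding
remains. -/
lemma insertLeft_act_homFunctor {C : Type u₁} [EnrichedCategory V C] (X Y Z : C) :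
    act ((insertLeft (op X)).comp V (homFunctor V C)) Y Z = eComp V X Y Z := by
  refine (act_comp _ _ _ _).trans ?_
  refine (congrArg (fun t => _ ≫ t) (MonoidalClosed.uncurry_curry _)).trans ?_
  have := insertLeft_aux (O := (X ⟶[V] Y)) (eId V X) (𝟙 _) (𝟙 _)
    ((β_ (X ⟶[V] Y) (X ⟶[V] X)).hom ≫ eComp V X X Y) (eComp V X Y Z)
    (by rw [Category.comp_id]; exact hom_unit_aux _ _ (e_id_comp V X Y))
  rw [id_tensorHom_id, Category.comp_id, MonoidalCategory.whiskerLeft_id, Category.id_comp] at this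
  exact this

lemma insertRight_act_homFunctor {C : Type u₁} [EnrichedCategory V C] (X Y Z : C) :
    act ((insertRight Z).comp V (homFunctor V C)) (op Y) (op X) =
      (β_ (Y ⟶[V] Z) (X ⟶[V] Y)).hom ≫ eComp V X Y Z := by
  refine (act_comp _ _ _ _).trans ?_
  refine (congrArg (fun t => _ ≫ t) (MonoidalClosed.uncurry_curry _)).trans ?_
  have := insertRight_aux (O := (Y ⟶[V] Z)) (eId V Z) (𝟙 _) (𝟙 _)
    ((β_ (Y ⟶[V] Z) (X ⟶[V] Y)).hom ≫ eComp V X Y Z) (eComp V X Z Z)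
    (by rw [Category.comp_id]; exact ((Iso.inv_comp_eq _).1 (e_comp_id V X Z)).trans
          (Category.comp_id _))
  rw [id_tensorHom_id, Category.comp_id, MonoidalCategory.whiskerLeft_id, Category.id_comp] at this
  exact this

lemma tensor_ev_aux {X X' Y Y' f f' g g' : V} (k : f' ⟶ f) (l : g' ⟶ g) (a : X ⊗ f ⟶ X')
    (b : Y ⊗ g ⟶ Y') :
    (X ⊗ Y) ◁ (k ⊗ₘ l) ≫ (α_ (X ⊗ Y) f g).inv ≫
        ((α_ X Y f).hom ≫ X ◁ (β_ Y f).hom ≫ (α_ X f Y).inv ≫ a ▷ Y) ▷ g ≫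
          (α_ X' Y g).hom ≫ X' ◁ b =
      tensorμ X Y f' g' ≫ ((X ◁ k ≫ a) ⊗ₘ (Y ◁ l ≫ b)) := by
  have h : tensorμ X Y f' g' ≫ ((X ◁ k ≫ a) ⊗ₘ (Y ◁ l ≫ b)) =
      ((X ⊗ Y) ◁ (k ⊗ₘ l) ≫ tensorμ X Y f g) ≫ (a ⊗ₘ b) := by
    rw [tensorμ_natural_right, Category.assoc, tensorHom_comp_tensorHom]
  rw [h, Category.assoc, MonoidalCategory.tensorHom_def a b]
  dsimp only [tensorμ]
  monoidal

/-- The two actions run in parallel once the middle-four interchange has brought each hom-object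
next to the object it acts on. -/
lemma act_prodMap_tensorFunctor {J : Type u₁} {K : Type u₂} [EnrichedCategory V J]
    [EnrichedCategory V K] (F : EnrichedFunctor V J V) (G : EnrichedFunctor V K V) (X Y : J × K) :
    act ((prodMap F G).comp V (tensorFunctor V)) X Y =
      tensorμ (F.obj X.1) (G.obj X.2) (X.1 ⟶[V] Y.1) (X.2 ⟶[V] Y.2) ≫
        (act F X.1 Y.1 ⊗ₘ act G X.2 Y.2) := by
  refine (act_comp _ _ _ _).trans ?_
  refine (congrArg (fun t => _ ≫ t) (MonoidalClosed.uncurry_curry _)).trans ?_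
  refine (tensor_ev_aux _ _ _ _).trans ?_
  rw [act, act, MonoidalClosed.uncurry_eq, MonoidalClosed.uncurry_eq]
  rfl

variable {M : Type u₁} {C : Type u₂} {D : Type u₃} [EnrichedCategory V M]
  [MonoidalVCategory V M] [EnrichedCategory V C] [EnrichedCategory V D]
  (L : MonoidalAction V M C) (R : MonoidalAction V M D)

/-- The object `(N ⊘ X, N' ⊘' Y)`. -/
abbrev diag (k : Cᵒᵖ × D) (N N' : M) : Cᵒᵖ × D :=
  (op (L.action.obj (N, k.1.unop)), R.action.obj (N', k.2))

/-- The action of `M(N, N')` on the second component. -/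
def diagR (k : Cᵒᵖ × D) (N N' : M) : (N ⟶[V] N') ⟶ (diag L R k N N ⟶[V] diag L R k N N') :=
  pairR (eId V (op (L.action.obj (N, k.1.unop)))) ((R.onObj k.2).map N N')

/-- The action of `M(N, N')` on the first component. -/
def diagL (k : Cᵒᵖ × D) (N N' : M) : (N ⟶[V] N') ⟶ (diag L R k N' N' ⟶[V] diag L R k N N') :=
  pairL (X := op (L.action.obj (N', k.1.unop))) (X' := op (L.action.obj (N, k.1.unop)))
    ((L.onObj k.1.unop).map N N') (eId V (R.action.obj (N', k.2)))

/-- The factor `h` meets only the identity `e`, so its action disappears and what is left is the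
action of `m` on `h'`. This is the shape of the first leg of the optic coend; `coend_snd_aux` is
that of the second, with the roles of the factors exchanged. -/
lemma coend_fst_aux {m h h' h'' d : V} (e : 𝟙_ V ⟶ d) (a : h ⊗ d ⟶ h) (b : h' ⊗ m ⟶ h'')
    (ha : h ◁ e ≫ a = (ρ_ h).hom) :
    (β_ m (h ⊗ h')).hom ≫ (h ⊗ h') ◁ (((ρ_ m).inv ≫ m ◁ e) ≫ (β_ m d).hom) ≫
        tensorμ h h' d m ≫ (a ⊗ₘ b) =
      (α_ m h h').inv ≫ (β_ m h).hom ▷ h' ≫ (α_ h m h').hom ≫ h ◁ ((β_ m h').hom ≫ b) := by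
  have h₁ : ((ρ_ m).inv ≫ m ◁ e) ≫ (β_ m d).hom = (λ_ m).inv ≫ (e ⊗ₘ 𝟙 m) := by
    rw [Category.assoc, BraidedCategory.braiding_naturality_right,
      rightUnitor_inv_braiding_assoc, tensorHom_id]
  rw [h₁, MonoidalCategory.whiskerLeft_comp, Category.assoc, tensorμ_natural_right_assoc,
    reassoc_of% tensorμ_unit_right, tensorHom_comp_tensorHom, ha, whiskerRight_comp_tensorHom,
    Iso.inv_hom_id, MonoidalCategory.whiskerLeft_id, Category.id_comp, id_tensorHom,
    BraidedCategory.braiding_tensor_right_hom]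
  monoidal

lemma coend_snd_aux {m h h' h'' d : V} (e : 𝟙_ V ⟶ d) (a : h ⊗ m ⟶ h'') (b : h' ⊗ d ⟶ h')
    (hb : h' ◁ e ≫ b = (ρ_ h').hom) :
    (β_ m (h ⊗ h')).hom ≫ (h ⊗ h') ◁ (((λ_ m).inv ≫ e ▷ m) ≫ (β_ d m).hom) ≫
        tensorμ h h' m d ≫ (a ⊗ₘ b) =
      (α_ m h h').inv ≫ ((β_ m h).hom ≫ a) ▷ h' := by
  have h₁ : ((λ_ m).inv ≫ e ▷ m) ≫ (β_ d m).hom = (ρ_ m).inv ≫ (𝟙 m ⊗ₘ e) := by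
    rw [Category.assoc, BraidedCategory.braiding_naturality_left,
      leftUnitor_inv_braiding_assoc, id_tensorHom]
  rw [h₁, MonoidalCategory.whiskerLeft_comp, Category.assoc, tensorμ_natural_right_assoc,
    reassoc_of% tensorμ_unit_right', tensorHom_comp_tensorHom, hb, whiskerLeft_comp_tensorHom,
    Iso.inv_hom_id, MonoidalCategory.whiskerLeft_id, Category.id_comp, tensorHom_id,
    BraidedCategory.braiding_tensor_right_hom]
  simp only [Category.assoc, comp_whiskerRight, Iso.inv_hom_id_assoc]
  rw [← MonoidalCategory.whiskerLeft_comp_assoc, SymmetricCategory.symmetry,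
    MonoidalCategory.whiskerLeft_id, Category.id_comp, Iso.hom_inv_id_assoc]

lemma braiding_whiskerLeft_braiding {m f h o : V} (k : m ⟶ f) (c : f ⊗ h ⟶ o) :
    (β_ m h).hom ≫ h ◁ k ≫ (β_ h f).hom ≫ c = k ▷ h ≫ c := by
  rw [BraidedCategory.braiding_naturality_right_assoc, SymmetricCategory.symmetry_assoc]

/-- The value of the diagram at `(N', N)` is the hom-object from `diag L R a N N'` to `(S, T)`, and
this leg is precomposition with the image of `M(N, N')` in the second coordinate. The other leg,
treated next, uses the first coordinate. From here on optics are handled through composition in `Cᵒᵖ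
⊗ D`, without unfolding the tensor product. -/
lemma opticDiagram_fst (a : Cᵒᵖ × D) (S : C) (T : D) (N N' : M) :
    (coendIndex (opticDiagram L R a.1.unop a.2 S T)).fst (N, N') =
      diagR L R a N N' ▷ (diag L R a N N' ⟶[V] (op S, T)) ≫
        eComp V (diag L R a N N) (diag L R a N N') (op S, T) := by
  refine Eq.trans ?_ (pairR_whiskerRight_eComp (eId V (op (L.action.obj (N, a.1.unop))))
    ((R.onObj a.2).map N N') (op S) T).symm
  rw [preElt_eId, id_tensorHom]
  change (β_ _ _).hom ≫ act ((insertRight N).comp V (opticDiagram L R a.1.unop a.2 S T))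
    (op N') (op N) = _
  refine (congrArg (fun t => _ ≫ t) (act_comp _ _ _ _)).trans ?_
  refine (congrArg (fun t => _ ≫ _ ≫ t) (act_comp _ _ _ _)).trans ?_
  refine (congrArg (fun t => _ ≫ _ ≫ _ ≫ t) (act_prodMap_tensorFunctor _ _ _ _)).trans ?_
  have h₁ := act_eId ((L.onObj a.1.unop).comp V
    ((insertLeft (op S)).comp V (homFunctor V C))) N
  have h₂ := (act_comp (opFunctor (R.onObj a.2)) ((insertRight T).comp V (homFunctor V D))
    (op N') (op N)).trans
      (congrArg (fun t => _ ≫ t) (insertRight_act_homFunctor _ _ _))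
  have h₃ := coend_fst_aux (m := N ⟶[V] N') _ _ (act ((opFunctor (R.onObj a.2)).comp V
    ((insertRight T).comp V (homFunctor V D))) (op N') (op N)) h₁
  refine Eq.trans ?_ (h₃.trans ?_)
  · exact congrArg (fun t => _ ≫ t) (MonoidalCategory.whiskerLeft_comp_assoc _ _ _ _).symm
  · congr 3
    refine congrArg _ ((congrArg (fun t => _ ≫ t) h₂).trans ?_)
    exact braiding_whiskerLeft_braiding ((R.onObj a.2).map N N') (eComp V _ _ _)

lemma opticDiagram_snd (a : Cᵒᵖ × D) (S : C) (T : D) (N N' : M) :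
    (coendIndex (opticDiagram L R a.1.unop a.2 S T)).snd (N, N') =
      diagL L R a N N' ▷ (diag L R a N N' ⟶[V] (op S, T)) ≫
        eComp V (diag L R a N' N') (diag L R a N N') (op S, T) := by
  refine Eq.trans ?_ (pairL_whiskerRight_eComp (X := op (L.action.obj (N', a.1.unop)))
    (X' := op (L.action.obj (N, a.1.unop))) ((L.onObj a.1.unop).map N N')
    (eId V (R.action.obj (N', a.2))) (op S) T).symm
  rw [preElt_eId, tensorHom_id]
  change (β_ _ _).hom ≫ act ((insertLeft (op N')).comp V (opticDiagram L R a.1.unop a.2 S T))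
    N N' = _
  refine (congrArg (fun t => _ ≫ t) (act_comp _ _ _ _)).trans ?_
  refine (congrArg (fun t => _ ≫ _ ≫ t) (act_comp _ _ _ _)).trans ?_
  refine (congrArg (fun t => _ ≫ _ ≫ _ ≫ t) (act_prodMap_tensorFunctor _ _ _ _)).trans ?_
  have h₁ := act_eId ((opFunctor (R.onObj a.2)).comp V
    ((insertRight T).comp V (homFunctor V D))) (op N')
  have h₂ := (act_comp (L.onObj a.1.unop) ((insertLeft (op S)).comp V (homFunctor V C))
    N N').trans
      (congrArg (fun t => _ ≫ t) (insertLeft_act_homFunctor _ _ _))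
  have h₃ := coend_snd_aux (m := N ⟶[V] N') _ (act ((L.onObj a.1.unop).comp V
    ((insertLeft (op S)).comp V (homFunctor V C))) N N') _ h₁
  refine Eq.trans ?_ (h₃.trans ?_)
  · exact congrArg (fun t => _ ≫ t) (MonoidalCategory.whiskerLeft_comp_assoc _ _ _ _).symm
  · congr 2
    refine (congrArg (fun t => _ ≫ t) h₂).trans ?_
    exact (BraidedCategory.braiding_naturality_left_assoc ((L.onObj a.1.unop).map N N') _
      (eComp V _ _ _)).symm

section OpticObj

variable [∀ (A S : C) (B T : D), HasVCoend (opticDiagram L R A B S T)] (a : Cᵒᵖ × D)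

/-- The object of optics, as a family indexed by the objects of `Cᵒᵖ ⊗ D`. -/
def opticObj (k : Cᵒᵖ × D) : V := Optic L R a.1.unop a.2 k.1.unop k.2

/-- The inclusion of `(Cᵒᵖ ⊗ D)((N ⊘ A, N ⊘' B), k)` into the object of optics. -/
def opticIn (k : Cᵒᵖ × D) (N : M) : (diag L R a N N ⟶[V] k) ⟶ opticObj L R a k :=
  opticι L R a.1.unop a.2 k.1.unop k.2 N

/-- The only relation among optics: a morphism of `M` slides from the `D`-side to the `C`-side. -/
lemma opticIn_condition (k : Cᵒᵖ × D) (N N' : M) :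
    diagR L R a N N' ▷ (diag L R a N N' ⟶[V] k) ≫
        eComp V (diag L R a N N) (diag L R a N N') k ≫ opticIn L R a k N =
      diagL L R a N N' ▷ (diag L R a N N' ⟶[V] k) ≫
        eComp V (diag L R a N' N') (diag L R a N N') k ≫ opticIn L R a k N' := by
  have h := vCoend_condition (opticDiagram L R a.1.unop a.2 k.1.unop k.2) N N'
  rw [opticDiagram_fst, opticDiagram_snd] at h
  exact (Category.assoc _ _ _).symm.trans (h.trans (Category.assoc _ _ _))

variable {L R a}

lemma whiskerLeft_optic_hom_ext {k : Cᵒᵖ × D} {Z Y : V} {f g : Z ⊗ opticObj L R a k ⟶ Y}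
    (h : ∀ N, Z ◁ opticIn L R a k N ≫ f = Z ◁ opticIn L R a k N ≫ g) : f = g :=
  whiskerLeft_vCoend_hom_ext h

lemma whiskerRight_optic_hom_ext {k : Cᵒᵖ × D} {Z Y : V} {f g : opticObj L R a k ⊗ Z ⟶ Y}
    (h : ∀ N, opticIn L R a k N ▷ Z ≫ f = opticIn L R a k N ▷ Z ≫ g) : f = g :=
  whiskerRight_vCoend_hom_ext h

lemma optic_hom_ext {k : Cᵒᵖ × D} {Y : V} {f g : opticObj L R a k ⟶ Y}
    (h : ∀ N, opticIn L R a k N ≫ f = opticIn L R a k N ≫ g) : f = g :=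
  Multicoequalizer.hom_ext _ _ _ h

variable (L R a)

/-- The map out of `Z ⊗ Optic` given by a compatible family. -/
def opticDescLeft (k : Cᵒᵖ × D) {Z Y : V} (t : ∀ N, Z ⊗ (diag L R a N N ⟶[V] k) ⟶ Y)
    (ht : ∀ N N', Z ◁ (diagR L R a N N' ▷ (diag L R a N N' ⟶[V] k) ≫ eComp V _ _ _) ≫ t N =
      Z ◁ (diagL L R a N N' ▷ (diag L R a N N' ⟶[V] k) ≫ eComp V _ _ _) ≫ t N') :
    Z ⊗ opticObj L R a k ⟶ Y :=
  whiskerLeftDesc (opticDiagram L R a.1.unop a.2 k.1.unop k.2) t (fun N N' => by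
    rw [opticDiagram_fst, opticDiagram_snd]; exact ht N N')

lemma opticIn_descLeft (k : Cᵒᵖ × D) {Z Y : V} (t : ∀ N, Z ⊗ (diag L R a N N ⟶[V] k) ⟶ Y)
    (ht) (N : M) : Z ◁ opticIn L R a k N ≫ opticDescLeft L R a k t ht = t N :=
  ι_whiskerLeftDesc _ _ _ _

/-- The map out of `Optic ⊗ Z` given by a compatible family. -/
def opticDescRight (k : Cᵒᵖ × D) {Z Y : V} (t : ∀ N, (diag L R a N N ⟶[V] k) ⊗ Z ⟶ Y)
    (ht : ∀ N N', (diagR L R a N N' ▷ (diag L R a N N' ⟶[V] k) ≫ eComp V _ _ _) ▷ Z ≫ t N =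
      (diagL L R a N N' ▷ (diag L R a N N' ⟶[V] k) ≫ eComp V _ _ _) ▷ Z ≫ t N') :
    opticObj L R a k ⊗ Z ⟶ Y :=
  whiskerRightDesc (opticDiagram L R a.1.unop a.2 k.1.unop k.2) t (fun N N' => by
    rw [opticDiagram_fst, opticDiagram_snd]; exact ht N N')

lemma opticIn_descRight (k : Cᵒᵖ × D) {Z Y : V} (t : ∀ N, (diag L R a N N ⟶[V] k) ⊗ Z ⟶ Y)
    (ht) (N : M) : opticIn L R a k N ▷ Z ≫ opticDescRight L R a k t ht = t N :=
  ι_whiskerRightDesc _ _ _ _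

/-- The map out of the object of optics given by a compatible family. -/
def opticDesc (k : Cᵒᵖ × D) {Y : V} (t : ∀ N, (diag L R a N N ⟶[V] k) ⟶ Y)
    (ht : ∀ N N', diagR L R a N N' ▷ (diag L R a N N' ⟶[V] k) ≫ eComp V _ _ _ ≫ t N =
      diagL L R a N N' ▷ (diag L R a N N' ⟶[V] k) ≫ eComp V _ _ _ ≫ t N') :
    opticObj L R a k ⟶ Y :=
  Multicoequalizer.desc (coendIndex (opticDiagram L R a.1.unop a.2 k.1.unop k.2)) _ t (fun p => by
    obtain ⟨N, N'⟩ := p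
    rw [opticDiagram_fst, opticDiagram_snd]
    exact (Category.assoc _ _ _).trans ((ht N N').trans (Category.assoc _ _ _).symm))

lemma opticIn_desc (k : Cᵒᵖ × D) {Y : V} (t : ∀ N, (diag L R a N N ⟶[V] k) ⟶ Y)
    (ht) (N : M) : opticIn L R a k N ≫ opticDesc L R a k t ht = t N :=
  Multicoequalizer.π_desc _ _ _ _ _

end OpticObj

end OpticDiagram

/-! ### Natural isomorphisms expressed through global elements. -/

section NaturalIsomorphisms

variable {V : Type v} [Category.{u} V] [MonoidalCategory V] {C : Type u₁} {D : Type u₂}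
  [EnrichedCategory V C] [EnrichedCategory V D] {F G : EnrichedFunctor V C D}

lemma compElt_homTo_hom_inv {X Y : ForgetEnrichment V C} (e : X ≅ Y) :
    compElt (ForgetEnrichment.homTo V e.hom) (ForgetEnrichment.homTo V e.inv) =
      eId V (ForgetEnrichment.to V X) := by
  rw [← homTo_comp', e.hom_inv_id, ForgetEnrichment.homTo_id]

lemma compElt_homTo_inv_hom {X Y : ForgetEnrichment V C} (e : X ≅ Y) :
    compElt (ForgetEnrichment.homTo V e.inv) (ForgetEnrichment.homTo V e.hom) =
      eId V (ForgetEnrichment.to V Y) :=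
  compElt_homTo_hom_inv e.symm

namespace VNatIso

/-- The component of a `V`-natural isomorphism. -/
def homElt (t : VNatIso F G) (X : C) : 𝟙_ V ⟶ (F.obj X ⟶[V] G.obj X) :=
  ForgetEnrichment.homTo V (t.iso X).hom

/-- The inverse of the component of a `V`-natural isomorphism. -/
def invElt (t : VNatIso F G) (X : C) : 𝟙_ V ⟶ (G.obj X ⟶[V] F.obj X) :=
  ForgetEnrichment.homTo V (t.iso X).inv

variable (t : VNatIso F G)

lemma homElt_invElt (X : C) : compElt (t.homElt X) (t.invElt X) = eId V (F.obj X) :=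
  compElt_homTo_hom_inv _

lemma invElt_homElt (X : C) : compElt (t.invElt X) (t.homElt X) = eId V (G.obj X) :=
  compElt_homTo_inv_hom _

lemma map_postElt (X Y : C) :
    F.map X Y ≫ postElt (t.homElt Y) (F.obj X) = G.map X Y ≫ preElt (t.homElt X) (G.obj Y) := by
  rw [postElt, preElt, rightUnitor_inv_naturality_assoc, leftUnitor_inv_naturality_assoc,
    ← MonoidalCategory.tensorHom_def_assoc, ← MonoidalCategory.tensorHom_def'_assoc]
  exact t.naturality X Y

lemma map_postElt_inv (X Y : C) :
    G.map X Y ≫ postElt (t.invElt Y) (G.obj X) = F.map X Y ≫ preElt (t.invElt X) (F.obj Y) := by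
  -- The naturality square is composed on both sides with inverse components; the original
  -- components then cancel, leaving the square for the inverse.
  have h := (t.map_postElt X Y =≫ preElt (t.invElt X) (G.obj Y)) =≫
    postElt (t.invElt Y) (G.obj X)
  simp only [Category.assoc] at h
  rw [reassoc_of% preElt_preElt, invElt_homElt, preElt_eId, Category.id_comp, preElt_postElt,
    reassoc_of% postElt_postElt, homElt_invElt, postElt_eId, Category.id_comp] at h
  exact h.symm

end VNatIso

end NaturalIsomorphisms

/-! ### Functors of two and three variables, one variable at a time. -/

section Bifunctors

variable {V : Type v} [Category.{u} V] [MonoidalCategory V] [BraidedCategory V]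
  {C : Type u₁} {D : Type u₂} {E : Type u₃} [EnrichedCategory V C] [EnrichedCategory V D]
  [EnrichedCategory V E]

lemma insertLeft_comp_map (F : EnrichedFunctor V (C × D) E) (X : C) (Y Y' : D) {W : V}
    (r : W ⟶ (Y ⟶[V] Y')) :
    r ≫ ((insertLeft X).comp V F).map Y Y' = pairR (eId V X) r ≫ F.map (X, Y) (X, Y') := by
  have h : r ≫ (λ_ (Y ⟶[V] Y')).inv ≫ eId V X ▷ (Y ⟶[V] Y') = pairR (eId V X) r := by
    rw [pairR, MonoidalCategory.tensorHom_def', leftUnitor_inv_naturality_assoc]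
  exact (Category.assoc _ _ _).symm.trans (congrArg (fun t => t ≫ _) h)

lemma insertRight_comp_map (F : EnrichedFunctor V (C × D) E) (X X' : C) (Y : D) {W : V}
    (r : W ⟶ (X ⟶[V] X')) :
    r ≫ ((insertRight Y).comp V F).map X X' = pairL r (eId V Y) ≫ F.map (X, Y) (X', Y) := by
  have h : r ≫ (ρ_ (X ⟶[V] X')).inv ≫ (X ⟶[V] X') ◁ eId V Y = pairL r (eId V Y) := by
    rw [pairL, MonoidalCategory.tensorHom_def, rightUnitor_inv_naturality_assoc]
  exact (Category.assoc _ _ _).symm.trans (congrArg (fun t => t ≫ _) h)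

/-- A morphism of `C ⊗ D` factors as its first coordinate followed by its second. The opposite
order, in the next lemma, costs exactly a braiding. Applying a functor to both factorizations yields
`insert_interchange`. -/
lemma pairL_pairR_eComp (X X' : C) (Y Y' : D) :
    (pairL (𝟙 (X ⟶[V] X')) (eId V Y) ⊗ₘ pairR (eId V X') (𝟙 (Y ⟶[V] Y'))) ≫
      eComp V (X, Y) (X', Y) (X', Y') = 𝟙 _ := by
  rw [MonoidalCategory.tensorHom_def, Category.assoc, whiskerLeft_pairR_eComp, postElt_eId,
    MonoidalCategory.whiskerLeft_id, Category.id_comp, id_tensorHom]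
  change ((ρ_ _).inv ≫ (𝟙 (X ⟶[V] X') ⊗ₘ eId V Y)) ▷ _ ≫ (α_ _ _ _).hom ≫ _ = _
  rw [id_tensorHom]
  calc
    _ = 𝟙 _ ⊗≫ (X ⟶[V] X') ◁ ((λ_ _).inv ≫ eId V Y ▷ (Y ⟶[V] Y') ≫ eComp V Y Y Y') := by
      monoidal
    _ = _ := by
      rw [e_id_comp]; monoidal

lemma pairR_pairL_eComp (X X' : C) (Y Y' : D) :
    (pairR (eId V X) (𝟙 (Y ⟶[V] Y')) ⊗ₘ pairL (𝟙 (X ⟶[V] X')) (eId V Y')) ≫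
      eComp V (X, Y) (X, Y') (X', Y') = (β_ _ _).hom := by
  rw [MonoidalCategory.tensorHom_def', Category.assoc, pairR_whiskerRight_eComp, preElt_eId,
    id_whiskerRight, Category.id_comp, id_tensorHom]
  change _ ◁ ((ρ_ _).inv ≫ (𝟙 (X ⟶[V] X') ⊗ₘ eId V Y')) ≫ (α_ _ _ _).inv ≫ _ = _
  rw [id_tensorHom]
  calc
    _ = 𝟙 _ ⊗≫ (((Y ⟶[V] Y') ⊗ (X ⟶[V] X')) ◁ eId V Y' ≫ (β_ _ _).hom ▷ _) ⊗≫
        (X ⟶[V] X') ◁ eComp V Y Y' Y' := by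
      monoidal
    _ = 𝟙 _ ⊗≫ (β_ (Y ⟶[V] Y') (X ⟶[V] X')).hom ⊗≫
        (X ⟶[V] X') ◁ ((ρ_ _).inv ≫ (Y ⟶[V] Y') ◁ eId V Y' ≫ eComp V Y Y' Y') := by
      rw [whisker_exchange]; monoidal
    _ = _ := by
      rw [e_comp_id]; monoidal

lemma insert_interchange (F : EnrichedFunctor V (C × D) E) (X X' : C) (Y Y' : D) :
    (((insertLeft X).comp V F).map Y Y' ⊗ₘ ((insertRight Y').comp V F).map X X') ≫
        eComp V (F.obj (X, Y)) (F.obj (X, Y')) (F.obj (X', Y')) =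
      (β_ _ _).hom ≫ (((insertRight Y).comp V F).map X X' ⊗ₘ
        ((insertLeft X').comp V F).map Y Y') ≫
          eComp V (F.obj (X, Y)) (F.obj (X', Y)) (F.obj (X', Y')) := by
  have h₁ := insertLeft_comp_map F X Y Y' (𝟙 _)
  have h₂ := insertRight_comp_map F X X' Y' (𝟙 _)
  have h₃ := insertLeft_comp_map F X' Y Y' (𝟙 _)
  have h₄ := insertRight_comp_map F X X' Y (𝟙 _)
  rw [Category.id_comp] at h₁ h₂ h₃ h₄
  refine (congrArg₂ (fun s t => (s ⊗ₘ t) ≫ eComp V (F.obj (X, Y)) (F.obj (X, Y'))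
    (F.obj (X', Y'))) h₁ h₂).trans (Eq.trans ?_ (congrArg₂ (fun s t => (β_ _ _).hom ≫ (s ⊗ₘ t) ≫
      eComp V (F.obj (X, Y)) (F.obj (X', Y)) (F.obj (X', Y'))) h₄ h₃).symm)
  rw [← tensorHom_comp_tensorHom, ← tensorHom_comp_tensorHom, Category.assoc, Category.assoc,
    ← F.map_comp, ← F.map_comp, ← Category.assoc, pairR_pairL_eComp,
    ← Category.assoc (_ ⊗ₘ _), pairL_pairR_eComp, Category.id_comp]

variable {C' : Type u₃} {D' : Type u₄} [EnrichedCategory V C'] [EnrichedCategory V D']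

lemma pairR_prodMap (F : EnrichedFunctor V C C') (G : EnrichedFunctor V D D') {W : V}
    {X X' : C} {Y Y' : D} (e : 𝟙_ V ⟶ (X ⟶[V] X')) (r : W ⟶ (Y ⟶[V] Y')) :
    pairR e r ≫ (prodMap F G).map (X, Y) (X', Y') = pairR (e ≫ F.map X X') (r ≫ G.map Y Y') :=
  (Category.assoc _ _ _).trans (congrArg (fun t => (λ_ W).inv ≫ t)
    (tensorHom_comp_tensorHom _ _ _ _))

lemma pairL_prodMap (F : EnrichedFunctor V C C') (G : EnrichedFunctor V D D') {W : V}
    {X X' : C} {Y Y' : D} (r : W ⟶ (X ⟶[V] X')) (e : 𝟙_ V ⟶ (Y ⟶[V] Y')) :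
    pairL r e ≫ (prodMap F G).map (X, Y) (X', Y') = pairL (r ≫ F.map X X') (e ≫ G.map Y Y') :=
  (Category.assoc _ _ _).trans (congrArg (fun t => (ρ_ W).inv ≫ t)
    (tensorHom_comp_tensorHom _ _ _ _))

/-- With a single moving coordinate, reassociating only rearranges units. The three positions of
that coordinate are treated in turn. -/
lemma pairLR_prodAssoc {W : V} {X X' : C} {Y Y' : D} {Z Z' : E} (e : 𝟙_ V ⟶ (X ⟶[V] X'))
    (r : W ⟶ (Y ⟶[V] Y')) (e' : 𝟙_ V ⟶ (Z ⟶[V] Z')) :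
    pairL (pairR e r) e' ≫ (prodAssoc V C D E).map ((X, Y), Z) ((X', Y'), Z') =
      pairR e (pairL r e') := by
  change ((ρ_ _).inv ≫ (((λ_ _).inv ≫ (e ⊗ₘ r)) ⊗ₘ e')) ≫ (α_ _ _ _).hom =
    (λ_ _).inv ≫ (e ⊗ₘ ((ρ_ _).inv ≫ (r ⊗ₘ e')))
  simp only [MonoidalCategory.tensorHom_def]
  monoidal

lemma pairLL_prodAssoc {W : V} {X X' : C} {Y Y' : D} {Z Z' : E} (r : W ⟶ (X ⟶[V] X'))
    (e : 𝟙_ V ⟶ (Y ⟶[V] Y')) (e' : 𝟙_ V ⟶ (Z ⟶[V] Z')) :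
    pairL (pairL r e) e' ≫ (prodAssoc V C D E).map ((X, Y), Z) ((X', Y'), Z') =
      pairL r (pairR e e') := by
  change ((ρ_ _).inv ≫ (((ρ_ _).inv ≫ (r ⊗ₘ e)) ⊗ₘ e')) ≫ (α_ _ _ _).hom =
    (ρ_ _).inv ≫ (r ⊗ₘ ((λ_ _).inv ≫ (e ⊗ₘ e')))
  simp only [MonoidalCategory.tensorHom_def]
  monoidal

lemma pairRR_prodAssoc {W : V} {X X' : C} {Y Y' : D} {Z Z' : E} (e : 𝟙_ V ⟶ (X ⟶[V] X'))
    (e' : 𝟙_ V ⟶ (Y ⟶[V] Y')) (r : W ⟶ (Z ⟶[V] Z')) :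
    pairR (pairR e e') r ≫ (prodAssoc V C D E).map ((X, Y), Z) ((X', Y'), Z') =
      pairR e (pairR e' r) := by
  change ((λ_ _).inv ≫ (((λ_ _).inv ≫ (e ⊗ₘ e')) ⊗ₘ r)) ≫ (α_ _ _ _).hom =
    (λ_ _).inv ≫ (e ⊗ₘ ((λ_ _).inv ≫ (e' ⊗ₘ r)))
  simp only [MonoidalCategory.tensorHom_def]
  monoidal

end Bifunctors

open MonoidalVCategory

/-! ### Structure isomorphisms of an action as global elements, and their naturality. -/

section ActionElements

variable {V : Type v} [Category.{u} V] [MonoidalCategory V] [BraidedCategory V]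
  {M : Type u₁} {C : Type u₂} [EnrichedCategory V M] [MonoidalVCategory V M]
  [EnrichedCategory V C]

/-- The `V`-functor `K ⊗ - : M → M` on hom-objects. -/
def tensorLeftMap (K N N' : M) :
    (N ⟶[V] N') ⟶ (tensor.obj (V := V) (K, N) ⟶[V] tensor.obj (V := V) (K, N')) :=
  pairR (eId V K) (𝟙 (N ⟶[V] N')) ≫ (tensor (V := V) (M := M)).map (K, N) (K, N')

/-- The `V`-functor `- ⊗ N : M → M` on hom-objects. -/
def tensorRightMap (K K' N : M) :
    (K ⟶[V] K') ⟶ (tensor.obj (V := V) (K, N) ⟶[V] tensor.obj (V := V) (K', N)) :=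
  pairL (𝟙 (K ⟶[V] K')) (eId V N) ≫ (tensor (V := V) (M := M)).map (K, N) (K', N)

namespace MonoidalAction

variable (L : MonoidalAction V M C)

/-- The structure isomorphism `K ⊘ (N ⊘ A) ⟶ (K ⊗ N) ⊘ A` as a global element. -/
def mulElt (K N : M) (A : C) : 𝟙_ V ⟶
    (L.action.obj (K, L.action.obj (N, A)) ⟶[V] L.action.obj (tensor.obj (V := V) (K, N), A)) :=
  L.mulIso.homElt ((K, N), A)

/-- The inverse structure isomorphism `(K ⊗ N) ⊘ A ⟶ K ⊘ (N ⊘ A)` as a global element. -/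
def mulInvElt (K N : M) (A : C) : 𝟙_ V ⟶
    (L.action.obj (tensor.obj (V := V) (K, N), A) ⟶[V] L.action.obj (K, L.action.obj (N, A))) :=
  L.mulIso.invElt ((K, N), A)

/-- The structure isomorphism `A ⟶ I ⊘ A` as a global element. -/
def unitElt (A : C) : 𝟙_ V ⟶ (A ⟶[V] L.action.obj (unit V, A)) := L.unitIso.homElt A

/-- The inverse structure isomorphism `I ⊘ A ⟶ A` as a global element. -/
def unitInvElt (A : C) : 𝟙_ V ⟶ (L.action.obj (unit V, A) ⟶[V] A) := L.unitIso.invElt A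

/-- The `V`-functor `- ⊘ A` on hom-objects. -/
def onMap (A : C) (N N' : M) : (N ⟶[V] N') ⟶ (L.action.obj (N, A) ⟶[V] L.action.obj (N', A)) :=
  (L.onObj A).map N N'

/-- The `V`-functor `N ⊘ -` on hom-objects. -/
def byMap (N : M) (A A' : C) : (A ⟶[V] A') ⟶ (L.action.obj (N, A) ⟶[V] L.action.obj (N, A')) :=
  (L.byObj N).map A A'

lemma eId_byMap (N : M) (A : C) : eId V A ≫ L.byMap N A A = eId V (L.action.obj (N, A)) :=
  (L.byObj N).map_id A

lemma pairR_action (N : M) (A A' : C) {W : V} (r : W ⟶ (A ⟶[V] A')) :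
    pairR (eId V N) r ≫ L.action.map (N, A) (N, A') = r ≫ L.byMap N A A' :=
  (insertLeft_comp_map L.action N A A' r).symm

lemma pairL_action (N N' : M) (A : C) {W : V} (r : W ⟶ (N ⟶[V] N')) :
    pairL r (eId V A) ≫ L.action.map (N, A) (N', A) = r ≫ L.onMap A N N' :=
  (insertRight_comp_map L.action N N' A r).symm

/-- The source functor `((K, N), A) ↦ K ⊘ (N ⊘ A)` of the multiplicativity isomorphism. -/
abbrev mulSource : EnrichedFunctor V ((M × M) × C) C :=
  (prodAssoc V M M C).comp V ((prodMap (EnrichedFunctor.id V M) L.action).comp V L.action)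

/-- The target functor `((K, N), A) ↦ (K ⊗ N) ⊘ A` of the multiplicativity isomorphism. -/
abbrev mulTarget : EnrichedFunctor V ((M × M) × C) C :=
  (prodMap (tensor (V := V) (M := M)) (EnrichedFunctor.id V C)).comp V L.action

/-- `mulIso` is natural in three variables jointly. Feeding it elements with one moving coordinate
isolates naturality in that variable; these six lemmas compute its source and target functors on
such elements. -/
lemma mulSource_mid (K N N' : M) (A : C) :
    pairL (pairR (eId V K) (𝟙 (N ⟶[V] N'))) (eId V A) ≫ L.mulSource.map ((K, N), A) ((K, N'), A) =
      L.onMap A N N' ≫ L.byMap K (L.action.obj (N, A)) (L.action.obj (N', A)) := by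
  refine ((reassoc_of% (pairLR_prodAssoc (eId V K) (𝟙 (N ⟶[V] N')) (eId V A))) _).trans ?_
  refine ((reassoc_of% (pairR_prodMap (EnrichedFunctor.id V M) L.action (eId V K)
    (pairL (𝟙 (N ⟶[V] N')) (eId V A)))) _).trans ?_
  rw [pairL_action, Category.id_comp]
  exact (congrArg (fun t => pairR t _ ≫ L.action.map _ _) (Category.comp_id _)).trans
    (L.pairR_action K _ _ _)

lemma mulSource_left (K K' N : M) (A : C) :
    pairL (pairL (𝟙 (K ⟶[V] K')) (eId V N)) (eId V A) ≫
        L.mulSource.map ((K, N), A) ((K', N), A) =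
      L.onMap (L.action.obj (N, A)) K K' := by
  refine ((reassoc_of% (pairLL_prodAssoc (𝟙 (K ⟶[V] K')) (eId V N) (eId V A))) _).trans ?_
  refine ((reassoc_of% (pairL_prodMap (EnrichedFunctor.id V M) L.action (𝟙 (K ⟶[V] K'))
    (pairR (eId V N) (eId V A)))) _).trans ?_
  refine (congrArg (fun t => pairL _ t ≫ L.action.map _ _) (L.action.map_id (N, A))).trans ?_
  exact (L.pairL_action _ _ _ _).trans (Category.id_comp _)

lemma mulSource_right (K N : M) (A A' : C) :
    pairR (pairR (eId V K) (eId V N)) (𝟙 (A ⟶[V] A')) ≫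
        L.mulSource.map ((K, N), A) ((K, N), A') =
      L.byMap N A A' ≫ L.byMap K (L.action.obj (N, A)) (L.action.obj (N, A')) := by
  refine ((reassoc_of% (pairRR_prodAssoc (eId V K) (eId V N) (𝟙 (A ⟶[V] A')))) _).trans ?_
  refine ((reassoc_of% (pairR_prodMap (EnrichedFunctor.id V M) L.action (eId V K)
    (pairR (eId V N) (𝟙 (A ⟶[V] A'))))) _).trans ?_
  rw [pairR_action, Category.id_comp]
  exact (congrArg (fun t => pairR t _ ≫ L.action.map _ _) (Category.comp_id _)).trans
    (L.pairR_action K _ _ _)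

lemma mulTarget_mid (K N N' : M) (A : C) :
    pairL (pairR (eId V K) (𝟙 (N ⟶[V] N'))) (eId V A) ≫ L.mulTarget.map ((K, N), A) ((K, N'), A) =
      tensorLeftMap K N N' ≫
        L.onMap A (tensor.obj (V := V) (K, N)) (tensor.obj (V := V) (K, N')) := by
  refine ((reassoc_of% (pairL_prodMap tensor (EnrichedFunctor.id V C) (pairR (eId V K) (𝟙
      (N ⟶[V] N')))
    (eId V A))) _).trans ?_
  refine (congrArg (fun t => pairL _ t ≫ L.action.map _ _) (Category.comp_id _)).trans ?_
  exact L.pairL_action _ _ _ _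

lemma mulTarget_left (K K' N : M) (A : C) :
    pairL (pairL (𝟙 (K ⟶[V] K')) (eId V N)) (eId V A) ≫
        L.mulTarget.map ((K, N), A) ((K', N), A) =
      tensorRightMap K K' N ≫
        L.onMap A (tensor.obj (V := V) (K, N)) (tensor.obj (V := V) (K', N)) := by
  refine ((reassoc_of% (pairL_prodMap tensor (EnrichedFunctor.id V C) (pairL (𝟙 (K ⟶[V] K'))
      (eId V N))
    (eId V A))) _).trans ?_
  refine (congrArg (fun t => pairL _ t ≫ L.action.map _ _) (Category.comp_id _)).trans ?_
  exact L.pairL_action _ _ _ _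

lemma mulTarget_right (K N : M) (A A' : C) :
    pairR (pairR (eId V K) (eId V N)) (𝟙 (A ⟶[V] A')) ≫
        L.mulTarget.map ((K, N), A) ((K, N), A') =
      L.byMap (tensor.obj (V := V) (K, N)) A A' := by
  refine ((reassoc_of% (pairR_prodMap tensor (EnrichedFunctor.id V C) (pairR (eId V K) (eId V N))
    (𝟙 (A ⟶[V] A')))) _).trans ?_
  refine (congrArg (fun t => pairR t _ ≫ L.action.map _ _)
    ((tensor (V := V) (M := M)).map_id (K, N))).trans ?_
  exact (L.pairR_action _ _ _ _).trans (Category.id_comp _)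

lemma comp_eq_of_elt {W P Q Q' T : V} {x : W ⟶ P} {F : P ⟶ Q} {G : P ⟶ Q'} {p : Q ⟶ T}
    {q : Q' ⟶ T} (h : F ≫ p = G ≫ q) {s : W ⟶ Q} {t : W ⟶ Q'} (hs : x ≫ F = s) (ht : x ≫ G = t) :
    s ≫ p = t ≫ q := by
  rw [← hs, ← ht, Category.assoc, Category.assoc, h]

/-- Each variable has its own use: naturality in `N` makes the Tambara structure on optics well
defined on the coend, naturality in `K` gives its dinaturality, and naturality in `A` enters its
compatibility with `⊗`. The inverse is needed as well, since `C` enters contravariantly and `D`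
covariantly. -/
lemma mulElt_natural_mid (K N N' : M) (A : C) :
    L.onMap A N N' ≫ L.byMap K (L.action.obj (N, A)) (L.action.obj (N', A)) ≫
        postElt (L.mulElt K N' A) _ =
      tensorLeftMap K N N' ≫ L.onMap A _ _ ≫ preElt (L.mulElt K N A) _ := by
  exact (Category.assoc _ _ _).symm.trans ((comp_eq_of_elt (L.mulIso.map_postElt ((K, N), A) ((K,
      N'), A)) (L.mulSource_mid K N N' A) (L.mulTarget_mid K N N' A)).trans (Category.assoc _ _ _))

lemma mulInvElt_natural_mid (K N N' : M) (A : C) :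
    L.onMap A N N' ≫ L.byMap K (L.action.obj (N, A)) (L.action.obj (N', A)) ≫
        preElt (L.mulInvElt K N A) _ =
      tensorLeftMap K N N' ≫ L.onMap A _ _ ≫ postElt (L.mulInvElt K N' A) _ := by
  exact (Category.assoc _ _ _).symm.trans ((comp_eq_of_elt (L.mulIso.map_postElt_inv ((K, N), A)
      ((K, N'), A)).symm (L.mulSource_mid K N N' A) (L.mulTarget_mid K N N' A)).trans
      (Category.assoc _ _ _))

lemma mulElt_natural_left (K K' N : M) (A : C) :
    L.onMap (L.action.obj (N, A)) K K' ≫ postElt (L.mulElt K' N A) _ =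
      tensorRightMap K K' N ≫ L.onMap A _ _ ≫ preElt (L.mulElt K N A) _ := by
  exact (comp_eq_of_elt (L.mulIso.map_postElt ((K, N), A) ((K', N), A))
      (L.mulSource_left K K' N A) (L.mulTarget_left K K' N A)).trans (Category.assoc _ _ _)

lemma mulInvElt_natural_left (K K' N : M) (A : C) :
    L.onMap (L.action.obj (N, A)) K K' ≫ preElt (L.mulInvElt K N A) _ =
      tensorRightMap K K' N ≫ L.onMap A _ _ ≫ postElt (L.mulInvElt K' N A) _ := by
  exact (comp_eq_of_elt (L.mulIso.map_postElt_inv ((K, N), A) ((K', N), A)).symm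
      (L.mulSource_left K K' N A) (L.mulTarget_left K K' N A)).trans (Category.assoc _ _ _)

lemma mulElt_natural_right (K N : M) (A A' : C) :
    L.byMap N A A' ≫ L.byMap K (L.action.obj (N, A)) (L.action.obj (N, A')) ≫
        postElt (L.mulElt K N A') _ =
      L.byMap (tensor.obj (V := V) (K, N)) A A' ≫ preElt (L.mulElt K N A) _ := by
  exact (Category.assoc _ _ _).symm.trans ((comp_eq_of_elt (L.mulIso.map_postElt ((K, N), A) ((K,
      N), A')) (L.mulSource_right K N A A') (L.mulTarget_right K N A A')))

lemma mulInvElt_natural_right (K N : M) (A A' : C) :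
    L.byMap N A A' ≫ L.byMap K (L.action.obj (N, A)) (L.action.obj (N, A')) ≫
        preElt (L.mulInvElt K N A) _ =
      L.byMap (tensor.obj (V := V) (K, N)) A A' ≫ postElt (L.mulInvElt K N A') _ := by
  exact (Category.assoc _ _ _).symm.trans ((comp_eq_of_elt (L.mulIso.map_postElt_inv ((K, N), A)
      ((K, N), A')).symm (L.mulSource_right K N A A') (L.mulTarget_right K N A A')))

lemma unitElt_natural (A A' : C) :
    postElt (L.unitElt A') A = L.byMap (unit V) A A' ≫ preElt (L.unitElt A) _ :=
  (Category.id_comp _).symm.trans (L.unitIso.map_postElt A A')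

lemma unitInvElt_natural (A A' : C) :
    preElt (L.unitInvElt A) A' = L.byMap (unit V) A A' ≫ postElt (L.unitInvElt A') _ :=
  (Category.id_comp _).symm.trans (L.unitIso.map_postElt_inv A A').symm

/-- The isomorphism `e ⊘ A` as a global element. -/
def onElt {N N' : M} (A : C) (e : ForgetEnrichment.of V N ⟶ ForgetEnrichment.of V N') :
    𝟙_ V ⟶ (L.action.obj (N, A) ⟶[V] L.action.obj (N', A)) :=
  ForgetEnrichment.homTo V e ≫ L.onMap A N N'

lemma onElt_comp {N N' N'' : M} (A : C) (e : ForgetEnrichment.of V N ⟶ ForgetEnrichment.of V N')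
    (e' : ForgetEnrichment.of V N' ⟶ ForgetEnrichment.of V N'') :
    compElt (L.onElt A e) (L.onElt A e') = L.onElt A (e ≫ e') := by
  rw [onElt, onElt, onElt, homTo_comp']
  exact (compElt_map (L.onObj A) _ _).symm

lemma onElt_id (N : M) (A : C) :
    L.onElt A (𝟙 (ForgetEnrichment.of V N)) = eId V (L.action.obj (N, A)) :=
  (congrArg (fun t => t ≫ _) (ForgetEnrichment.homTo_id V _)).trans ((L.onObj A).map_id N)

/-- Together with `homTo_id_vBimap`, translates the coherence axioms of an action from the
underlying category into equations of global elements. -/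
lemma homTo_vBimap_id {N N' : M} (A : C)
    (e : ForgetEnrichment.of V N ⟶ ForgetEnrichment.of V N') :
    ForgetEnrichment.homTo V (vBimap L.action e (𝟙 (ForgetEnrichment.of V A))) = L.onElt A e := by
  rw [vBimap, ForgetEnrichment.homTo_homOf, ForgetEnrichment.homTo_id]
  refine Eq.trans ?_ (L.pairL_action N N' A (ForgetEnrichment.homTo V e))
  rw [pairL, unitors_inv_equal]
  exact (Category.assoc _ _ _).symm

lemma homTo_id_vBimap (N : M) {A A' : C}
    (f : ForgetEnrichment.of V A ⟶ ForgetEnrichment.of V A') :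
    ForgetEnrichment.homTo V (vBimap L.action (𝟙 (ForgetEnrichment.of V N)) f) =
      ForgetEnrichment.homTo V f ≫ L.byMap N A A' := by
  rw [vBimap, ForgetEnrichment.homTo_homOf, ForgetEnrichment.homTo_id]
  exact (Category.assoc _ _ _).symm.trans (L.pairR_action N A A' _)

end MonoidalAction

end ActionElements

/-! ### Interchange of a one-coordinate morphism with a two-coordinate one. -/

section PairInterchange

variable {V : Type v} [Category.{u} V] [MonoidalCategory V] [SymmetricCategory V]
  {C : Type u₁} {D : Type u₂} [EnrichedCategory V C] [EnrichedCategory V D]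

/-- The generalized element of a hom-object of `C ⊗ D` with the given components. -/
def pairHom {a b : V} {X X' : C} {Y Y' : D} (k : a ⟶ (X ⟶[V] X')) (s : b ⟶ (Y ⟶[V] Y')) :
    a ⊗ b ⟶ ((X, Y) ⟶[V] (X', Y')) :=
  (k ⊗ₘ s)

lemma pairHom_pairR_eComp {a b m : V} {X X' X'' : C} {Y Y' Y'' : D} (k : a ⟶ (X ⟶[V] X'))
    (s : b ⟶ (Y ⟶[V] Y')) (e : 𝟙_ V ⟶ (X' ⟶[V] X'')) (r : m ⟶ (Y' ⟶[V] Y'')) :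
    (pairHom k s ⊗ₘ pairR e r) ≫ eComp V (X, Y) (X', Y') (X'', Y'') =
      (α_ a b m).hom ≫ ((k ≫ postElt e X) ⊗ₘ ((s ⊗ₘ r) ≫ eComp V Y Y' Y'')) := by
  have h : (k ⊗ₘ s) ▷ m ≫ (α_ _ _ _).hom = (α_ a b m).hom ≫ (k ⊗ₘ (s ▷ m)) := by
    rw [← tensorHom_id, associator_naturality, tensorHom_id]
  rw [MonoidalCategory.tensorHom_def, Category.assoc, whiskerLeft_pairR_eComp]
  have h' := reassoc_of% h
  refine (h' _).trans ?_
  rw [tensorHom_comp_tensorHom, MonoidalCategory.tensorHom_def s r, Category.assoc]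

lemma pairR_pairHom_eComp {a b m : V} {X X' X'' : C} {Y Y' Y'' : D} (k : a ⟶ (X' ⟶[V] X''))
    (s : b ⟶ (Y' ⟶[V] Y'')) (e : 𝟙_ V ⟶ (X ⟶[V] X')) (r : m ⟶ (Y ⟶[V] Y')) :
    (pairR e r ⊗ₘ pairHom k s) ≫ eComp V (X, Y) (X', Y') (X'', Y'') =
      (α_ m a b).inv ≫ (β_ m a).hom ▷ b ≫ (α_ a m b).hom ≫
        ((k ≫ preElt e X'') ⊗ₘ ((r ⊗ₘ s) ≫ eComp V Y Y' Y'')) := by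
  have h : m ◁ (k ⊗ₘ s) ≫ (α_ _ _ _).inv ≫ (β_ _ _).hom ▷ _ ≫ (α_ _ _ _).hom =
      (α_ m a b).inv ≫ (β_ m a).hom ▷ b ≫ (α_ a m b).hom ≫ (k ⊗ₘ (m ◁ s)) := by
    rw [← id_tensorHom, associator_inv_naturality_assoc, ← tensorHom_id,
      tensorHom_comp_tensorHom_assoc, BraidedCategory.braiding_naturality, ← id_tensorHom m s,
      ← associator_naturality, ← tensorHom_id, tensorHom_comp_tensorHom_assoc, Category.id_comp,
      Category.comp_id]
  rw [MonoidalCategory.tensorHom_def', Category.assoc, pairR_whiskerRight_eComp]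
  have h' := reassoc_of% h
  refine (h' _).trans ?_
  rw [tensorHom_comp_tensorHom, MonoidalCategory.tensorHom_def' r s, Category.assoc]

lemma pairHom_pairL_eComp {a b m : V} {X X' X'' : C} {Y Y' Y'' : D} (k : a ⟶ (X ⟶[V] X'))
    (s : b ⟶ (Y ⟶[V] Y')) (r : m ⟶ (X' ⟶[V] X'')) (e : 𝟙_ V ⟶ (Y' ⟶[V] Y'')) :
    (pairHom k s ⊗ₘ pairL r e) ≫ eComp V (X, Y) (X', Y') (X'', Y'') =
      (α_ a b m).hom ≫ a ◁ (β_ b m).hom ≫ (α_ a m b).inv ≫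
        (((k ⊗ₘ r) ≫ eComp V X X' X'') ⊗ₘ (s ≫ postElt e Y)) := by
  have h : (k ⊗ₘ s) ▷ m ≫ (α_ _ _ _).hom ≫ _ ◁ (β_ _ _).hom ≫ (α_ _ _ _).inv =
      (α_ a b m).hom ≫ a ◁ (β_ b m).hom ≫ (α_ a m b).inv ≫ ((k ▷ m) ⊗ₘ s) := by
    rw [← tensorHom_id, associator_naturality_assoc, ← id_tensorHom,
      tensorHom_comp_tensorHom_assoc, BraidedCategory.braiding_naturality, ← tensorHom_id k m,
      ← associator_inv_naturality, ← id_tensorHom, tensorHom_comp_tensorHom_assoc,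
      Category.id_comp, Category.comp_id]
  rw [MonoidalCategory.tensorHom_def, Category.assoc, whiskerLeft_pairL_eComp]
  have h' := reassoc_of% h
  refine (h' _).trans ?_
  rw [tensorHom_comp_tensorHom, MonoidalCategory.tensorHom_def k r, Category.assoc]

lemma pairL_pairHom_eComp {a b m : V} {X X' X'' : C} {Y Y' Y'' : D} (k : a ⟶ (X' ⟶[V] X''))
    (s : b ⟶ (Y' ⟶[V] Y'')) (r : m ⟶ (X ⟶[V] X')) (e : 𝟙_ V ⟶ (Y ⟶[V] Y')) :
    (pairL r e ⊗ₘ pairHom k s) ≫ eComp V (X, Y) (X', Y') (X'', Y'') =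
      (α_ m a b).inv ≫ (((r ⊗ₘ k) ≫ eComp V X X' X'') ⊗ₘ (s ≫ preElt e Y'')) := by
  have h : m ◁ (k ⊗ₘ s) ≫ (α_ _ _ _).inv = (α_ m a b).inv ≫ ((m ◁ k) ⊗ₘ s) := by
    rw [← id_tensorHom, associator_inv_naturality, id_tensorHom]
  rw [MonoidalCategory.tensorHom_def', Category.assoc, pairL_whiskerRight_eComp]
  have h' := reassoc_of% h
  refine (h' _).trans ?_
  rw [tensorHom_comp_tensorHom, MonoidalCategory.tensorHom_def' r k, Category.assoc]

/-- Only the second coordinate carries content: there the square is the hypothesis, while the first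
coordinate composes with identities. The rest is the bookkeeping of moving `m` past `a`. -/
lemma pairR_interchange {a b m : V} {X X' : C} {Y Y₁ Y₂ Y' : D} (k : a ⟶ (X ⟶[V] X'))
    (s : b ⟶ (Y ⟶[V] Y₁)) (r : m ⟶ (Y₁ ⟶[V] Y')) (r' : m ⟶ (Y ⟶[V] Y₂))
    (s' : b ⟶ (Y₂ ⟶[V] Y'))
    (h : (s ⊗ₘ r) ≫ eComp V Y Y₁ Y' = (β_ b m).hom ≫ (r' ⊗ₘ s') ≫ eComp V Y Y₂ Y') :
    (pairHom k s ⊗ₘ pairR (eId V X') r) ≫ eComp V (X, Y) (X', Y₁) (X', Y') =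
      (β_ (a ⊗ b) m).hom ≫ (pairR (eId V X) r' ⊗ₘ pairHom k s') ≫
        eComp V (X, Y) (X, Y₂) (X', Y') := by
  rw [pairHom_pairR_eComp, pairR_pairHom_eComp, h, postElt_eId, preElt_eId,
    BraidedCategory.braiding_tensor_left_hom]
  simp only [Category.assoc, Iso.hom_inv_id_assoc, Category.comp_id]
  rw [← comp_whiskerRight_assoc, SymmetricCategory.symmetry, id_whiskerRight, Category.id_comp,
    Iso.inv_hom_id_assoc, whiskerLeft_comp_tensorHom]

lemma pairL_interchange {a b m : V} {X X₁ X₂ X' : C} {Y Y' : D} (s : b ⟶ (Y ⟶[V] Y'))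
    (k : a ⟶ (X ⟶[V] X₁)) (r : m ⟶ (X₁ ⟶[V] X')) (r' : m ⟶ (X ⟶[V] X₂))
    (k' : a ⟶ (X₂ ⟶[V] X'))
    (h : (k ⊗ₘ r) ≫ eComp V X X₁ X' = (β_ a m).hom ≫ (r' ⊗ₘ k') ≫ eComp V X X₂ X') :
    (pairHom k s ⊗ₘ pairL r (eId V Y')) ≫ eComp V (X, Y) (X₁, Y') (X', Y') =
      (β_ (a ⊗ b) m).hom ≫ (pairL r' (eId V Y) ⊗ₘ pairHom k' s) ≫
        eComp V (X, Y) (X₂, Y) (X', Y') := by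
  rw [pairHom_pairL_eComp, pairL_pairHom_eComp, h, postElt_eId, preElt_eId,
    BraidedCategory.braiding_tensor_left_hom]
  simp only [Category.assoc, Iso.hom_inv_id_assoc, Category.comp_id]
  rw [← whiskerRight_comp_tensorHom]

end PairInterchange

/-! ### The diagonal action of `M` on `Cᵒᵖ ⊗ D`. -/

section Diagonal

variable {V : Type v} [Category.{u} V] [MonoidalCategory V] [SymmetricCategory V]
  {M : Type u₁} {C : Type u₂} {D : Type u₃} [EnrichedCategory V M]
  [MonoidalVCategory V M] [EnrichedCategory V C] [EnrichedCategory V D]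
  (L : MonoidalAction V M C) (R : MonoidalAction V M D)

/-- The `V`-functor `(X, Y) ↦ (K ⊘ X, K' ⊘' Y)`. -/
def diagFunctor (K K' : M) : EnrichedFunctor V (Cᵒᵖ × D) (Cᵒᵖ × D) :=
  prodMap (opFunctor (L.byObj K)) (R.byObj K')

/-- The `V`-functor `(X, Y) ↦ (K ⊘ X, K' ⊘' Y)` on hom-objects. -/
def diagMap (K K' : M) (k k' : Cᵒᵖ × D) :
    (k ⟶[V] k') ⟶ (diag L R k K K' ⟶[V] diag L R k' K K') :=
  (L.byMap K k'.1.unop k.1.unop ⊗ₘ R.byMap K' k.2 k'.2)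

lemma eComp_diagMap (K K' : M) (k k' k'' : Cᵒᵖ × D) :
    eComp V k k' k'' ≫ diagMap L R K K' k k'' =
      (diagMap L R K K' k k' ⊗ₘ diagMap L R K K' k' k'') ≫ eComp V _ _ _ :=
  (diagFunctor L R K K').map_comp k k' k''

lemma preElt_diagMap (K K' : M) {k k' : Cᵒᵖ × D} (g : 𝟙_ V ⟶ (k ⟶[V] k')) (k'' : Cᵒᵖ × D) :
    preElt g k'' ≫ diagMap L R K K' k k'' =
      diagMap L R K K' k' k'' ≫ preElt (g ≫ diagMap L R K K' k k') _ :=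
  preElt_map (diagFunctor L R K K') g k''

lemma pairR_diagMap (K K' : M) {k k' : Cᵒᵖ × D} {W : V} (e : 𝟙_ V ⟶ (k.1 ⟶[V] k'.1))
    (r : W ⟶ (k.2 ⟶[V] k'.2)) :
    pairR e r ≫ diagMap L R K K' k k' =
      pairR (X := (diag L R k K K').1) (X' := (diag L R k' K K').1)
        (e ≫ L.byMap K k'.1.unop k.1.unop) (r ≫ R.byMap K' k.2 k'.2) :=
  pairR_prodMap (opFunctor (L.byObj K)) (R.byObj K') e r

lemma pairL_diagMap (K K' : M) {k k' : Cᵒᵖ × D} {W : V} (r : W ⟶ (k.1 ⟶[V] k'.1))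
    (e : 𝟙_ V ⟶ (k.2 ⟶[V] k'.2)) :
    pairL r e ≫ diagMap L R K K' k k' =
      pairL (X := (diag L R k K K').1) (X' := (diag L R k' K K').1)
        (r ≫ L.byMap K k'.1.unop k.1.unop) (e ≫ R.byMap K' k.2 k'.2) :=
  pairL_prodMap (opFunctor (L.byObj K)) (R.byObj K') r e

/-- The structure isomorphisms `(K ⊗ N) ⊘ X ≅ K ⊘ (N ⊘ X)`, on both components. -/
def mulPair (k : Cᵒᵖ × D) (K K' N N' : M) : 𝟙_ V ⟶
    (diag L R k (tensor.obj (V := V) (K, N)) (tensor.obj (V := V) (K', N')) ⟶[V]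
      diag L R (diag L R k N N') K K') :=
  pairR (X := (diag L R k (tensor.obj (V := V) (K, N)) (tensor.obj (V := V) (K', N'))).1)
    (X' := (diag L R (diag L R k N N') K K').1)
    (L.mulElt K N k.1.unop) (R.mulInvElt K' N' k.2)

/-- The structure isomorphisms `I ⊘ X ≅ X`, on both components. -/
def unitPair (k : Cᵒᵖ × D) : 𝟙_ V ⟶ (diag L R k (unit V) (unit V) ⟶[V] k) :=
  pairR (X := (diag L R k (unit V) (unit V)).1) (X' := k.1)
    (L.unitElt k.1.unop) (R.unitInvElt k.2)

/-- The isomorphism induced by an isomorphism of `M`, on both components. -/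
def isoPair (k : Cᵒᵖ × D) {N N' : M} (e : ForgetEnrichment.of V N ≅ ForgetEnrichment.of V N') :
    𝟙_ V ⟶ (diag L R k N N ⟶[V] diag L R k N' N') :=
  pairR (X := (diag L R k N N).1) (X' := (diag L R k N' N').1)
    (L.onElt k.1.unop e.inv) (R.onElt k.2 e.hom)

/-- Sliding along `N ⟶ N'` and then acting by `K` becomes, after reassociating, sliding along `K ⊗ N
⟶ K ⊗ N'`. The first coordinate meets only identities, and the second is `mulInvElt_natural_mid`. -/
lemma diagR_mulPair (k : Cᵒᵖ × D) (K N N' : M) :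
    diagR L R k N N' ≫ diagMap L R K K _ _ ≫ preElt (mulPair L R k K K N N) _ =
      tensorLeftMap K N N' ≫ diagR L R k _ _ ≫ postElt (mulPair L R k K K N N') _ := by
  have h₁ := pairR_diagMap L R K K (k := diag L R k N N) (k' := diag L R k N N')
    (eId V (op (L.action.obj (N, k.1.unop)))) (R.onMap k.2 N N')
  have h₂ := pairR_preElt (C := Cᵒᵖ) (eId V (op (L.action.obj (K, L.action.obj (N, k.1.unop)))))
    (R.onMap k.2 N N' ≫ R.byMap K _ _) (L.mulElt K N k.1.unop) (R.mulInvElt K N k.2)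
  have h₃ := pairR_postElt (C := Cᵒᵖ) (eId V (op (L.action.obj (tensor.obj (V := V) (K, N),
      k.1.unop))))
    (R.onMap k.2 (tensor.obj (V := V) (K, N)) (tensor.obj (V := V) (K, N')))
    (L.mulElt K N k.1.unop) (R.mulInvElt K N' k.2)
  refine ((Category.assoc _ _ _).symm.trans (congrArg (fun t => t ≫ _) (h₁.trans
    (congrArg (fun t => pairR t _) (L.eId_byMap _ _))))).trans (h₂.trans ?_)
  refine Eq.trans ?_ ((congrArg (fun t => _ ≫ t) h₃).trans (comp_pairR _ _ _)).symm
  rw [compElt_eId, eId_compElt]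
  exact congrArg _ ((Category.assoc _ _ _).trans (R.mulInvElt_natural_mid K N N' k.2))

lemma diagL_mulPair (k : Cᵒᵖ × D) (K N N' : M) :
    diagL L R k N N' ≫ diagMap L R K K _ _ ≫ preElt (mulPair L R k K K N' N') _ =
      tensorLeftMap K N N' ≫ diagL L R k _ _ ≫ postElt (mulPair L R k K K N N') _ := by
  have h₁ := pairL_diagMap L R K K (k := diag L R k N' N') (k' := diag L R k N N')
    (L.onMap k.1.unop N N') (eId V (R.action.obj (N', k.2)))
  have h₂ := pairL_preElt (C := Cᵒᵖ) (X := op (L.action.obj (K, L.action.obj (N', k.1.unop))))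
    (X' := op (L.action.obj (K, L.action.obj (N, k.1.unop))))
    (L.onMap k.1.unop N N' ≫ L.byMap K _ _)
    (eId V (R.action.obj (K, R.action.obj (N', k.2)))) (L.mulElt K N' k.1.unop)
    (R.mulInvElt K N' k.2)
  have h₃ := pairL_postElt (C := Cᵒᵖ)
    (X := op (L.action.obj (tensor.obj (V := V) (K, N'), k.1.unop)))
    (X' := op (L.action.obj (tensor.obj (V := V) (K, N), k.1.unop)))
    (L.onMap k.1.unop (tensor.obj (V := V) (K, N)) (tensor.obj (V := V) (K, N')))
    (eId V (R.action.obj (tensor.obj (V := V) (K, N'), k.2)))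
    (L.mulElt K N k.1.unop) (R.mulInvElt K N' k.2)
  refine ((Category.assoc _ _ _).symm.trans (congrArg (fun t => t ≫ _) (h₁.trans
    (congrArg (fun t => pairL _ t) (R.eId_byMap _ _))))).trans (h₂.trans ?_)
  refine Eq.trans ?_ ((congrArg (fun t => _ ≫ t) h₃).trans (comp_pairL _ _ _)).symm
  rw [compElt_eId, eId_compElt]
  refine congrArg (fun t => pairL t _) ?_
  rw [preElt_op, postElt_op]
  exact (Category.assoc _ _ _).trans (L.mulElt_natural_mid K N N' k.1.unop)

/-- Here the acting object `K` varies instead of `N`: its slide on `N ⊘ -` turns into a slide along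
`K ⊗ N ⟶ K' ⊗ N`. -/
lemma diagR_diag_mulPair (k : Cᵒᵖ × D) (K K' N : M) :
    diagR L R (diag L R k N N) K K' ≫ preElt (mulPair L R k K K N N) _ =
      tensorRightMap K K' N ≫ diagR L R k _ _ ≫ postElt (mulPair L R k K K' N N) _ := by
  have h₂ := pairR_preElt (C := Cᵒᵖ) (eId V (op (L.action.obj (K, L.action.obj (N, k.1.unop)))))
    (R.onMap (R.action.obj (N, k.2)) K K') (L.mulElt K N k.1.unop) (R.mulInvElt K N k.2)
  have h₃ := pairR_postElt (C := Cᵒᵖ)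
    (eId V (op (L.action.obj (tensor.obj (V := V) (K, N), k.1.unop))))
    (R.onMap k.2 (tensor.obj (V := V) (K, N)) (tensor.obj (V := V) (K', N)))
    (L.mulElt K N k.1.unop) (R.mulInvElt K' N k.2)
  refine h₂.trans ?_
  refine Eq.trans ?_ ((congrArg (fun t => _ ≫ t) h₃).trans (comp_pairR _ _ _)).symm
  rw [compElt_eId, eId_compElt]
  exact congrArg _ (R.mulInvElt_natural_left K K' N k.2)

lemma diagL_diag_mulPair (k : Cᵒᵖ × D) (K K' N : M) :
    diagL L R (diag L R k N N) K K' ≫ preElt (mulPair L R k K' K' N N) _ =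
      tensorRightMap K K' N ≫ diagL L R k _ _ ≫ postElt (mulPair L R k K K' N N) _ := by
  have h₂ := pairL_preElt (C := Cᵒᵖ) (X := op (L.action.obj (K', L.action.obj (N, k.1.unop))))
    (X' := op (L.action.obj (K, L.action.obj (N, k.1.unop))))
    (L.onMap (L.action.obj (N, k.1.unop)) K K')
    (eId V (R.action.obj (K', R.action.obj (N, k.2)))) (L.mulElt K' N k.1.unop)
    (R.mulInvElt K' N k.2)
  have h₃ := pairL_postElt (C := Cᵒᵖ)
    (X := op (L.action.obj (tensor.obj (V := V) (K', N), k.1.unop)))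
    (X' := op (L.action.obj (tensor.obj (V := V) (K, N), k.1.unop)))
    (L.onMap k.1.unop (tensor.obj (V := V) (K, N)) (tensor.obj (V := V) (K', N)))
    (eId V (R.action.obj (tensor.obj (V := V) (K', N), k.2)))
    (L.mulElt K N k.1.unop) (R.mulInvElt K' N k.2)
  refine h₂.trans ?_
  refine Eq.trans ?_ ((congrArg (fun t => _ ≫ t) h₃).trans (comp_pairL _ _ _)).symm
  rw [compElt_eId, eId_compElt]
  refine congrArg (fun t => pairL t _) ?_
  rw [preElt_op, postElt_op]
  exact L.mulElt_natural_left K K' N k.1.unop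

/-- Bifunctoriality of the action on `D`, with the first coordinate carried along unchanged. -/
lemma diagR_interchange (k k' : Cᵒᵖ × D) (K K' : M) :
    (diagMap L R K K k k' ⊗ₘ diagR L R k' K K') ≫ eComp V _ _ _ =
      (β_ _ _).hom ≫ (diagR L R k K K' ⊗ₘ diagMap L R K K' k k') ≫ eComp V _ _ _ :=
  pairR_interchange (C := Cᵒᵖ) (X := op (L.action.obj (K, k.1.unop)))
    (X' := op (L.action.obj (K, k'.1.unop))) (L.byMap K k'.1.unop k.1.unop) _ _ _ _
    (insert_interchange R.action K K' k.2 k'.2)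

lemma diagL_interchange (k k' : Cᵒᵖ × D) (K K' : M) :
    (diagMap L R K' K' k k' ⊗ₘ diagL L R k' K K') ≫ eComp V _ _ _ =
      (β_ _ _).hom ≫ (diagL L R k K K' ⊗ₘ diagMap L R K K' k k') ≫ eComp V _ _ _ := by
  refine pairL_interchange (C := Cᵒᵖ) (X := op (L.action.obj (K', k.1.unop)))
    (X₁ := op (L.action.obj (K', k'.1.unop))) (X₂ := op (L.action.obj (K, k.1.unop)))
    (X' := op (L.action.obj (K, k'.1.unop))) (R.byMap K' k.2 k'.2) _ _ _ _ ?_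
  -- The first coordinate lives in `Cᵒᵖ`, so the interchange law of the action on `C` is needed
  -- backwards; unfolding both opposite compositions produces the braidings that reverse it.
  rw [eComp_op_eq, eComp_op_eq]
  refine (BraidedCategory.braiding_naturality_assoc _ _ _).trans ?_
  refine congrArg (fun t => _ ≫ t) ?_
  refine Eq.trans ?_ (BraidedCategory.braiding_naturality_assoc _ _ _).symm
  refine Eq.trans ?_ (congrArg (fun t => _ ≫ t)
    (insert_interchange L.action K K' k'.1.unop k.1.unop)).symm
  exact (SymmetricCategory.symmetry_assoc _ _ _).symm

lemma diagMap_unitPair (k k' : Cᵒᵖ × D) :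
    diagMap L R (unit V) (unit V) k k' ≫ postElt (unitPair L R k') _ =
      preElt (unitPair L R k) k' := by
  have h₁ := postElt_pair (C := Cᵒᵖ) (X := op (L.action.obj (unit V, k'.1.unop))) (X' := k'.1)
    (L.unitElt k'.1.unop) (R.unitInvElt k'.2) (op (L.action.obj (unit V, k.1.unop)))
    (R.action.obj (unit V, k.2))
  have h₂ := preElt_pair (C := Cᵒᵖ) (X := op (L.action.obj (unit V, k.1.unop))) (X' := k.1)
    (L.unitElt k.1.unop) (R.unitInvElt k.2) k'.1 k'.2
  refine (congrArg (fun t => _ ≫ t) h₁).trans (Eq.trans ?_ h₂.symm)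
  refine (tensorHom_comp_tensorHom _ _ _ _).trans ?_
  exact congrArg₂ (fun s t => (s ⊗ₘ t))
    ((congrArg (fun t => _ ≫ t) (postElt_op _ _)).trans
      ((L.unitElt_natural _ _).symm.trans (preElt_op _ _).symm))
    (R.unitInvElt_natural _ _).symm

lemma diagMap_mulPair (k k' : Cᵒᵖ × D) (K N : M) :
    diagMap L R (tensor.obj (V := V) (K, N)) (tensor.obj (V := V) (K, N)) k k' ≫
        postElt (mulPair L R k' K K N N) _ =
      diagMap L R N N k k' ≫ diagMap L R K K _ _ ≫ preElt (mulPair L R k K K N N) _ := by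
  have h₁ := postElt_pair (C := Cᵒᵖ)
    (X := op (L.action.obj (tensor.obj (V := V) (K, N), k'.1.unop)))
    (X' := op (L.action.obj (K, L.action.obj (N, k'.1.unop))))
    (L.mulElt K N k'.1.unop) (R.mulInvElt K N k'.2)
    (op (L.action.obj (tensor.obj (V := V) (K, N), k.1.unop)))
    (R.action.obj (tensor.obj (V := V) (K, N), k.2))
  have h₂ := preElt_pair (C := Cᵒᵖ)
    (X := op (L.action.obj (tensor.obj (V := V) (K, N), k.1.unop)))
    (X' := op (L.action.obj (K, L.action.obj (N, k.1.unop))))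
    (L.mulElt K N k.1.unop) (R.mulInvElt K N k.2)
    (op (L.action.obj (K, L.action.obj (N, k'.1.unop)))) (R.action.obj (K, R.action.obj (N, k'.2)))
  refine (congrArg (fun t => _ ≫ t) h₁).trans (Eq.trans ?_ (congrArg (fun t =>
    diagMap L R N N k k' ≫ diagMap L R K K (diag L R k N N) (diag L R k' N N) ≫ t) h₂).symm)
  have h₃ := tensorHom_comp_tensorHom (L.byMap K (L.action.obj (N, k'.1.unop))
      (L.action.obj (N, k.1.unop))) (R.byMap K (R.action.obj (N, k.2)) (R.action.obj (N, k'.2)))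
    (preElt (E := Cᵒᵖ) (X := op (L.action.obj (tensor.obj (V := V) (K, N), k.1.unop)))
      (Y := op (L.action.obj (K, L.action.obj (N, k.1.unop)))) (L.mulElt K N k.1.unop)
      (op (L.action.obj (K, L.action.obj (N, k'.1.unop)))))
    (preElt (R.mulInvElt K N k.2) (R.action.obj (K, R.action.obj (N, k'.2))))
  refine (tensorHom_comp_tensorHom _ _ _ _).trans (Eq.trans ?_
    ((congrArg (fun t => diagMap L R N N k k' ≫ t) h₃).trans
      (tensorHom_comp_tensorHom _ _ _ _)).symm)
  exact congrArg₂ (fun s t => (s ⊗ₘ t))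
    ((congrArg (fun t => _ ≫ t) (postElt_op _ _)).trans
      ((L.mulElt_natural_right K N _ _).symm.trans
        (congrArg (fun t => L.byMap N _ _ ≫ L.byMap K _ _ ≫ t) (preElt_op _ _).symm)))
    (R.mulInvElt_natural_right K N _ _).symm

end Diagonal

/-! ### Inverse global elements. -/

section Inverses

variable {V : Type v} [Category.{u} V] [MonoidalCategory V] {E : Type u₁} [EnrichedCategory V E]

lemma elt_inv_unique {X Y : E} {f : 𝟙_ V ⟶ (X ⟶[V] Y)} {g h : 𝟙_ V ⟶ (Y ⟶[V] X)}
    (h₁ : compElt h f = eId V Y) (h₂ : compElt f g = eId V X) : h = g := by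
  rw [← compElt_eId h, ← h₂, ← compElt_assoc, h₁, eId_compElt]

lemma compElt_inverse {X Y Z : E} {f : 𝟙_ V ⟶ (X ⟶[V] Y)} {f' : 𝟙_ V ⟶ (Y ⟶[V] X)}
    {g : 𝟙_ V ⟶ (Y ⟶[V] Z)} {g' : 𝟙_ V ⟶ (Z ⟶[V] Y)} (hf : compElt f f' = eId V X)
    (hg : compElt g g' = eId V Y) : compElt (compElt f g) (compElt g' f') = eId V X := by
  rw [compElt_assoc, ← compElt_assoc g, hg, eId_compElt, hf]

lemma compElt_cancel {X Y Z : E} (f : 𝟙_ V ⟶ (X ⟶[V] Y)) {g : 𝟙_ V ⟶ (Y ⟶[V] Z)}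
    {g' : 𝟙_ V ⟶ (Z ⟶[V] Y)} (hg : compElt g g' = eId V Y) : compElt (compElt f g) g' = f := by
  rw [compElt_assoc, hg, compElt_eId]

lemma homTo_comp_comp {X Y Z W : ForgetEnrichment V E} (f : X ⟶ Y) (g : Y ⟶ Z) (h : Z ⟶ W) :
    ForgetEnrichment.homTo V (f ≫ g ≫ h) = compElt (ForgetEnrichment.homTo V f)
      (compElt (ForgetEnrichment.homTo V g) (ForgetEnrichment.homTo V h)) := by
  rw [homTo_comp', homTo_comp']

end Inverses

/-! ### Coherence of an action, for the structure maps and for their inverses. -/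

namespace MonoidalAction

variable {V : Type v} [Category.{u} V] [MonoidalCategory V] [BraidedCategory V]
  {M : Type u₁} {C : Type u₂} [EnrichedCategory V M] [MonoidalVCategory V M]
  [EnrichedCategory V C] (L : MonoidalAction V M C)

lemma onElt_hom_inv {N N' : M} (A : C) (e : ForgetEnrichment.of V N ≅ ForgetEnrichment.of V N') :
    compElt (L.onElt A e.hom) (L.onElt A e.inv) = eId V (L.action.obj (N, A)) := by
  rw [onElt_comp, e.hom_inv_id, onElt_id]

lemma onElt_inv_hom {N N' : M} (A : C) (e : ForgetEnrichment.of V N ≅ ForgetEnrichment.of V N') :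
    compElt (L.onElt A e.inv) (L.onElt A e.hom) = eId V (L.action.obj (N', A)) := by
  rw [onElt_comp, e.inv_hom_id, onElt_id]

lemma mulElt_mulInvElt (K N : M) (A : C) :
    compElt (L.mulElt K N A) (L.mulInvElt K N A) = eId V _ := L.mulIso.homElt_invElt ((K, N), A)

lemma mulInvElt_mulElt (K N : M) (A : C) :
    compElt (L.mulInvElt K N A) (L.mulElt K N A) = eId V _ := L.mulIso.invElt_homElt ((K, N), A)

lemma unitInvElt_unitElt (A : C) :
    compElt (L.unitInvElt A) (L.unitElt A) = eId V (L.action.obj (unit V, A)) :=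
  L.unitIso.invElt_homElt A

lemma byMap_inverse (N : M) {A A' : C} {f : 𝟙_ V ⟶ (A ⟶[V] A')} {g : 𝟙_ V ⟶ (A' ⟶[V] A)}
    (h : compElt f g = eId V A) :
    compElt (f ≫ L.byMap N A A') (g ≫ L.byMap N A' A) = eId V (L.action.obj (N, A)) := by
  refine (compElt_map (L.byObj N) f g).symm.trans ?_
  rw [h]
  exact L.eId_byMap N A

lemma unitElt_mulElt_onElt (N : M) (A : C) :
    compElt (compElt (L.unitElt (L.action.obj (N, A))) (L.mulElt (unit V) N A))
      (L.onElt A (leftUnitor.iso N).hom) = eId V (L.action.obj (N, A)) := by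
  have h := congrArg (ForgetEnrichment.homTo V) (L.left_unitality N A)
  rw [compElt_assoc]
  refine (congrArg (fun t => compElt _ (compElt _ t)) (L.homTo_vBimap_id A _).symm).trans ?_
  exact (homTo_comp_comp _ _ _).symm.trans (h.trans (ForgetEnrichment.homTo_id V _))

/-- The axiom says that this composite followed by the action of the left unitor is the identity, so
it is the inverse of the latter. Inverting the same axiom gives the next lemma; the first form
serves the contravariant coordinate and the second the covariant one. -/
lemma unitElt_mulElt (N : M) (A : C) :
    compElt (L.unitElt (L.action.obj (N, A))) (L.mulElt (unit V) N A) =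
      L.onElt A (leftUnitor.iso N).inv :=
  elt_inv_unique (L.unitElt_mulElt_onElt N A) (L.onElt_hom_inv A (leftUnitor.iso N))

lemma mulInvElt_unitInvElt (N : M) (A : C) :
    compElt (L.mulInvElt (unit V) N A) (L.unitInvElt (L.action.obj (N, A))) =
      L.onElt A (leftUnitor.iso N).hom :=
  elt_inv_unique (compElt_inverse (L.mulInvElt_mulElt _ N A) (L.unitInvElt_unitElt _))
    (L.unitElt_mulElt_onElt N A)

lemma map_unitElt_mulElt_onElt (N : M) (A : C) :
    compElt (compElt (L.unitElt A ≫ L.byMap N _ _) (L.mulElt N (unit V) A))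
      (L.onElt A (rightUnitor.iso N).hom) = eId V (L.action.obj (N, A)) := by
  have h := congrArg (ForgetEnrichment.homTo V) (L.right_unitality N A)
  rw [compElt_assoc]
  refine (congrArg₂ (fun s t => compElt s (compElt _ t))
    (L.homTo_id_vBimap N (L.unitIso.iso A).hom).symm (L.homTo_vBimap_id A _).symm).trans ?_
  exact (homTo_comp_comp _ _ _).symm.trans (h.trans (ForgetEnrichment.homTo_id V _))

lemma map_unitElt_mulElt (N : M) (A : C) :
    compElt (L.unitElt A ≫ L.byMap N _ _) (L.mulElt N (unit V) A) =
      L.onElt A (rightUnitor.iso N).inv :=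
  elt_inv_unique (L.map_unitElt_mulElt_onElt N A) (L.onElt_hom_inv A (rightUnitor.iso N))

lemma mulInvElt_map_unitInvElt (N : M) (A : C) :
    compElt (L.mulInvElt N (unit V) A) (L.unitInvElt A ≫ L.byMap N _ _) =
      L.onElt A (rightUnitor.iso N).hom :=
  elt_inv_unique (compElt_inverse (L.mulInvElt_mulElt N _ A)
    (L.byMap_inverse N (L.unitInvElt_unitElt A))) (L.map_unitElt_mulElt_onElt N A)

lemma mulElt_mulElt_onElt (K N N' : M) (A : C) :
    compElt (compElt (L.mulElt K N (L.action.obj (N', A))) (L.mulElt (tensor.obj (V := V) (K,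
      N)) N' A))
        (L.onElt A (associator.iso ((K, N), N')).hom) =
      compElt (L.mulElt N N' A ≫ L.byMap K _ _) (L.mulElt K (tensor.obj (V := V) (N, N')) A) := by
  have h := congrArg (ForgetEnrichment.homTo V) (L.associativity K N N' A)
  rw [compElt_assoc]
  refine (congrArg (fun t => compElt _ (compElt _ t)) (L.homTo_vBimap_id A _).symm).trans ?_
  refine (homTo_comp_comp _ _ _).symm.trans (h.trans ((homTo_comp' _ _).trans ?_))
  exact congrArg (fun t => compElt t _) (L.homTo_id_vBimap K (L.mulIso.iso ((N, N'), A)).hom)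

lemma mulElt_mulElt (K N N' : M) (A : C) :
    compElt (L.mulElt K N (L.action.obj (N', A))) (L.mulElt (tensor.obj (V := V) (K, N)) N' A) =
      compElt (compElt (L.mulElt N N' A ≫ L.byMap K _ _)
        (L.mulElt K (tensor.obj (V := V) (N, N')) A))
        (L.onElt A (associator.iso ((K, N), N')).inv) := by
  exact (compElt_cancel _ (L.onElt_hom_inv A (associator.iso ((K, N), N')))).symm.trans
    (congrArg (fun t => compElt t _) (L.mulElt_mulElt_onElt K N N' A))

/-- The associativity axiom inverted: both sides are inverses of the same composite of forward maps.
-/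
lemma mulInvElt_mulInvElt (K N N' : M) (A : C) :
    compElt (L.mulInvElt (tensor.obj (V := V) (K, N)) N' A)
        (L.mulInvElt K N (L.action.obj (N', A))) =
      compElt (L.onElt A (associator.iso ((K, N), N')).hom)
        (compElt (L.mulInvElt K (tensor.obj (V := V) (N, N')) A)
          (L.mulInvElt N N' A ≫ L.byMap K _ _)) := by
  refine elt_inv_unique (compElt_inverse (L.mulInvElt_mulElt (tensor.obj (V := V) (K, N)) N' A)
    (L.mulInvElt_mulElt K N (L.action.obj (N', A)))) ?_
  refine (compElt_assoc _ _ _).symm.trans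
    ((congrArg (fun t => compElt t _) (L.mulElt_mulElt_onElt K N N' A)).trans ?_)
  exact compElt_inverse (L.byMap_inverse K (L.mulElt_mulInvElt N N' A)) (L.mulElt_mulInvElt _ _ A)

end MonoidalAction

/-! ### The coherence laws in both coordinates at once. -/

section Diagonal

variable {V : Type v} [Category.{u} V] [MonoidalCategory V] [SymmetricCategory V]
  {M : Type u₁} {C : Type u₂} {D : Type u₃} [EnrichedCategory V M]
  [MonoidalVCategory V M] [EnrichedCategory V C] [EnrichedCategory V D]
  (L : MonoidalAction V M C) (R : MonoidalAction V M D)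

/-- The composite is not an identity, but only the effect of the left unitor on the index. The next
two lemmas do the same for the right unitor and the associator. -/
lemma mulPair_unitPair (k : Cᵒᵖ × D) (N : M) :
    compElt (mulPair L R k (unit V) (unit V) N N) (unitPair L R (diag L R k N N)) =
      isoPair L R k (leftUnitor.iso N) := by
  refine (compElt_pair _ _ _ _).trans ?_
  exact congrArg₂ (fun s t => pairR s t)
    ((compElt_op _ _).trans (L.unitElt_mulElt N k.1.unop)) (R.mulInvElt_unitInvElt N k.2)

lemma mulPair_map_unitPair (k : Cᵒᵖ × D) (N : M) :
    compElt (mulPair L R k N N (unit V) (unit V)) (unitPair L R k ≫ diagMap L R N N _ _) =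
      isoPair L R k (rightUnitor.iso N) := by
  refine (congrArg (fun t => compElt _ t) (pairR_diagMap L R N N _ _)).trans ?_
  refine (compElt_pair _ _ _ _).trans ?_
  exact congrArg₂ (fun s t => pairR s t)
    ((compElt_op _ _).trans (L.map_unitElt_mulElt N k.1.unop)) (R.mulInvElt_map_unitInvElt N k.2)

lemma mulPair_mulPair (k : Cᵒᵖ × D) (K N N' : M) :
    compElt (mulPair L R k (tensor.obj (V := V) (K, N)) (tensor.obj (V := V) (K, N)) N' N')
        (mulPair L R (diag L R k N' N') K K N N) =
      compElt (isoPair L R k (associator.iso ((K, N), N')))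
        (compElt (mulPair L R k K K (tensor.obj (V := V) (N, N')) (tensor.obj (V := V) (N, N')))
          (mulPair L R k N N N' N' ≫ diagMap L R K K _ _)) := by
  refine (compElt_pair _ _ _ _).trans ?_
  refine Eq.trans ?_ (congrArg (fun t => compElt _ (compElt _ t))
    (pairR_diagMap L R K K _ _)).symm
  refine Eq.trans ?_ (congrArg (fun t => compElt _ t) (compElt_pair _ _ _ _)).symm
  refine Eq.trans ?_ (compElt_pair _ _ _ _).symm
  refine congrArg₂ (fun s t => pairR s t) ?_ (R.mulInvElt_mulInvElt K N N' k.2)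
  refine (compElt_op _ _).trans ((L.mulElt_mulElt K N N' k.1.unop).trans ?_)
  exact ((congrArg (fun t => compElt _ t) (compElt_op _ _)).trans (compElt_op _ _)).symm

end Diagonal

/-! ### Invariance of optics under isomorphisms of the index. -/

section Relation

variable {V : Type v} [Category.{u} V] [MonoidalCategory V] [SymmetricCategory V]
  [MonoidalClosed V]
  {M : Type u₁} {C : Type u₂} {D : Type u₃} [EnrichedCategory V M]
  [MonoidalVCategory V M] [EnrichedCategory V C] [EnrichedCategory V D]
  (L : MonoidalAction V M C) (R : MonoidalAction V M D)
  [∀ (A S : C) (B T : D), HasVCoend (opticDiagram L R A B S T)]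

/-- The coend relation lets `e.hom` cross from one coordinate to the other, where it cancels against
`e.inv`. This is what absorbs the unitors and associators of `M`. -/
lemma isoPair_opticIn (a k : Cᵒᵖ × D) {N N' : M}
    (e : ForgetEnrichment.of V N ≅ ForgetEnrichment.of V N') :
    preElt (isoPair L R a e) k ≫ opticIn L R a k N = opticIn L R a k N' := by
  have hR : ForgetEnrichment.homTo V e.hom ≫ diagR L R a N N' =
      pairR (eId V (op (L.action.obj (N, a.1.unop)))) (R.onElt a.2 e.hom) := comp_pairR _ _ _
  have hL : ForgetEnrichment.homTo V e.hom ≫ diagL L R a N N' =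
      pairL (X := op (L.action.obj (N', a.1.unop))) (X' := op (L.action.obj (N, a.1.unop)))
        (L.onElt a.1.unop e.hom) (eId V (R.action.obj (N', a.2))) := comp_pairL _ _ _
  have h : preElt (ForgetEnrichment.homTo V e.hom ≫ diagR L R a N N') k ≫ opticIn L R a k N =
      preElt (ForgetEnrichment.homTo V e.hom ≫ diagL L R a N N') k ≫ opticIn L R a k N' := by
    simp only [preElt, comp_whiskerRight, Category.assoc, opticIn_condition]
  -- `w` undoes `e` in the first coordinate only. After it, the `diagR` side of the relation becomes
  -- `isoPair` and the `diagL` side an identity.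
  let w : 𝟙_ V ⟶ (diag L R a N N' ⟶[V] diag L R a N' N') :=
    pairR (X := op (L.action.obj (N, a.1.unop))) (X' := op (L.action.obj (N', a.1.unop)))
      (L.onElt a.1.unop e.inv) (eId V (R.action.obj (N', a.2)))
  have h' := congrArg (fun t => preElt w k ≫ t) h
  have h₁ : compElt (ForgetEnrichment.homTo V e.hom ≫ diagR L R a N N') w = isoPair L R a e := by
    rw [hR]
    refine (compElt_pair _ _ _ _).trans ?_
    rw [eId_compElt, compElt_eId]
    rfl
  have h₂ : compElt (ForgetEnrichment.homTo V e.hom ≫ diagL L R a N N') w = eId V _ := by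
    rw [hL, pairR_elt_eq_pairL]
    refine (compElt_pair _ _ _ _).trans ?_
    refine congrArg₂ (fun s t => pairR s t) ?_ (compElt_eId _)
    exact (compElt_op _ _).trans (L.onElt_inv_hom _ e)
  rw [reassoc_of% preElt_preElt, reassoc_of% preElt_preElt, h₁, h₂, preElt_eId,
      Category.id_comp] at h'
  exact h'

end Relation

/-! ### Transporting composites along global elements. -/

section Composition

variable {V : Type v} [Category.{u} V] [MonoidalCategory V] {E : Type u₁} [EnrichedCategory V E]
  {E' : Type u₂} [EnrichedCategory V E']

lemma whiskerRight_eComp_eComp {m : V} {X Y : E} (r : m ⟶ (X ⟶[V] Y)) (Z W : E) :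
    (r ▷ (Y ⟶[V] Z) ≫ eComp V X Y Z) ▷ (Z ⟶[V] W) ≫ eComp V X Z W =
      (α_ _ _ _).hom ≫ m ◁ eComp V Y Z W ≫ r ▷ (Y ⟶[V] W) ≫ eComp V X Y W := by
  rw [comp_whiskerRight, Category.assoc, ← e_assoc', whisker_exchange_assoc]
  monoidal

/-- In diagrammatic order: from `p r = r₁ q` follows `p (r s) = r₁ (q s)`. In the applications `p`
and `q` are reassociations and `r`, `r₁` are slides before and after them. The next lemma is the
same with a functor applied to the composite first. -/
lemma tensorHom_eComp_preElt {m m' : V} {X Y Z : E} (r : m ⟶ (X ⟶[V] Y)) (s : m' ⟶ (Y ⟶[V] Z))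
    {X₁ Y₁ : E} (p : 𝟙_ V ⟶ (X₁ ⟶[V] X)) (q : 𝟙_ V ⟶ (Y₁ ⟶[V] Y)) (r₁ : m ⟶ (X₁ ⟶[V] Y₁))
    (h : r ≫ preElt p Y = r₁ ≫ postElt q X₁) :
    (r ⊗ₘ s) ≫ eComp V X Y Z ≫ preElt p Z =
      m ◁ (s ≫ preElt q Z) ≫ r₁ ▷ (Y₁ ⟶[V] Z) ≫ eComp V X₁ Y₁ Z := by
  rw [← preElt_eComp, MonoidalCategory.tensorHom_def', Category.assoc, ← comp_whiskerRight_assoc,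
    h, comp_whiskerRight_assoc, postElt_eComp, ← whisker_exchange_assoc,
    MonoidalCategory.whiskerLeft_comp, Category.assoc]

lemma whiskerRight_eComp_map_preElt (F : EnrichedFunctor V E E') {m : V} {X Y : E}
    (r : m ⟶ (X ⟶[V] Y)) (Z : E) {X₁ Y₁ : E'} (p : 𝟙_ V ⟶ (X₁ ⟶[V] F.obj X))
    (q : 𝟙_ V ⟶ (Y₁ ⟶[V] F.obj Y)) (r₁ : m ⟶ (X₁ ⟶[V] Y₁))
    (h : r ≫ F.map X Y ≫ preElt p (F.obj Y) = r₁ ≫ postElt q X₁) :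
    r ▷ (Y ⟶[V] Z) ≫ eComp V X Y Z ≫ F.map X Z ≫ preElt p (F.obj Z) =
      m ◁ (F.map Y Z ≫ preElt q (F.obj Z)) ≫ r₁ ▷ (Y₁ ⟶[V] F.obj Z) ≫
        eComp V X₁ Y₁ (F.obj Z) := by
  rw [F.map_comp_assoc, whiskerRight_comp_tensorHom_assoc]
  exact tensorHom_eComp_preElt _ _ _ _ _ ((Category.assoc _ _ _).trans h)

end Composition

/-! ### Optics with a fixed focus: profunctor and Tambara structure. -/

section OpticFunctor

variable {V : Type v} [Category.{u} V] [MonoidalCategory V] [SymmetricCategory V]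
  [MonoidalClosed V] {M : Type u₁} {C : Type u₂} {D : Type u₃} [EnrichedCategory V M]
  [MonoidalVCategory V M] [EnrichedCategory V C] [EnrichedCategory V D]
  (L : MonoidalAction V M C) (R : MonoidalAction V M D)
  [∀ (A S : C) (B T : D), HasVCoend (opticDiagram L R A B S T)] (a : Cᵒᵖ × D)

/-- The action of `Cᵒᵖ ⊗ D` on the objects of optics. -/
def opticAct (k k' : Cᵒᵖ × D) : opticObj L R a k ⊗ (k ⟶[V] k') ⟶ opticObj L R a k' :=
  opticDescRight L R a k (fun N => eComp V (diag L R a N N) k k' ≫ opticIn L R a k' N)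
    (fun N N' => by
      -- The coend relation acts by precomposition and `k ⟶ k'` by postcomposition; associativity
      -- makes them independent.
      rw [reassoc_of% whiskerRight_eComp_eComp, reassoc_of% whiskerRight_eComp_eComp,
        opticIn_condition])

lemma opticIn_opticAct (k k' : Cᵒᵖ × D) (N : M) :
    opticIn L R a k N ▷ (k ⟶[V] k') ≫ opticAct L R a k k' =
      eComp V (diag L R a N N) k k' ≫ opticIn L R a k' N :=
  opticIn_descRight _ _ _ _ _ _ _

/-- The profunctor of optics with focus `a`. -/
def opticFunctor : EnrichedFunctor V (Cᵒᵖ × D) V :=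
  ofAct (opticObj L R a) (opticAct L R a)
    (fun k => whiskerRight_optic_hom_ext fun N => by
      rw [← whisker_exchange_assoc, opticIn_opticAct, rightUnitor_naturality]
      refine (Category.assoc _ _ _).symm.trans (congrArg (fun t => t ≫ _) ?_)
      exact ((Iso.inv_comp_eq _).1 (e_comp_id V _ k)).trans (Category.comp_id _))
    (fun k k' k'' => whiskerRight_optic_hom_ext fun N => by
      rw [← whisker_exchange_assoc, opticIn_opticAct, associator_inv_naturality_left_assoc,
        ← comp_whiskerRight_assoc, opticIn_opticAct, comp_whiskerRight_assoc, opticIn_opticAct,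
        ← e_assoc_assoc])

lemma act_opticFunctor (k k' : Cᵒᵖ × D) : act (opticFunctor L R a) k k' = opticAct L R a k k' :=
  act_ofAct _ _ _ _ k k'

/-- The action of a global element on the objects of optics. -/
def opticActElt {k k' : Cᵒᵖ × D} (g : 𝟙_ V ⟶ (k ⟶[V] k')) :
    opticObj L R a k ⟶ opticObj L R a k' :=
  (ρ_ _).inv ≫ opticObj L R a k ◁ g ≫ opticAct L R a k k'

lemma actElt_opticFunctor {k k' : Cᵒᵖ × D} (g : 𝟙_ V ⟶ (k ⟶[V] k')) :
    actElt (opticFunctor L R a) g = opticActElt L R a g :=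
  congrArg (fun t => (ρ_ (opticObj L R a k)).inv ≫ opticObj L R a k ◁ g ≫ t)
    (act_opticFunctor L R a k k')

lemma opticIn_opticActElt {k k' : Cᵒᵖ × D} (g : 𝟙_ V ⟶ (k ⟶[V] k')) (N : M) :
    opticIn L R a k N ≫ opticActElt L R a g =
      postElt g (diag L R a N N) ≫ opticIn L R a k' N := by
  rw [opticActElt, postElt, rightUnitor_inv_naturality_assoc, ← whisker_exchange_assoc,
    opticIn_opticAct, Category.assoc, Category.assoc]

/-- The Tambara structure on the profunctor of optics. -/
def opticStr (K : M) (k : Cᵒᵖ × D) : opticObj L R a k ⟶ opticObj L R a (diag L R k K K) :=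
  -- On the summand at `N`: act by `K` on both coordinates, reassociate, and land in the summand at
  -- `K ⊗ N`.
  opticDesc L R a k (fun N => diagMap L R K K (diag L R a N N) k ≫
    preElt (mulPair L R a K K N N) (diag L R k K K) ≫
      opticIn L R a (diag L R k K K) (tensor.obj (V := V) (K, N))) (fun N N' => by
    -- `h₁` and `h₂` turn the two legs at `(N, N')` into the two legs at `(K ⊗ N, K ⊗ N')`, which
    -- the coend relation `h₃` identifies.
    have h₁ := whiskerRight_eComp_map_preElt (diagFunctor L R K K) (diagR L R a N N') k
      (mulPair L R a K K N N) (mulPair L R a K K N N')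
      (tensorLeftMap K N N' ≫ diagR L R a (tensor.obj (V := V) (K, N)) (tensor.obj (V := V) (K,
        N')))
      ((diagR_mulPair L R a K N N').trans (Category.assoc _ _ _).symm)
    have h₂ := whiskerRight_eComp_map_preElt (diagFunctor L R K K) (diagL L R a N N') k
      (mulPair L R a K K N' N') (mulPair L R a K K N N')
      (tensorLeftMap K N N' ≫ diagL L R a (tensor.obj (V := V) (K, N)) (tensor.obj (V := V) (K,
        N')))
      ((diagL_mulPair L R a K N N').trans (Category.assoc _ _ _).symm)
    have h₃ := opticIn_condition L R a (diag L R k K K) (tensor.obj (V := V) (K, N))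
      (tensor.obj (V := V) (K, N'))
    have h₁' := reassoc_of% h₁
    have h₂' := reassoc_of% h₂
    refine (h₁' _).trans (Eq.trans ?_ (h₂' _).symm)
    refine congrArg (fun t => _ ≫ t) ?_
    rw [comp_whiskerRight, comp_whiskerRight, Category.assoc, Category.assoc]
    exact congrArg (fun t => _ ≫ t) h₃)

lemma opticIn_opticStr (K : M) (k : Cᵒᵖ × D) (N : M) :
    opticIn L R a k N ≫ opticStr L R a K k = diagMap L R K K (diag L R a N N) k ≫
      preElt (mulPair L R a K K N N) (diag L R k K K) ≫
        opticIn L R a (diag L R k K K) (tensor.obj (V := V) (K, N)) :=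
  opticIn_desc _ _ _ _ _ _ _

/-- A common normal form on a summand, shared by naturality and dinaturality of the structure: only
a composite of `diagMap` with `g` has to be compared. -/
lemma opticIn_opticStr_opticAct {x : V} (H : M) {k k' : Cᵒᵖ × D}
    (g : x ⟶ (diag L R k H H ⟶[V] k')) (N : M) :
    opticIn L R a k N ▷ x ≫ opticStr L R a H k ▷ x ≫ opticObj L R a (diag L R k H H) ◁ g ≫
        opticAct L R a (diag L R k H H) k' =
      (diagMap L R H H (diag L R a N N) k ⊗ₘ g) ≫ eComp V _ _ _ ≫
        preElt (mulPair L R a H H N N) k' ≫ opticIn L R a k' (tensor.obj (V := V) (H, N)) := by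
  rw [← comp_whiskerRight_assoc, opticIn_opticStr, comp_whiskerRight, comp_whiskerRight]
  simp only [Category.assoc]
  rw [← whisker_exchange_assoc, opticIn_opticAct, ← whisker_exchange_assoc,
      reassoc_of% preElt_eComp,
    MonoidalCategory.tensorHom_def, Category.assoc]

lemma opticStr_natural (K : M) (k k' : Cᵒᵖ × D) :
    opticAct L R a k k' ≫ opticStr L R a K k' =
      opticStr L R a K k ▷ (k ⟶[V] k') ≫ opticObj L R a (diag L R k K K) ◁ diagMap L R K K k k' ≫
        opticAct L R a (diag L R k K K) (diag L R k' K K) := by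
  refine whiskerRight_optic_hom_ext fun N => ?_
  rw [opticIn_opticStr_opticAct, reassoc_of% opticIn_opticAct, opticIn_opticStr,
      reassoc_of% eComp_diagMap]

/-- On the summand at `N`, interchange brings the slide along `K ⟶ K'` in front of `diagMap`,
reassociation turns it into a slide along `K ⊗ N ⟶ K' ⊗ N`, and the coend relation finishes. -/
lemma opticStr_dinatural (K K' : M) (k : Cᵒᵖ × D) :
    opticStr L R a K k ▷ (K ⟶[V] K') ≫ opticObj L R a (diag L R k K K) ◁ diagR L R k K K' ≫
        opticAct L R a (diag L R k K K) (diag L R k K K') =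
      opticStr L R a K' k ▷ (K ⟶[V] K') ≫ opticObj L R a (diag L R k K' K') ◁ diagL L R k K K' ≫
        opticAct L R a (diag L R k K' K') (diag L R k K K') := by
  refine whiskerRight_optic_hom_ext fun N => ?_
  refine (opticIn_opticStr_opticAct L R a K _ N).trans (Eq.trans ?_
      (opticIn_opticStr_opticAct L R a K' _ N).symm)
  have h₁ := tensorHom_eComp_preElt (diagR L R (diag L R a N N) K K')
    (diagMap L R K K' (diag L R a N N) k) (mulPair L R a K K N N) (mulPair L R a K K' N N)
    (tensorRightMap K K' N ≫ diagR L R a (tensor.obj (V := V) (K, N)) (tensor.obj (V := V) (K', N)))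
    ((diagR_diag_mulPair L R a K K' N).trans (Category.assoc _ _ _).symm)
  have h₂ := tensorHom_eComp_preElt (diagL L R (diag L R a N N) K K')
    (diagMap L R K K' (diag L R a N N) k) (mulPair L R a K' K' N N) (mulPair L R a K K' N N)
    (tensorRightMap K K' N ≫ diagL L R a (tensor.obj (V := V) (K, N)) (tensor.obj (V := V) (K', N)))
    ((diagL_diag_mulPair L R a K K' N).trans (Category.assoc _ _ _).symm)
  have h₃ := opticIn_condition L R a (diag L R k K K') (tensor.obj (V := V) (K, N))
    (tensor.obj (V := V) (K', N))
  have i₁ := reassoc_of% (diagR_interchange L R (diag L R a N N) k K K')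
  have i₂ := reassoc_of% (diagL_interchange L R (diag L R a N N) k K K')
  have h₁' := reassoc_of% h₁
  have h₂' := reassoc_of% h₂
  refine (i₁ _).trans (Eq.trans ?_ (i₂ _).symm)
  refine congrArg (fun t => _ ≫ t) ?_
  refine (h₁' _).trans (Eq.trans ?_ (h₂' _).symm)
  refine congrArg (fun t => _ ≫ t) ?_
  rw [comp_whiskerRight, comp_whiskerRight, Category.assoc, Category.assoc]
  exact congrArg (fun t => _ ≫ t) h₃

/-- Naturality of the unit isomorphism reduces the composite to the inclusion at `I ⊗ N` preceded by
the left unitor, which the coend does not see. -/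
lemma opticStr_unit (k : Cᵒᵖ × D) :
    opticStr L R a (unit V) k ≫ opticActElt L R a (unitPair L R k) =
      𝟙 (opticObj L R a k) := by
  refine optic_hom_ext fun N => ?_
  refine ((reassoc_of% (opticIn_opticStr L R a _ k N)) _).trans ?_
  refine (congrArg (fun t => _ ≫ _ ≫ t) (opticIn_opticActElt L R a _ _)).trans ?_
  rw [reassoc_of% preElt_postElt]
  have h := reassoc_of% (diagMap_unitPair L R (diag L R a N N) k)
  refine (h _).trans ?_
  rw [reassoc_of% preElt_preElt, mulPair_unitPair]
  exact (isoPair_opticIn L R a k (leftUnitor.iso N)).trans (Category.comp_id _).symm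

lemma opticStr_tensor (K N : M) (k : Cᵒᵖ × D) :
    opticStr L R a (tensor.obj (V := V) (K, N)) k ≫
        opticActElt L R a (mulPair L R k K K N N) =
      opticStr L R a N k ≫ opticStr L R a K (diag L R k N N) := by
  refine optic_hom_ext fun N' => ?_
  refine ((reassoc_of% (opticIn_opticStr L R a _ k N')) _).trans ?_
  refine (congrArg (fun t => _ ≫ _ ≫ t) (opticIn_opticActElt L R a _ _)).trans ?_
  rw [reassoc_of% preElt_postElt]
  have h := reassoc_of% (diagMap_mulPair L R (diag L R a N' N') k K N)
  refine (h _).trans ?_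
  -- The two ways of reassociating `K`, `N`, `N'` differ by the associator of `M`, which
  -- `isoPair_opticIn` absorbs below.
  have h' := congrArg (fun t => preElt t (diag L R (diag L R k N N) K K))
    (mulPair_mulPair L R a K N N')
  have h'' := (preElt_preElt _ _ _).trans (h'.trans ((preElt_preElt _ _ _).symm.trans
    (congrArg (fun t => t ≫ _) (preElt_preElt _ _ _).symm)))
  refine (congrArg (fun t => _ ≫ _ ≫ t) ((Category.assoc _ _ _).symm.trans
    ((congrArg (fun t => t ≫ _) h'').trans ((Category.assoc _ _ _).trans
    (congrArg (fun t => _ ≫ t) (isoPair_opticIn L R a _ (associator.iso ((K, N), N')))))))).trans ?_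
  rw [reassoc_of% opticIn_opticStr, opticIn_opticStr, reassoc_of% preElt_diagMap]
  exact congrArg (fun t => _ ≫ _ ≫ t) (Category.assoc _ _ _)

end OpticFunctor

/-! ### The curried Tambara axioms as equations between actions. -/

section CurriedConditions

variable {V : Type v} [Category.{u} V] [MonoidalCategory V] [SymmetricCategory V]
  [MonoidalClosed V] {J : Type u₁} [EnrichedCategory V J]

lemma map_ihom_map_iff (P : EnrichedFunctor V J V) (F : EnrichedFunctor V J J) (X Y : J)
    (s : P.obj X ⟶ P.obj (F.obj X)) (s' : P.obj Y ⟶ P.obj (F.obj Y)) :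
    P.map X Y ≫ (ihom (P.obj X)).map s' =
        (F.comp V P).map X Y ≫ (MonoidalClosed.pre s).app (P.obj (F.obj Y)) ↔
      act P X Y ≫ s' = s ▷ (X ⟶[V] Y) ≫ P.obj (F.obj X) ◁ F.map X Y ≫
        act P (F.obj X) (F.obj Y) := by
  rw [← MonoidalClosed.uncurry_injective.eq_iff, MonoidalClosed.uncurry_natural_right]
  have h := (MonoidalClosed.uncurry_pre_app (f := (F.comp V P).map X Y) (g := s)).trans
    (congrArg (fun t => _ ≫ t) (act_comp F P X Y))
  exact ⟨fun h' => h'.trans h, fun h' => h'.trans h.symm⟩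

variable {M : Type u₂} {C : Type u₃} {D : Type u₄} [EnrichedCategory V M]
  [MonoidalVCategory V M] [EnrichedCategory V C] [EnrichedCategory V D]
  (L : MonoidalAction V M C) (R : MonoidalAction V M D)

/-- Dinaturality is stated with maps into internal homs; uncurried, it compares the actions of
`diagR` and `diagL`, the same data that define the optic coend. -/
lemma wedge_iff_act (P : EnrichedFunctor V (Cᵒᵖ × D) V) (k : Cᵒᵖ × D) (N N' : M) {W : V}
    (s : W ⟶ P.obj (diag L R k N N)) (s' : W ⟶ P.obj (diag L R k N' N')) :
    s ≫ wedgeLeft ((prodMap (opFunctor (L.onObj k.1.unop)) (R.onObj k.2)).comp V P) N N' =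
        s' ≫ wedgeRight ((prodMap (opFunctor (L.onObj k.1.unop)) (R.onObj k.2)).comp V P) N N' ↔
      s ▷ (N ⟶[V] N') ≫ P.obj (diag L R k N N) ◁ diagR L R k N N' ≫
          act P (diag L R k N N) (diag L R k N N') =
        s' ▷ (N ⟶[V] N') ≫ P.obj (diag L R k N' N') ◁ diagL L R k N N' ≫
          act P (diag L R k N' N') (diag L R k N N') := by
  -- A partial functor pairs its morphism with an identity of `M`, which is sent to an identity;
  -- what remains is `diagR`, and likewise `diagL` in `hL`.
  have hR : ((λ_ (N ⟶[V] N')).inv ≫ eId V (op N) ▷ (N ⟶[V] N')) ≫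
      (prodMap (opFunctor (L.onObj k.1.unop)) (R.onObj k.2)).map (op N, N) (op N, N') =
        diagR L R k N N' := by
    have h₁ : (λ_ (N ⟶[V] N')).inv ≫ eId V (op N) ▷ (N ⟶[V] N') =
        pairR (eId V (op N)) (𝟙 (N ⟶[V] N')) := by rw [pairR, tensorHom_id]
    refine (congrArg (fun t => t ≫ _) h₁).trans ((pairR_prodMap _ _ _ _).trans ?_)
    exact congrArg₂ (fun s t => pairR s t) ((opFunctor (L.onObj k.1.unop)).map_id (op N))
      (Category.id_comp _)
  have hL : ((ρ_ (N ⟶[V] N')).inv ≫ (N ⟶[V] N') ◁ eId V N') ≫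
      (prodMap (opFunctor (L.onObj k.1.unop)) (R.onObj k.2)).map (op N', N') (op N, N') =
        diagL L R k N N' := by
    have h₁ : (ρ_ (N ⟶[V] N')).inv ≫ (N ⟶[V] N') ◁ eId V N' =
        pairL (C := Mᵒᵖ) (X := op N') (X' := op N) (𝟙 (N ⟶[V] N')) (eId V N') := by
      rw [pairL]; exact congrArg (fun t => _ ≫ t) (id_tensorHom _ _).symm
    refine (congrArg (fun t => t ≫ _) h₁).trans ((pairL_prodMap _ _ _ _).trans ?_)
    exact congrArg₂ (fun s t => pairL s t) (Category.id_comp _) ((R.onObj k.2).map_id N')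
  have h₁ : act ((insertLeft (op N)).comp V
      ((prodMap (opFunctor (L.onObj k.1.unop)) (R.onObj k.2)).comp V P)) N N' =
        P.obj (diag L R k N N) ◁ diagR L R k N N' ≫ act P (diag L R k N N) (diag L R k N N') := by
    refine (act_comp _ _ _ _).trans ((congrArg (fun t => _ ≫ t) (act_comp _ _ _ _)).trans ?_)
    refine (MonoidalCategory.whiskerLeft_comp_assoc _ _ _ _).symm.trans ?_
    exact congrArg (fun t => P.obj (diag L R k N N) ◁ t ≫ _) hR
  have h₂ : act ((insertRight N').comp V
      ((prodMap (opFunctor (L.onObj k.1.unop)) (R.onObj k.2)).comp V P)) (op N') (op N) =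
        P.obj (diag L R k N' N') ◁ diagL L R k N N' ≫
          act P (diag L R k N' N') (diag L R k N N') := by
    refine (act_comp _ _ _ _).trans ((congrArg (fun t => _ ≫ t) (act_comp _ _ _ _)).trans ?_)
    refine (MonoidalCategory.whiskerLeft_comp_assoc _ _ _ _).symm.trans ?_
    exact congrArg (fun t => P.obj (diag L R k N' N') ◁ t ≫ _) hL
  have h₃ := (comp_curry_braiding s (act ((insertLeft (op N)).comp V
      ((prodMap (opFunctor (L.onObj k.1.unop)) (R.onObj k.2)).comp V P)) N N')).trans
        (congrArg (fun t => MonoidalClosed.curry ((β_ _ _).hom ≫ s ▷ _ ≫ t)) h₁)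
  have h₄ := (comp_curry_braiding s' (act ((insertRight N').comp V
      ((prodMap (opFunctor (L.onObj k.1.unop)) (R.onObj k.2)).comp V P)) (op N') (op N))).trans
        (congrArg (fun t => MonoidalClosed.curry ((β_ _ _).hom ≫ s' ▷ _ ≫ t)) h₂)
  constructor
  · intro h
    exact (cancel_epi _).1 (MonoidalClosed.curry_injective (h₃.symm.trans (h.trans h₄)))
  · intro h
    exact h₃.trans (Eq.trans (congrArg (fun t => MonoidalClosed.curry ((β_ _ _).hom ≫ t)) h)
      h₄.symm)

lemma profMap_eq_actElt (P : EnrichedFunctor V (Cᵒᵖ × D) V) {A A' : C} {B B' : D}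
    (f : ForgetEnrichment.of V A' ⟶ ForgetEnrichment.of V A)
    (g : ForgetEnrichment.of V B ⟶ ForgetEnrichment.of V B') :
    profMap P f g = actElt P (pairR (C := Cᵒᵖ) (X := op A) (X' := op A')
      (ForgetEnrichment.homTo V f) (ForgetEnrichment.homTo V g)) := by
  refine Eq.trans ?_ (actElt_eq_uncurry' _ _).symm
  exact congrArg (fun t => MonoidalClosed.uncurry' t) (Category.assoc _ _ _).symm

end CurriedConditions

/-! ### Tambara axioms in action form, and the Tambara module of optics. -/

section OpticModule

variable {V : Type v} [Category.{u} V] [MonoidalCategory V] [SymmetricCategory V]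
  [MonoidalClosed V] {M : Type u₁} {C : Type u₂} {D : Type u₃} [EnrichedCategory V M]
  [MonoidalVCategory V M] [EnrichedCategory V C] [EnrichedCategory V D]
  (L : MonoidalAction V M C) (R : MonoidalAction V M D)

namespace TambaraModule

variable {L R} (P : TambaraModule L R)

/-- The structure morphisms of a Tambara module, indexed by the objects of `Cᵒᵖ ⊗ D`. -/
def strAt (N : M) (k : Cᵒᵖ × D) : P.P.obj k ⟶ P.P.obj (diag L R k N N) :=
  P.str N k.1.unop k.2

lemma act_strAt (N : M) (k k' : Cᵒᵖ × D) :
    act P.P k k' ≫ P.strAt N k' = P.strAt N k ▷ (k ⟶[V] k') ≫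
      P.P.obj (diag L R k N N) ◁ diagMap L R N N k k' ≫
        act P.P (diag L R k N N) (diag L R k' N N) :=
  (map_ihom_map_iff P.P (diagFunctor L R N N) k k' (P.strAt N k) (P.strAt N k')).1
    (P.natural N k k')

lemma strAt_dinatural (N N' : M) (k : Cᵒᵖ × D) :
    P.strAt N k ▷ (N ⟶[V] N') ≫ P.P.obj (diag L R k N N) ◁ diagR L R k N N' ≫
        act P.P (diag L R k N N) (diag L R k N N') =
      P.strAt N' k ▷ (N ⟶[V] N') ≫ P.P.obj (diag L R k N' N') ◁ diagL L R k N N' ≫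
        act P.P (diag L R k N' N') (diag L R k N N') :=
  (wedge_iff_act L R P.P k N N' (P.strAt N k) (P.strAt N' k)).1
    (P.dinatural N N' k.1.unop k.2)

lemma strAt_unit (k : Cᵒᵖ × D) :
    P.strAt (unit V) k ≫ actElt P.P (unitPair L R k) = 𝟙 (P.P.obj k) :=
  (congrArg (fun t => P.strAt (unit V) k ≫ t)
    (profMap_eq_actElt P.P (L.unitIso.iso k.1.unop).hom (R.unitIso.iso k.2).inv)).symm.trans
      (P.str_unit k.1.unop k.2)

lemma strAt_tensor (K N : M) (k : Cᵒᵖ × D) :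
    P.strAt (tensor.obj (V := V) (K, N)) k ≫ actElt P.P (mulPair L R k K K N N) =
      P.strAt N k ≫ P.strAt K (diag L R k N N) :=
  (congrArg (fun t => P.strAt (tensor.obj (V := V) (K, N)) k ≫ t)
    (profMap_eq_actElt P.P (L.mulIso.iso ((K, N), k.1.unop)).hom
      (R.mulIso.iso ((K, N), k.2)).inv)).symm.trans (P.str_tensor K N k.1.unop k.2)

end TambaraModule

variable [∀ (A S : C) (B T : D), HasVCoend (opticDiagram L R A B S T)] (a : Cᵒᵖ × D)

/-- The Tambara module of optics with focus `a`. -/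
def opticModule : TambaraModule L R where
  P := opticFunctor L R a
  str N A B := opticStr L R a N (op A, B)
  natural N X Y := (map_ihom_map_iff (opticFunctor L R a) (diagFunctor L R N N) X Y
    (opticStr L R a N X) (opticStr L R a N Y)).2 (by
      rw [act_opticFunctor, act_opticFunctor]
      exact opticStr_natural L R a N X Y)
  dinatural N N' A B := (wedge_iff_act L R (opticFunctor L R a) (op A, B) N N'
    (opticStr L R a N (op A, B)) (opticStr L R a N' (op A, B))).2 (by
      rw [act_opticFunctor, act_opticFunctor]
      exact opticStr_dinatural L R a N N' (op A, B))
  str_unit A B := (congrArg (fun t => opticStr L R a (unit V) (op A, B) ≫ t)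
    ((profMap_eq_actElt _ _ _).trans (actElt_opticFunctor L R a _))).trans
      (opticStr_unit L R a (op A, B))
  str_tensor K N A B :=
    (congrArg (fun t => opticStr L R a (tensor.obj (V := V) (K, N)) (op A, B) ≫ t)
      ((profMap_eq_actElt _ _ _).trans (actElt_opticFunctor L R a _))).trans
        (opticStr_tensor L R a K N (op A, B))

end OpticModule

/-! ### The action of optics on a Tambara module, and the identity optic. -/

section OpticTransformation

variable {V : Type v} [Category.{u} V] [MonoidalCategory V] [SymmetricCategory V]
  [MonoidalClosed V] {M : Type u₁} {C : Type u₂} {D : Type u₃} [EnrichedCategory V M]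
  [MonoidalVCategory V M] [EnrichedCategory V C] [EnrichedCategory V D]
  {L : MonoidalAction V M C} {R : MonoidalAction V M D}
  [∀ (A S : C) (B T : D), HasVCoend (opticDiagram L R A B S T)] {a : Cᵒᵖ × D}

lemma whiskerLeft_whiskerRight_optic_hom_ext {k : Cᵒᵖ × D} {Z W Y : V}
    {f g : Z ⊗ (opticObj L R a k ⊗ W) ⟶ Y}
    (h : ∀ N, Z ◁ (opticIn L R a k N ▷ W) ≫ f = Z ◁ (opticIn L R a k N ▷ W) ≫ g) : f = g :=
  MonoidalClosed.curry_injective (whiskerRight_optic_hom_ext fun N => by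
    rw [← MonoidalClosed.curry_natural_left, ← MonoidalClosed.curry_natural_left, h])

lemma whiskerLeft_whiskerLeft_optic_hom_ext {k : Cᵒᵖ × D} {Z W Y : V}
    {f g : Z ⊗ (W ⊗ opticObj L R a k) ⟶ Y}
    (h : ∀ N, Z ◁ (W ◁ opticIn L R a k N) ≫ f = Z ◁ (W ◁ opticIn L R a k N) ≫ g) : f = g :=
  MonoidalClosed.curry_injective (whiskerLeft_optic_hom_ext fun N => by
    rw [← MonoidalClosed.curry_natural_left, ← MonoidalClosed.curry_natural_left, h])

namespace TambaraModule

variable (P : TambaraModule L R) (a)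

/-- The action `P(a) ⊗ Optic(a, k) ⟶ P(k)` of optics on a Tambara module. -/
def opticTransform (k : Cᵒᵖ × D) : P.P.obj a ⊗ opticObj L R a k ⟶ P.P.obj k :=
  -- An optic with residual `N` acts by the structure map `P(a) ⟶ P(N ⊘ a)` and then along its
  -- morphism to `k`.
  opticDescLeft L R a k (fun N => P.strAt N a ▷ (diag L R a N N ⟶[V] k) ≫
    act P.P (diag L R a N N) k) (fun N N' => by
      -- Associativity of the action isolates the part of each leg before `k`; the two parts are
      -- then the two sides of dinaturality.
      have key {m : V} (H : M) {y : Cᵒᵖ × D} (r : m ⟶ (diag L R a H H ⟶[V] y)) :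
          P.P.obj a ◁ (r ▷ (y ⟶[V] k) ≫ eComp V _ y k) ≫
              P.strAt H a ▷ (diag L R a H H ⟶[V] k) ≫ act P.P (diag L R a H H) k =
            (α_ _ _ _).inv ≫ (P.strAt H a ▷ m ≫ P.P.obj (diag L R a H H) ◁ r ≫
              act P.P (diag L R a H H) y) ▷ (y ⟶[V] k) ≫ act P.P y k := by
        rw [whisker_exchange_assoc, MonoidalCategory.whiskerLeft_comp, Category.assoc, act_eComp,
          associator_inv_naturality_middle_assoc, associator_inv_naturality_left_assoc]
        simp only [comp_whiskerRight, Category.assoc]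
      rw [key, key, strAt_dinatural])

lemma opticIn_opticTransform (k : Cᵒᵖ × D) (N : M) :
    P.P.obj a ◁ opticIn L R a k N ≫ P.opticTransform a k =
      P.strAt N a ▷ (diag L R a N N ⟶[V] k) ≫ act P.P (diag L R a N N) k :=
  opticIn_descLeft _ _ _ _ _ _ _

lemma opticTransform_act (k k' : Cᵒᵖ × D) :
    (α_ _ _ _).inv ≫ P.opticTransform a k ▷ (k ⟶[V] k') ≫ act P.P k k' =
      P.P.obj a ◁ opticAct L R a k k' ≫ P.opticTransform a k' := by
  refine whiskerLeft_whiskerRight_optic_hom_ext fun N => ?_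
  rw [associator_inv_naturality_middle_assoc, ← comp_whiskerRight_assoc, opticIn_opticTransform,
    ← MonoidalCategory.whiskerLeft_comp_assoc, opticIn_opticAct,
    MonoidalCategory.whiskerLeft_comp_assoc, opticIn_opticTransform, whisker_exchange_assoc,
    act_eComp, associator_inv_naturality_left_assoc, comp_whiskerRight, Category.assoc]

/-- Structure at `K` after structure at `N` is structure at `K ⊗ N` up to reassociation, by the
tensor axiom of `P`; naturality of the structure moves `K` past the action. With
`opticTransform_act`, this makes the action of optics on each element of `P(a)` a morphism of
Tambara modules. -/
lemma opticStr_opticTransform (K : M) (k : Cᵒᵖ × D) :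
    P.P.obj a ◁ opticStr L R a K k ≫ P.opticTransform a (diag L R k K K) =
      P.opticTransform a k ≫ P.strAt K k := by
  refine whiskerLeft_optic_hom_ext fun N => ?_
  rw [reassoc_of% opticIn_opticTransform, ← MonoidalCategory.whiskerLeft_comp_assoc,
      opticIn_opticStr,
    MonoidalCategory.whiskerLeft_comp, MonoidalCategory.whiskerLeft_comp, Category.assoc,
    Category.assoc, opticIn_opticTransform, whisker_exchange_assoc, whisker_exchange_assoc,
    ← actElt_act, whisker_exchange_assoc, ← comp_whiskerRight_assoc, strAt_tensor,
    act_strAt, comp_whiskerRight_assoc]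

variable (L R) in
/-- The identity optic. -/
def idOptic : 𝟙_ V ⟶ opticObj L R a a := unitPair L R a ≫ opticIn L R a a (unit V)

lemma idOptic_opticTransform :
    (ρ_ _).inv ≫ P.P.obj a ◁ idOptic L R a ≫ P.opticTransform a a = 𝟙 (P.P.obj a) := by
  rw [idOptic, MonoidalCategory.whiskerLeft_comp_assoc, opticIn_opticTransform,
    whisker_exchange_assoc, ← rightUnitor_inv_naturality_assoc]
  exact P.strAt_unit a

/-- The identity optic sits in the summand at `I`, so acting on it by an optic at `N` lands in the
summand at `N ⊗ I`, where the right unitor is absorbed. Only the values of `τ` on summands matter,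
so it is kept abstract. -/
lemma idOptic_comp {k : Cᵒᵖ × D} (τ : opticObj L R a a ⊗ opticObj L R a k ⟶ opticObj L R a k)
    (hτ : ∀ N, opticObj L R a a ◁ opticIn L R a k N ≫ τ =
      opticStr L R a N a ▷ (diag L R a N N ⟶[V] k) ≫ opticAct L R a (diag L R a N N) k) :
    (λ_ _).inv ≫ idOptic L R a ▷ opticObj L R a k ≫ τ = 𝟙 (opticObj L R a k) := by
  refine optic_hom_ext fun N => ?_
  have h₁ : unitPair L R a ≫ diagMap L R N N (diag L R a (unit V) (unit V)) a ≫
      preElt (mulPair L R a N N (unit V) (unit V)) (diag L R a N N) =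
        isoPair L R a (rightUnitor.iso N) :=
    (Category.assoc _ _ _).symm.trans ((elt_preElt _ _).trans (mulPair_map_unitPair L R a N))
  have h₂ : idOptic L R a ≫ opticStr L R a N a =
      isoPair L R a (rightUnitor.iso N) ≫
        opticIn L R a (diag L R a N N) (tensor.obj (V := V) (N, unit V)) := by
    refine Eq.trans ?_ (congrArg (fun t => t ≫ opticIn L R a (diag L R a N N)
      (tensor.obj (V := V) (N, unit V))) h₁)
    rw [idOptic, Category.assoc, opticIn_opticStr]
    exact ((Category.assoc _ _ _).trans (congrArg (fun t => _ ≫ t) (Category.assoc _ _ _))).symm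
  have h₃ := (congrArg (fun t => t ▷ (diag L R a N N ⟶[V] k) ≫ opticAct L R a (diag L R a N N) k)
    h₂).trans ((comp_whiskerRight_assoc _ _ _ _).trans
      (congrArg (fun t => _ ≫ t) (opticIn_opticAct L R a (diag L R a N N) k
        (tensor.obj (V := V) (N, unit V)))))
  rw [Category.comp_id, leftUnitor_inv_naturality_assoc, whisker_exchange_assoc, hτ,
    ← comp_whiskerRight_assoc]
  refine (congrArg (fun t => _ ≫ t) h₃).trans ?_
  refine Eq.trans ?_ (isoPair_opticIn L R a k (rightUnitor.iso N))
  exact ((Category.assoc _ _ _).trans (congrArg (fun t => _ ≫ t) (Category.assoc _ _ _))).symm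

lemma idOptic_opticTransform_opticModule (k : Cᵒᵖ × D) :
    (λ_ _).inv ≫ idOptic L R a ▷ opticObj L R a k ≫ (opticModule L R a).opticTransform a k =
      𝟙 (opticObj L R a k) :=
  idOptic_comp a ((opticModule L R a).opticTransform a k) fun N =>
    ((opticModule L R a).opticIn_opticTransform a k N).trans
      (congrArg (fun t => opticStr L R a N a ▷ (diag L R a N N ⟶[V] k) ≫ t)
        (act_opticFunctor L R a (diag L R a N N) k))

end TambaraModule

end OpticTransformation

/-! ### The explicit formula on each summand. -/

section Canonical

variable {V : Type v} [Category.{u} V] [MonoidalCategory V] [SymmetricCategory V]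
  [MonoidalClosed V] {M : Type u₁} {C : Type u₂} {D : Type u₃} [EnrichedCategory V M]
  [MonoidalVCategory V M] [EnrichedCategory V C] [EnrichedCategory V D]
  {L : MonoidalAction V M C} {R : MonoidalAction V M D}
  [∀ (A S : C) (B T : D), HasVCoend (opticDiagram L R A B S T)] (a : Cᵒᵖ × D)

lemma opticIn_curry_opticTransform (P : TambaraModule L R) (k : Cᵒᵖ × D) (N : M) :
    opticIn L R a k N ≫ MonoidalClosed.curry (P.opticTransform a k) =
      P.P.map (diag L R a N N) k ≫ (MonoidalClosed.pre (P.strAt N a)).app (P.P.obj k) := by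
  apply MonoidalClosed.uncurry_injective
  rw [MonoidalClosed.uncurry_pre_app, MonoidalClosed.uncurry_natural_left,
    MonoidalClosed.uncurry_curry]
  exact P.opticIn_opticTransform a k N

end Canonical

/-! ### Naturality of the action in the Tambara module, and the Yoneda map. -/

section Components

variable {V : Type v} [Category.{u} V] [MonoidalCategory V] [SymmetricCategory V]
  [MonoidalClosed V] [HasLimits V] {M C D : Type u} [EnrichedCategory V M]
  [MonoidalVCategory V M] [EnrichedCategory V C] [EnrichedCategory V D]
  {L : MonoidalAction V M C} {R : MonoidalAction V M D}

namespace TambaraModule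

variable (P Q : TambaraModule L R)

/-- The evaluation of the object of morphisms of Tambara modules. -/
def homEv (k : Cᵒᵖ × D) : P.P.obj k ⊗ homObj P Q ⟶ Q.P.obj k :=
  MonoidalClosed.uncurry (homπ P Q k)

lemma homEv_strAt (N : M) (k : Cᵒᵖ × D) :
    homEv P Q k ≫ Q.strAt N k = P.strAt N k ▷ homObj P Q ≫ homEv P Q (diag L R k N N) := by
  refine (MonoidalClosed.uncurry_natural_right _ _).symm.trans ?_
  refine (congrArg MonoidalClosed.uncurry (homπ_condition P Q N k.1.unop k.2)).trans ?_
  exact MonoidalClosed.uncurry_pre_app (f := homπ P Q (diag L R k N N)) (g := P.strAt N k)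

lemma homEv_act (k k' : Cᵒᵖ × D) :
    (α_ _ _ _).inv ≫ homEv P Q k ▷ (k ⟶[V] k') ≫ act Q.P k k' =
      P.P.obj k ◁ (β_ (homObj P Q) (k ⟶[V] k')).hom ≫ (α_ _ _ _).inv ≫
        act P.P k k' ▷ homObj P Q ≫ homEv P Q k' := by
  have h := (natWedge_iff P.P Q.P (homπ P Q) k k').1 (by
    have := Multiequalizer.condition (endIndex (natDiagram P.P Q.P)) (k, k')
    refine (Category.assoc _ _ _).trans (Eq.trans ?_ (Category.assoc _ _ _).symm)
    exact congrArg (fun t => homι P Q ≫ t) this)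
  have h' := congrArg MonoidalClosed.uncurry h
  have h₁ := uncurry_tensorHom_comp (homπ P Q k) (Q.P.map k k')
  have h₂ := uncurry_tensorHom_comp (P.P.map k k') (homπ P Q k')
  have h₃ := (MonoidalClosed.uncurry_natural_left (β_ (k ⟶[V] k') (homObj P Q)).hom
    ((homπ P Q k ⊗ₘ Q.P.map k k') ≫ eComp V (P.P.obj k) (Q.P.obj k) (Q.P.obj k'))).symm.trans
      (h'.trans h₂)
  have h₄ := (congrArg (fun t => P.P.obj k ◁ (β_ (k ⟶[V] k')
      (homObj P Q)).hom ≫ t) h₁).symm.trans h₃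
  rw [← cancel_epi (P.P.obj k ◁ (β_ (k ⟶[V] k') (homObj P Q)).hom)]
  refine h₄.trans ?_
  rw [← MonoidalCategory.whiskerLeft_comp_assoc, SymmetricCategory.symmetry,
    MonoidalCategory.whiskerLeft_id, Category.id_comp]
  rfl

variable [∀ (A S : C) (B T : D), HasVCoend (opticDiagram L R A B S T)] (a : Cᵒᵖ × D)

/-- The action of optics is built from the structure maps and the profunctor action, and morphisms
of Tambara modules commute with both. This is the wedge condition for the optic cone. -/
lemma opticTransform_homEv (k : Cᵒᵖ × D) :
    P.P.obj a ◁ (β_ (homObj P Q) (opticObj L R a k)).hom ≫ (α_ _ _ _).inv ≫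
        P.opticTransform a k ▷ homObj P Q ≫ homEv P Q k =
      (α_ _ _ _).inv ≫ homEv P Q a ▷ opticObj L R a k ≫ Q.opticTransform a k := by
  refine whiskerLeft_whiskerLeft_optic_hom_ext fun N => ?_
  rw [← MonoidalCategory.whiskerLeft_comp_assoc, BraidedCategory.braiding_naturality_right,
    MonoidalCategory.whiskerLeft_comp_assoc, associator_inv_naturality_middle_assoc,
    ← comp_whiskerRight_assoc, opticIn_opticTransform, associator_inv_naturality_right_assoc,
    whisker_exchange_assoc, opticIn_opticTransform, ← comp_whiskerRight_assoc, homEv_strAt]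
  rw [comp_whiskerRight_assoc, ← associator_inv_naturality_left_assoc, comp_whiskerRight_assoc,
    ← associator_inv_naturality_left_assoc, homEv_act, whisker_exchange_assoc]

/-- The morphism `P(a) ⟶ Tamb(Optic(a, -), P)` given by the action of optics. -/
def opticYoneda : P.P.obj a ⟶ homObj (opticModule L R a) P :=
  homLift (opticModule L R a) P (natLift (opticModule L R a).P P.P
    (fun k => MonoidalClosed.curry ((β_ (opticObj L R a k) (P.P.obj a)).hom ≫ P.opticTransform a k))
    (fun k k' => by
      apply MonoidalClosed.uncurry_injective
      refine (MonoidalClosed.uncurry_natural_left _ _).trans ?_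
      refine (congrArg (fun t => _ ≫ t) (uncurry_tensorHom_comp _ _)).trans ?_
      refine Eq.trans ?_ (uncurry_tensorHom_comp _ _).symm
      rw [MonoidalClosed.uncurry_curry, MonoidalClosed.uncurry_curry]
      -- Naturality in `k` is compatibility of the optic action with the profunctor actions, up to
      -- moving `P(a)` past the other factors.
      have h := P.opticTransform_act a k k'
      rw [Iso.inv_comp_eq] at h
      have h₁ : opticObj L R a k ◁ (β_ (k ⟶[V] k') (P.P.obj a)).hom ≫ (α_ _ _ _).inv ≫
          ((β_ (opticObj L R a k) (P.P.obj a)).hom ≫ P.opticTransform a k) ▷ (k ⟶[V] k') ≫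
            act P.P k k' = (α_ _ _ _).inv ≫ opticAct L R a k k' ▷ P.P.obj a ≫
              (β_ (opticObj L R a k') (P.P.obj a)).hom ≫ P.opticTransform a k' := by
        rw [comp_whiskerRight_assoc, h, BraidedCategory.braiding_naturality_left_assoc,
          BraidedCategory.braiding_tensor_left_hom]
        simp only [Category.assoc, Iso.inv_hom_id_assoc]
      refine h₁.trans ?_
      exact congrArg (fun t => (α_ _ _ _).inv ≫ t ▷ P.P.obj a ≫ _)
        (act_opticFunctor L R a k k').symm)) (fun N A B => by
    -- Compatibility with the Tambara structures is `opticStr_opticTransform`.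
    rw [natLift_π, natLift_π]
    apply MonoidalClosed.uncurry_injective
    rw [MonoidalClosed.uncurry_natural_right, MonoidalClosed.uncurry_pre_app,
      MonoidalClosed.uncurry_curry, MonoidalClosed.uncurry_curry]
    have h := P.opticStr_opticTransform a N (op A, B)
    refine Eq.trans ?_ (BraidedCategory.braiding_naturality_left_assoc
      (opticStr L R a N (op A, B)) _ _).symm
    exact (Category.assoc _ _ _).trans (congrArg (fun t => _ ≫ t) h.symm))

lemma opticYoneda_homEv (k : Cᵒᵖ × D) :
    opticObj L R a k ◁ P.opticYoneda a ≫ homEv (opticModule L R a) P k =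
      (β_ _ _).hom ≫ P.opticTransform a k := by
  refine (MonoidalClosed.uncurry_natural_left _ _).symm.trans ?_
  refine (congrArg MonoidalClosed.uncurry
    ((homLift_π _ _ _ _ _).trans (natLift_π _ _ _ _ _))).trans ?_
  exact MonoidalClosed.uncurry_curry _

end TambaraModule

end Components

/-- The Yoneda computation, stripped of everything but objects of `V`. With elements `p` of `X` and
`w` of `W`: since `f p` evaluated at `e` is `p`, `y(p, w) = y((f p)(e), w)`; the wedge condition `h`
rewrites this as `(f p)(x(e, w))`, which is `t'(p, x(e, w))`. In use, `O` and `O'` are objects of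
optics, `H` is the hom-object from the optic module to `P`, and `X`, `X'` are values of `P`. -/
lemma eq_of_braided_wedge {V : Type v} [Category.{u} V] [MonoidalCategory V] [SymmetricCategory V]
    {O O' H W X X' : V} (e : 𝟙_ V ⟶ O) (x : O ⊗ W ⟶ O') (y : X ⊗ W ⟶ X') (f : X ⟶ H)
    (ev : O ⊗ H ⟶ X) (ev' : O' ⊗ H ⟶ X') (t : X ⊗ O ⟶ X) (t' : X ⊗ O' ⟶ X')
    (hev : O ◁ f ≫ ev = (β_ O X).hom ≫ t) (hev' : O' ◁ f ≫ ev' = (β_ O' X).hom ≫ t')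
    (he : (ρ_ X).inv ≫ X ◁ e ≫ t = 𝟙 X)
    (h : O ◁ (β_ H W).hom ≫ (α_ _ _ _).inv ≫ x ▷ H ≫ ev' = (α_ _ _ _).inv ≫ ev ▷ W ≫ y) :
    X ◁ ((λ_ W).inv ≫ e ▷ W ≫ x) ≫ t' = y := by
  have h₁ : (λ_ X).inv ≫ e ▷ X ≫ O ◁ f ≫ ev = 𝟙 X := by
    rw [hev, ← he, BraidedCategory.braiding_naturality_left_assoc, leftUnitor_inv_braiding_assoc]
  have h₂ : O ◁ (f ▷ W) ≫ O ◁ (β_ H W).hom ≫ (α_ _ _ _).inv ≫ x ▷ H ≫ ev' =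
      O ◁ (β_ X W).hom ≫ (α_ _ _ _).inv ≫ x ▷ X ≫ (β_ O' X).hom ≫ t' := by
    rw [← MonoidalCategory.whiskerLeft_comp_assoc, BraidedCategory.braiding_naturality_left,
      MonoidalCategory.whiskerLeft_comp_assoc, associator_inv_naturality_right_assoc,
      whisker_exchange_assoc, hev']
  have h₃ : O ◁ (f ▷ W) ≫ (α_ _ _ _).inv ≫ ev ▷ W ≫ y =
      (α_ _ _ _).inv ≫ (O ◁ f ≫ ev) ▷ W ≫ y := by
    rw [associator_inv_naturality_middle_assoc, comp_whiskerRight_assoc]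
  -- One side of the wedge condition, fed with `e` and `f`, collapses to `y`; `h₅` computes the
  -- other side.
  have h₄ : (λ_ (X ⊗ W)).inv ≫ e ▷ (X ⊗ W) ≫ (α_ _ _ _).inv ≫ (O ◁ f ≫ ev) ▷ W ≫ y = y := by
    rw [associator_inv_naturality_left_assoc, ← comp_whiskerRight_assoc,
      leftUnitor_tensor_inv_assoc, Iso.hom_inv_id_assoc, ← comp_whiskerRight_assoc, h₁,
      id_whiskerRight, Category.id_comp]
  have h₅ : (λ_ (X ⊗ W)).inv ≫ e ▷ (X ⊗ W) ≫ O ◁ (β_ X W).hom ≫ (α_ _ _ _).inv ≫ x ▷ X ≫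
      (β_ O' X).hom ≫ t' = X ◁ ((λ_ W).inv ≫ e ▷ W ≫ x) ≫ t' := by
    rw [← whisker_exchange_assoc, ← leftUnitor_inv_naturality_assoc,
      associator_inv_naturality_left_assoc, leftUnitor_tensor_inv_assoc, Iso.hom_inv_id_assoc,
      ← comp_whiskerRight_assoc, ← comp_whiskerRight_assoc,
      ← BraidedCategory.braiding_naturality_right_assoc, SymmetricCategory.symmetry_assoc,
      Category.assoc]
  rw [← h₅, ← h₂, h, h₃, h₄]

/-! ### The object of optics is the end. -/

section Representation

variable {V : Type v} [Category.{u} V] [MonoidalCategory V] [SymmetricCategory V]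
  [MonoidalClosed V] [HasLimits V] {M C D : Type u} [EnrichedCategory V M]
  [MonoidalVCategory V M] [EnrichedCategory V C] [EnrichedCategory V D]
  (L : MonoidalAction V M C) (R : MonoidalAction V M D) (A S : C) (B T : D)

namespace TambaraModule

lemma evalDiagram_wedge_iff {W : V}
    (k : ∀ P : TambaraModule L R, W ⟶ (ihom (P.P.obj (op A, B))).obj (P.P.obj (op S, T)))
    (P Q : TambaraModule L R) :
    k P ≫ wedgeLeft (evalDiagram L R A B S T) P Q = k Q ≫ wedgeRight (evalDiagram L R A B S T) P Q ↔
      P.P.obj (op A, B) ◁ (β_ (homObj P Q) W).hom ≫ (α_ _ _ _).inv ≫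
          MonoidalClosed.uncurry (k P) ▷ homObj P Q ≫ homEv P Q (op S, T) =
        (α_ _ _ _).inv ≫ homEv P Q (op A, B) ▷ W ≫ MonoidalClosed.uncurry (k Q) := by
  -- `evalDiagram` unfolds to the `natDiagram` of the two evaluation functors, so wedges over it are
  -- natural families between evaluations.
  refine (natWedge_iff (evalAt L R A B) (evalAt L R S T) k P Q).trans ?_
  refine (MonoidalClosed.uncurry_injective.eq_iff).symm.trans ?_
  have h₁ := (MonoidalClosed.uncurry_natural_left (β_ (homObj P Q) W).hom
    ((k P ⊗ₘ homπ P Q (op S, T)) ≫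
      eComp V (P.P.obj (op A, B)) (P.P.obj (op S, T)) (Q.P.obj (op S, T)))).trans
      (congrArg (fun t => _ ≫ t) (uncurry_tensorHom_comp (k P) (homπ P Q (op S, T))))
  have h₂ := uncurry_tensorHom_comp (homπ P Q (op A, B)) (k Q)
  exact ⟨fun h => h₁.symm.trans (h.trans h₂), fun h => h₁.trans (h.trans h₂.symm)⟩

variable [∀ (A S : C) (B T : D), HasVCoend (opticDiagram L R A B S T)]

/-- The cone over the diagram of evaluations given by the object of optics. -/
def opticFork : Multifork (endIndex (evalDiagram L R A B S T)) :=
  Multifork.ofι _ (opticObj L R (op A, B) (op S, T))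
    (fun P => MonoidalClosed.curry (P.opticTransform (op A, B) (op S, T)))
    (fun p => (evalDiagram_wedge_iff L R A S B T (fun P => MonoidalClosed.curry
        (P.opticTransform (op A, B) (op S, T))) p.1 p.2).2 (by
      rw [MonoidalClosed.uncurry_curry, MonoidalClosed.uncurry_curry]
      exact opticTransform_homEv p.1 p.2 (op A, B) (op S, T)))

variable {L R} in
lemma wedge_eq_opticTransform (a s : Cᵒᵖ × D) {W : V} (P : TambaraModule L R)
    (x : opticObj L R a a ⊗ W ⟶ opticObj L R a s) (y : P.P.obj a ⊗ W ⟶ P.P.obj s)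
    (h : opticObj L R a a ◁ (β_ (homObj (opticModule L R a) P) W).hom ≫ (α_ _ _ _).inv ≫
          x ▷ homObj (opticModule L R a) P ≫ homEv (opticModule L R a) P s =
        (α_ _ _ _).inv ≫ homEv (opticModule L R a) P a ▷ W ≫ y) :
    P.P.obj a ◁ ((λ_ W).inv ≫ idOptic L R a ▷ W ≫ x) ≫ P.opticTransform a s = y :=
  eq_of_braided_wedge (idOptic L R a) x y (P.opticYoneda a) (homEv (opticModule L R a) P a)
    (homEv (opticModule L R a) P s) (P.opticTransform a a) (P.opticTransform a s)
    (P.opticYoneda_homEv a a) (P.opticYoneda_homEv a s) (P.idOptic_opticTransform a) h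

/-- The map into the object of optics given by a map to its component at the Tambara module of
optics. -/
def toOptic {W : V} (k : W ⟶ (ihom (opticObj L R (op A, B) (op A, B))).obj
    (opticObj L R (op A, B) (op S, T))) : W ⟶ opticObj L R (op A, B) (op S, T) :=
  (λ_ W).inv ≫ idOptic L R (op A, B) ▷ W ≫ MonoidalClosed.uncurry k

/-- The object of optics is the end of the diagram of evaluations. -/
def isLimitOpticFork : IsLimit (opticFork L R A S B T) :=
  -- The lift uses a single component of the cone, the one at the optic module with focus `(A, B)`,
  -- evaluated at the identity optic; the size of `Tamb` plays no role.
  Multifork.IsLimit.mk _ (fun E => toOptic L R A S B T (E.ι (opticModule L R (op A, B))))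
    (fun E P => by
      apply MonoidalClosed.uncurry_injective
      refine (MonoidalClosed.uncurry_natural_left _ _).trans ?_
      refine (congrArg (fun t => _ ≫ t) (MonoidalClosed.uncurry_curry _)).trans ?_
      -- Only the wedge condition between the optic module and `P` is needed.
      exact wedge_eq_opticTransform (op A, B) (op S, T) P
        (MonoidalClosed.uncurry (E.ι (opticModule L R (op A, B)))) _
        ((evalDiagram_wedge_iff L R A S B T E.ι (opticModule L R (op A, B)) P).1
          (E.condition (opticModule L R (op A, B), P))))
    (fun E m hm => by
      -- Uniqueness: the component of `m` at the optic module, evaluated at the identity optic, is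
      -- `m` followed by an identity.
      have h₁ : m ≫ MonoidalClosed.curry ((opticModule L R (op A, B)).opticTransform
          (op A, B) (op S, T)) = E.ι (opticModule L R (op A, B)) :=
        hm (opticModule L R (op A, B))
      have h₂ := (MonoidalClosed.uncurry_natural_left m (MonoidalClosed.curry
        ((opticModule L R (op A, B)).opticTransform (op A, B) (op S, T)))).trans
          (congrArg (fun t => _ ≫ t) (MonoidalClosed.uncurry_curry _))
      refine Eq.symm ((congrArg (toOptic L R A S B T) h₁).symm.trans ?_)
      refine (congrArg (fun t => (λ_ _).inv ≫ idOptic L R (op A, B) ▷ _ ≫ t) h₂).trans ?_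
      refine (congrArg (fun t => _ ≫ t) (whisker_exchange_assoc _ _ _).symm).trans ?_
      refine (leftUnitor_inv_naturality_assoc _ _).symm.trans ?_
      refine (congrArg (fun t => m ≫ t)
        (idOptic_opticTransform_opticModule (L := L) (R := R) (op A, B) (op S, T))).trans ?_
      exact Category.comp_id m)

end TambaraModule

end Representation

end EnrichedOptics

end

theorem mainTheorem1 {V : Type v} [Category.{u} V] [MonoidalCategory V] [SymmetricCategory V]
    [MonoidalClosed V] [HasLimits V] [HasColimits V]
    {M C D : Type u} [EnrichedCategory V M] [MonoidalVCategory V M]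
    [EnrichedCategory V C] [EnrichedCategory V D]
    (L : MonoidalAction V M C) (R : MonoidalAction V M D) (A S : C) (B T : D) :
    ∃ (_ : HasVEnd (TambaraModule.evalDiagram L R A B S T))
      (i : vEnd (TambaraModule.evalDiagram L R A B S T) ≅ Optic L R A B S T),
      ∀ (N : M) (P : TambaraModule L R),
        opticι L R A B S T N ≫ i.inv ≫ vEndπ (TambaraModule.evalDiagram L R A B S T) P =
          P.P.map (op (L.action.obj (N, A)), R.action.obj (N, B)) (op S, T) ≫
            (MonoidalClosed.pre (P.str N A B)).app (P.P.obj (op S, T)) := by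
  have hl := TambaraModule.isLimitOpticFork L R A S B T
  -- Completeness of `V` covers only small diagrams, so the explicit limit cone supplies the end
  -- over `Tamb`.
  have : HasVEnd (TambaraModule.evalDiagram L R A B S T) := HasLimit.mk ⟨_, hl⟩
  refine ⟨this, (limit.isLimit _).conePointUniqueUpToIso hl, fun N P => ?_⟩
  -- The inverse comparison followed by a projection is a leg of the optic cone, which reduces the
  -- claim to the formula on summands.
  refine (congrArg (fun t => opticι L R A B S T N ≫ t)
    (IsLimit.conePointUniqueUpToIso_inv_comp (limit.isLimit _) hl
      (WalkingMulticospan.left P))).trans ?_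
  exact opticIn_curry_opticTransform (op A, B) P (op S, T) N
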